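/- Let $m,n\ge 0$ be integers. For $i=1,\dots,m+n$ put $\bar i=0$ if $i\le m$ and $\bar i=1$ if $i>m$, and let $e_{ij}$ (of parity $\bar i+\bar j$) be the matrix units of size $m+n$. The double Yangian ${\rm DY}(\mathfrak{gl}_{m|n})$ (of level $0$) is the $h$-adically complete $\mathbb{Z}_2$-graded unital associative algebra over $\mathbb{C}[[h]]$ topologically generated by elements $t_{ij}^{(\pm r)}$ of parity $\bar i+\bar j$, $1\le i,j\le m+n$, $r=1,2,\dots$, subject to the following relations. Put $$t^-_{ij}(u)=\delta_{ij}+h\sum_{r\ge1}t_{ij}^{(r)}u^{-r},\qquad t^+_{ij}(u)=\delta_{ij}-h\sum_{r\ge1}t_{ij}^{(-r)}u^{r-1},\qquad T^\pm(u)=\sum_{i,j}(-1)^{\bar i\bar j+\bar j}e_{ij}\otimes t^\pm_{ij}(u),$$ $$R(u)=1-hPu^{-1},\qquad P=\sum_{i,j}(-1)^{\bar j}\,e_{ij}\otimes e_{ji}.$$ In graded tensor products, with $T_1$, $T_2$ indicating the tensor position, the relations are $$R(u-v)\,T^\pm_1(u)\,T^\pm_2(v)=T^\pm_2(v)\,T^\pm_1(u)\,R(u-v),\qquad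 R(u-v)\,T^-_1(u)\,T^+_2(v)=T^+_2(v)\,T^-_1(u)\,R(u-v),$$ where both sides are multiplied by $u-v$, coefficients are compared, and the common factor $h^2$ of all the resulting relations among the $t_{ij}^{(\pm r)}$ is cancelled. Then the matrices $T^\pm(u)$ are invertible. Write $T^\pm(u)^{-1}=\sum_{i,j}(-1)^{\bar i\bar j+\bar j}e_{ij}\otimes t^{\pm\prime}_{ij}(u)$ and define the quantum Berezinians by $$b^\pm_{m|n}(u)=\sum_{\tau\in\mathfrak S_m}\operatorname{sgn}\tau\; t^\pm_{\tau(1)1}(u)\,t^\pm_{\tau(2)2}(u-h)\cdots t^\pm_{\tau(m)m}(u-(m-1)h)$$ $$\times\sum_{\sigma\in\mathfrak S_n}\operatorname{sgn}\sigma\; t^{\pm\prime}_{m+1,\,m+\sigma(1)}(u-(m-1)h)\,t^{\pm\prime}_{m+2,\,m+\sigma(2)}(u-(m-2)h)\cdots t^{\pm\prime}_{m+n,\,m+\sigma(n)}(u-(m-n)h),$$ where series with superscript $-$ are expanded in powers of $u^{-1}$ and those with superscript $+$ in powers of $u$ (with $h$-adically convergent coefficients). All coefficients of $b^+_{m|n}(u)$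 and of $b^-_{m|n}(u)$ belong to the center of ${\rm DY}(\mathfrak{gl}_{m|n})$. -/

import Mathlib

open scoped PowerSeries

noncomputable section

namespace DoubleYangian

/-! ### The `h`-adic completion of an algebra over `ℂ⟦h⟧`

The formal parameter `h` is `PowerSeries.X : ℂ⟦X⟧`. -/

/-- The formal parameter `h` of the ground ring `ℂ⟦h⟧`. -/
abbrev h : ℂ⟦X⟧ := PowerSeries.X

section Completion

variable (A : Type) [Ring A] [Algebra ℂ⟦X⟧ A]

/-- The ideal `hⁿ A`. -/
def hIdeal (n : ℕ) : Ideal A where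
  carrier := {x | ∃ y : A, x = h ^ n • y}
  add_mem' := by
    rintro _ _ ⟨y, rfl⟩ ⟨z, rfl⟩
    exact ⟨y + z, (smul_add _ _ _).symm⟩
  zero_mem' := ⟨0, (smul_zero _).symm⟩
  smul_mem' := by
    rintro c _ ⟨y, rfl⟩
    exact ⟨c * y, by rw [smul_eq_mul, mul_smul_comm]⟩

instance hIdeal_isTwoSided (n : ℕ) : (hIdeal A n).IsTwoSided :=
  ⟨by
    rintro _ b ⟨y, rfl⟩
    exact ⟨y * b, by rw [smul_mul_assoc]⟩⟩

theorem hIdeal_antitone {k n : ℕ} (hkn : k ≤ n) : hIdeal A n ≤ hIdeal A k := by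
  rintro _ ⟨y, rfl⟩
  exact ⟨h ^ (n - k) • y, by rw [smul_smul, ← pow_add, Nat.add_sub_cancel' hkn]⟩

/-- The projection `A / hⁿ A → A / hᵏ A` for `k ≤ n`. -/
def transition {k n : ℕ} (hkn : k ≤ n) : A ⧸ hIdeal A n →+* A ⧸ hIdeal A k :=
  Ideal.Quotient.factor (hIdeal_antitone A hkn)

/-- The inverse limit of the algebras `A / hⁿ A`, as a subalgebra of their product. -/
def completionSubalgebra : Subalgebra ℂ⟦X⟧ (∀ n : ℕ, A ⧸ hIdeal A n) where
  carrier := {x | ∀ (k n : ℕ) (hkn : k ≤ n), transition A hkn (x n) = x k}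
  mul_mem' := by
    intro x y hx hy k n hkn
    rw [Pi.mul_apply, map_mul, hx k n hkn, hy k n hkn, Pi.mul_apply]
  add_mem' := by
    intro x y hx hy k n hkn
    rw [Pi.add_apply, map_add, hx k n hkn, hy k n hkn, Pi.add_apply]
  algebraMap_mem' := by
    intro r k n hkn
    rfl

/-- The `h`-adic completion of `A`. -/
abbrev Completion : Type := completionSubalgebra A

/-- The canonical map from `A` to its `h`-adic completion. -/
def toCompletion (a : A) : Completion A :=
  ⟨fun _ => Ideal.Quotient.mk _ a, fun _ _ _ => rfl⟩

variable {A}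

/-- The `h`-adically convergent sum `∑_{j ≥ 0} hʲ c_j` in the completion: its image in
`A / hⁿ A` is the finite sum over `j < n`. -/
def hSum (c : ℕ → Completion A) : Completion A :=
  ⟨fun n => ∑ j ∈ Finset.range n, h ^ j • (c j).1 n, by
    have hsmul : ∀ (k n : ℕ) (hkn : k ≤ n) (r : ℂ⟦X⟧) (x : A ⧸ hIdeal A n),
        transition A hkn (r • x) = r • transition A hkn x := by
      intro k n hkn r x
      obtain ⟨a, rfl⟩ := Ideal.Quotient.mk_surjective x
      rfl
    intro k n hkn
    rw [map_sum]
    simp only [hsmul]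
    have hc : ∀ j, transition A hkn ((c j).1 n) = (c j).1 k := fun j => (c j).2 k n hkn
    simp only [hc]
    symm
    apply Finset.sum_subset (Finset.range_mono hkn)
    intro j _ hj
    obtain ⟨a, ha⟩ := Ideal.Quotient.mk_surjective ((c j).1 k)
    rw [← ha]
    have hkj : k ≤ j := by simpa using hj
    change Ideal.Quotient.mk (hIdeal A k) (h ^ j • a) = 0
    rw [Ideal.Quotient.eq_zero_iff_mem]
    exact hIdeal_antitone A hkj ⟨a, rfl⟩⟩

/-- For `f(u) = ∑_{r ≥ 0} a_r u^r` (a power series in `u`), the power series `f(u + c h)`: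
its coefficient of `u^s` is `∑_{j ≥ 0} binom(s + j, s) cʲ hʲ a_{s+j}`. -/
def shiftPlus (c : ℤ) (f : (Completion A)⟦X⟧) : (Completion A)⟦X⟧ :=
  PowerSeries.mk fun s =>
    hSum fun j => ((((s + j).choose s : ℤ) * c ^ j : ℤ) : Completion A) *
      PowerSeries.coeff (s + j) f

/-- For `f(u) = ∑_{r ≥ 0} a_r u^{-r}` (a power series in `u⁻¹`), the series `f(u + c h)`, where
`(u + c h)^{-r} = ∑_{j ≥ 0} binom(-r, j) cʲ hʲ u^{-r-j}`: its coefficient of `u^{-s}` is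
`∑_{r + j = s} binom(-r, j) cʲ hʲ a_r`. -/
def shiftMinus (c : ℤ) (f : (Completion A)⟦X⟧) : (Completion A)⟦X⟧ :=
  PowerSeries.mk fun s =>
    ∑ p ∈ Finset.HasAntidiagonal.antidiagonal s,
      ((Ring.choose (-(p.1 : ℤ)) p.2 * c ^ p.2 : ℤ) : Completion A) *
        h ^ p.2 • PowerSeries.coeff p.1 f

end Completion

/-! ### Generators and generator series -/

/-- The upper index of the series `t⁺_{ij}(u)` and `t⁻_{ij}(u)`. -/
inductive Sgn : Type
  | plus
  | minus

/-- The index set `{1, …, m + n}`: `Sum.inl` is the even part `{1, …, m}` and `Sum.inr` the odd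
part `{m + 1, …, m + n}`. -/
abbrev Idx (m n : ℕ) : Type := Fin m ⊕ Fin n

/-- The parity of an index. -/
def parity {m n : ℕ} : Idx m n → ℕ
  | Sum.inl _ => 0
  | Sum.inr _ => 1

/-- The generators: `Gen.mk .minus r i j` is `t_{ij}^{(r+1)}` (it occurs in `t⁻_{ij}(u)`) and
`Gen.mk .plus r i j` is `t_{ij}^{(-(r+1))}` (it occurs in `t⁺_{ij}(u)`), for `r = 0, 1, 2, …`. -/
structure Gen (m n : ℕ) : Type where
  sgn : Sgn
  r : ℕ
  i : Idx m n
  j : Idx m n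

/-- The free associative algebra over `ℂ⟦h⟧` on the generators. -/
abbrev Free (m n : ℕ) : Type := FreeAlgebra ℂ⟦X⟧ (Gen m n)

/-- The coefficient of `u^a`, `a ∈ ℤ`, in
`t⁻_{ij}(u) = δ_{ij} + h ∑_{r ≥ 1} t_{ij}^{(r)} u^{-r}` and
`t⁺_{ij}(u) = δ_{ij} - h ∑_{r ≥ 1} t_{ij}^{(-r)} u^{r-1}`. -/
def tCoeff {m n : ℕ} (i j : Idx m n) : Sgn → ℤ → Free m n
  | .minus, Int.ofNat a => if a = 0 ∧ i = j then 1 else 0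
  | .minus, Int.negSucc r => h • FreeAlgebra.ι ℂ⟦X⟧ ⟨.minus, r, i, j⟩
  | .plus, Int.ofNat r =>
      (if r = 0 ∧ i = j then 1 else 0) - h • FreeAlgebra.ι ℂ⟦X⟧ ⟨.plus, r, i, j⟩
  | .plus, Int.negSucc _ => 0

/-! ### The `RTT` relations -/

/-- Elements of the graded tensor product `End ℂ^{m|n} ⊗ End ℂ^{m|n} ⊗ Free`: the function `X`
stands for `∑ e_{ij} ⊗ e_{kl} ⊗ X i j k l`. All elements used below are even, that is
`X i j k l` is homogeneous of parity `i + j + k + l`. -/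
abbrev TensorSq (m n : ℕ) : Type := Idx m n → Idx m n → Idx m n → Idx m n → Free m n

/-- The product of two even elements in the graded tensor product, given by
`(e_{ia} ⊗ e_{kb} ⊗ x)(e_{aj} ⊗ e_{bl} ⊗ y) = (-1)^ε e_{ij} ⊗ e_{kl} ⊗ x y`, where
`ε = |e_{aj}| (|e_{kb}| + |x|) + |e_{bl}| |x|` and `|x| = i + a + k + b`. -/
def tensorMul {m n : ℕ} (X Y : TensorSq m n) : TensorSq m n := fun i j k l =>
  ∑ a : Idx m n, ∑ b : Idx m n,
    (-1 : ℂ⟦X⟧) ^ ((parity a + parity j) *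
          ((parity k + parity b) + (parity i + parity a + parity k + parity b)) +
        (parity b + parity l) * (parity i + parity a + parity k + parity b)) •
      (X i a k b * Y a j b l)

/-- The super permutation `P = ∑ e_{ij} ⊗ e_{ji} (-1)^j`. -/
def permP (m n : ℕ) : TensorSq m n := fun i j k l =>
  if k = j ∧ l = i then (-1 : ℂ⟦X⟧) ^ parity j • 1 else 0

/-- The coefficient of `u^a` in `T₁(u) = ∑ (-1)^{ij + j} e_{ij} ⊗ 1 ⊗ t_{ij}(u)`. -/
def T₁ {m n : ℕ} (s : Sgn) (a : ℤ) : TensorSq m n := fun i j k l =>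
  if k = l then (-1 : ℂ⟦X⟧) ^ (parity i * parity j + parity j) • tCoeff i j s a else 0

/-- The coefficient of `v^b` in `T₂(v) = ∑ (-1)^{kl + l} 1 ⊗ e_{kl} ⊗ t_{kl}(v)`. -/
def T₂ {m n : ℕ} (s : Sgn) (b : ℤ) : TensorSq m n := fun i j k l =>
  if i = j then (-1 : ℂ⟦X⟧) ^ (parity k * parity l + parity l) • tCoeff k l s b else 0

/-- The coefficient of `u^a v^b` in
`(u - v - h P) T₁(u) T₂(v) - T₂(v) T₁(u) (u - v - h P)`,
with `T = T^{s₁}` in the variable `u` and `T = T^{s₂}` in the variable `v`. As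
`R(u - v) = 1 - h P (u - v)⁻¹`, this is `u - v` times the difference of the two sides of
`R(u - v) T₁(u) T₂(v) = T₂(v) T₁(u) R(u - v)`. -/
def rttDefect {m n : ℕ} (s₁ s₂ : Sgn) (a b : ℤ) : TensorSq m n :=
  (tensorMul (T₁ s₁ (a - 1)) (T₂ s₂ b) - tensorMul (T₁ s₁ a) (T₂ s₂ (b - 1))
      - h • tensorMul (permP m n) (tensorMul (T₁ s₁ a) (T₂ s₂ b))) -
    (tensorMul (T₂ s₂ b) (T₁ s₁ (a - 1)) - tensorMul (T₂ s₂ (b - 1)) (T₁ s₁ a)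
      - h • tensorMul (tensorMul (T₂ s₂ b) (T₁ s₁ a)) (permP m n))

theorem tCoeff_eq {m n : ℕ} (s : Sgn) (a : ℤ) : ∃ g : Idx m n → Idx m n → Free m n,
    ∀ i j, tCoeff i j s a = (if a = 0 ∧ i = j then 1 else 0) + h • g i j := by
  cases s with
  | plus =>
    cases a with
    | ofNat r =>
      exact ⟨fun i j => -FreeAlgebra.ι ℂ⟦X⟧ ⟨.plus, r, i, j⟩, fun i j => by
        simp [tCoeff, sub_eq_add_neg]⟩
    | negSucc r => exact ⟨0, fun i j => by simp [tCoeff]⟩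
  | minus =>
    cases a with
    | ofNat r => exact ⟨0, fun i j => by simp [tCoeff]⟩
    | negSucc r =>
      exact ⟨fun i j => FreeAlgebra.ι ℂ⟦X⟧ ⟨.minus, r, i, j⟩, fun i j => by simp [tCoeff]⟩

/-- The unit `∑ e_{ii} ⊗ e_{kk} ⊗ 1`. -/
def tensorOne (m n : ℕ) : TensorSq m n := fun i j k l => if i = j ∧ k = l then 1 else 0

theorem even_sign {m n : ℕ} (i : Idx m n) :
    (-1 : ℂ⟦X⟧) ^ (parity i * parity i + parity i) = 1 := by
  cases i <;> simp [parity]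

theorem T₁_eq {m n : ℕ} (s : Sgn) (a : ℤ) : ∃ (c : ℂ⟦X⟧) (G : TensorSq m n),
    T₁ s a = c • tensorOne m n + h • G := by
  obtain ⟨g, hg⟩ := tCoeff_eq (m := m) (n := n) s a
  refine ⟨if a = 0 then 1 else 0, fun i j k l =>
    if k = l then (-1 : ℂ⟦X⟧) ^ (parity i * parity j + parity j) • g i j else 0, ?_⟩
  funext i j k l
  simp only [T₁, tensorOne, Pi.add_apply, Pi.smul_apply, hg]
  by_cases hkl : k = l
  · by_cases hij : i = j
    · subst hij
      by_cases ha : a = 0 <;> simp [hkl, ha, even_sign]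
    · simp [hkl, hij, smul_comm h]
  · simp [hkl]

theorem T₂_eq {m n : ℕ} (s : Sgn) (a : ℤ) : ∃ (c : ℂ⟦X⟧) (G : TensorSq m n),
    T₂ s a = c • tensorOne m n + h • G := by
  obtain ⟨g, hg⟩ := tCoeff_eq (m := m) (n := n) s a
  refine ⟨if a = 0 then 1 else 0, fun i j k l =>
    if i = j then (-1 : ℂ⟦X⟧) ^ (parity k * parity l + parity l) • g k l else 0, ?_⟩
  funext i j k l
  simp only [T₂, tensorOne, Pi.add_apply, Pi.smul_apply, hg]
  by_cases hij : i = j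
  · by_cases hkl : k = l
    · subst hkl
      by_cases ha : a = 0 <;> simp [hij, ha, even_sign]
    · simp [hij, hkl, smul_comm h]
  · simp [hij]

theorem tensorMul_add {m n : ℕ} (X Y Z : TensorSq m n) :
    tensorMul X (Y + Z) = tensorMul X Y + tensorMul X Z := by
  funext i j k l
  simp only [tensorMul, Pi.add_apply, ← Finset.sum_add_distrib]
  exact Finset.sum_congr rfl fun _ _ => Finset.sum_congr rfl fun _ _ => 
    (congrArg _ (mul_add _ _ _)).trans (smul_add _ _ _)

theorem add_tensorMul {m n : ℕ} (X Y Z : TensorSq m n) :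
    tensorMul (X + Y) Z = tensorMul X Z + tensorMul Y Z := by
  funext i j k l
  simp only [tensorMul, Pi.add_apply, ← Finset.sum_add_distrib]
  exact Finset.sum_congr rfl fun _ _ => Finset.sum_congr rfl fun _ _ => 
    (congrArg _ (add_mul _ _ _)).trans (smul_add _ _ _)

theorem tensorMul_smul {m n : ℕ} (c : ℂ⟦X⟧) (X Y : TensorSq m n) :
    tensorMul X (c • Y) = c • tensorMul X Y := by
  funext i j k l
  simp only [tensorMul, Pi.smul_apply, mul_smul_comm, Finset.smul_sum, smul_comm c]

theorem smul_tensorMul {m n : ℕ} (c : ℂ⟦X⟧) (X Y : TensorSq m n) :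
    tensorMul (c • X) Y = c • tensorMul X Y := by
  funext i j k l
  simp only [tensorMul, Pi.smul_apply, smul_mul_assoc, Finset.smul_sum, smul_comm c]

theorem tensorOne_mul {m n : ℕ} (X : TensorSq m n) : tensorMul (tensorOne m n) X = X := by
  funext i j k l
  unfold tensorMul
  rw [Finset.sum_eq_single i, Finset.sum_eq_single k]
  · have he : Even ((parity i + parity j) *
          ((parity k + parity k) + (parity i + parity i + parity k + parity k)) +
        (parity k + parity l) * (parity i + parity i + parity k + parity k)) :=
      ⟨(parity i + parity j) * (parity k + (parity i + parity k)) +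
        (parity k + parity l) * (parity i + parity k), by ring⟩
    simp [tensorOne, he.neg_one_pow]
  · intro b _ hb
    simp [tensorOne, hb.symm]
  · simp
  · intro a _ ha
    simp [tensorOne, ha.symm]
  · simp

theorem tensorMul_one {m n : ℕ} (X : TensorSq m n) : tensorMul X (tensorOne m n) = X := by
  funext i j k l
  unfold tensorMul
  rw [Finset.sum_eq_single j, Finset.sum_eq_single l]
  · have he : Even ((parity j + parity j) *
          ((parity k + parity l) + (parity i + parity j + parity k + parity l)) +
        (parity l + parity l) * (parity i + parity j + parity k + parity l)) :=
      ⟨parity j * ((parity k + parity l) + (parity i + parity j + parity k + parity l)) +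
        parity l * (parity i + parity j + parity k + parity l), by ring⟩
    simp [tensorOne, he.neg_one_pow]
  · intro b _ hb
    simp [tensorOne, hb]
  · simp
  · intro a _ ha
    simp [tensorOne, ha]
  · simp

theorem module_identity {K M : Type} [CommRing K] [AddCommGroup M] [Module K M]
    (h c₁ c₂ c₃ c₄ : K)
    (E P G₁ G₂ G₃ G₄ a₁₃ a₂₄ a₃₁ a₄₂ p₂ p₃ p₂₃ q₃ q₂ q₃₂ : M) :
    (c₃ • (c₁ • E + h • G₁) + h • (c₁ • G₃ + h • a₁₃)
        - (c₄ • (c₂ • E + h • G₂) + h • (c₂ • G₄ + h • a₂₄))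
        - h • (c₃ • (c₂ • P + h • p₂) + h • (c₂ • p₃ + h • p₂₃))) -
      (c₁ • (c₃ • E + h • G₃) + h • (c₃ • G₁ + h • a₃₁)
        - (c₂ • (c₄ • E + h • G₄) + h • (c₄ • G₂ + h • a₄₂))
        - h • (c₂ • (c₃ • P + h • q₃) + h • (c₃ • q₂ + h • q₃₂))) =
    h ^ 2 • ((a₁₃ - a₂₄ - (c₂ • p₃ + c₃ • p₂ + h • p₂₃)) -
        (a₃₁ - a₄₂ - (c₂ • q₃ + c₃ • q₂ + h • q₃₂))) := by
  module

/-- All coefficients of the `RTT` relations are divisible by `h²` in the free algebra. -/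
theorem exists_smul_eq_rttDefect {m n : ℕ} (s₁ s₂ : Sgn) (a b : ℤ) (i j k l : Idx m n) :
    ∃ x : Free m n, h ^ 2 • x = rttDefect s₁ s₂ a b i j k l := by
  obtain ⟨c₁, G₁, h₁⟩ := T₁_eq (m := m) (n := n) s₁ (a - 1)
  obtain ⟨c₂, G₂, h₂⟩ := T₁_eq (m := m) (n := n) s₁ a
  obtain ⟨c₃, G₃, h₃⟩ := T₂_eq (m := m) (n := n) s₂ b
  obtain ⟨c₄, G₄, h₄⟩ := T₂_eq (m := m) (n := n) s₂ (b - 1)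
  set P := permP m n with hP
  have key : rttDefect (m := m) (n := n) s₁ s₂ a b = h ^ 2 •
      ((tensorMul G₁ G₃ - tensorMul G₂ G₄
          - (c₂ • tensorMul P G₃ + c₃ • tensorMul P G₂ + h • tensorMul P (tensorMul G₂ G₃))) -
        (tensorMul G₃ G₁ - tensorMul G₄ G₂
          - (c₂ • tensorMul G₃ P + c₃ • tensorMul G₂ P
            + h • tensorMul (tensorMul G₃ G₂) P))) := by
    rw [rttDefect, h₁, h₂, h₃, h₄, ← hP]
    simp only [tensorMul_add, add_tensorMul, tensorMul_smul, smul_tensorMul, tensorOne_mul,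
      tensorMul_one]
    exact module_identity h c₁ c₂ c₃ c₄ (tensorOne m n) P G₁ G₂ G₃ G₄
      (tensorMul G₁ G₃) (tensorMul G₂ G₄) (tensorMul G₃ G₁) (tensorMul G₄ G₂)
      (tensorMul P G₂) (tensorMul P G₃) (tensorMul P (tensorMul G₂ G₃))
      (tensorMul G₃ P) (tensorMul G₂ P) (tensorMul (tensorMul G₃ G₂) P)
  exact ⟨_, (congrFun (congrFun (congrFun (congrFun key i) j) k) l).symm⟩

/-- The defining relations: the `RTT` relations for `(T⁺, T⁺)`, `(T⁻, T⁻)` and `(T⁻, T⁺)`,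
coefficient by coefficient. Every coefficient is divisible by `h²` in the free algebra (see
`exists_smul_eq_rttDefect`), and the relations are imposed after this common factor is cancelled,
as in `[t_{ij}^{(r+1)}, t_{kl}^{(s)}] - [t_{ij}^{(r)}, t_{kl}^{(s+1)}] = ⋯`. -/
def Relation (m n : ℕ) (x y : Free m n) : Prop :=
  y = 0 ∧ ∃ s₁ s₂ : Sgn, (s₁ = s₂ ∨ (s₁ = .minus ∧ s₂ = .plus)) ∧
    ∃ (a b : ℤ) (i j k l : Idx m n), h ^ 2 • x = rttDefect s₁ s₂ a b i j k l

/-- The algebra over `ℂ⟦h⟧` with the above generators and relations. -/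
abbrev Presented (m n : ℕ) : Type := RingQuot (Relation m n)

/-- The double Yangian `DY(gl_{m|n})`: the `h`-adic completion of the presented algebra. -/
abbrev DY (m n : ℕ) : Type := Completion (Presented m n)

/-- The image in the double Yangian of an element of the free algebra. -/
def ofFree {m n : ℕ} (x : Free m n) : DY m n :=
  toCompletion _ (RingQuot.mkAlgHom ℂ⟦X⟧ (Relation m n) x)

/-! ### The quantum Berezinians -/

/-- The matrix `(t⁺_{ij}(u))` over `DY(gl_{m|n})[[u]]`. -/
def Tplus (m n : ℕ) : Matrix (Idx m n) (Idx m n) (DY m n)⟦X⟧ := fun i j =>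
  PowerSeries.mk fun r => ofFree (tCoeff i j .plus (r : ℤ))

/-- The matrix `(t⁻_{ij}(u))` over `DY(gl_{m|n})[[u⁻¹]]`; the variable of the power series
is `u⁻¹`. -/
def Tminus (m n : ℕ) : Matrix (Idx m n) (Idx m n) (DY m n)⟦X⟧ := fun i j =>
  PowerSeries.mk fun r => ofFree (tCoeff i j .minus (-(r : ℤ)))

/-- `∑_τ sgn τ t_{τ(1)1}(u) t_{τ(2)2}(u - h) ⋯ t_{τ(m)m}(u - (m-1)h)
  × ∑_σ sgn σ t'_{m+1,m+σ(1)}(u - (m-1)h) ⋯ t'_{m+n,m+σ(n)}(u - (m-n)h)`,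
where `shift c f` is `f(u + c h)` and `t'_{ij}(u)` are the entries of the inverse matrix. As
`T(u) = ∑ (-1)^{ij + j} e_{ij} ⊗ t_{ij}(u)` and `T(u)⁻¹ = ∑ (-1)^{ij + j} e_{ij} ⊗ t'_{ij}(u)`,
the signs from the graded tensor product cancel and `(t'_{ij}(u))` is the inverse of
`(t_{ij}(u))` for the ordinary matrix product. Products are ordered from left to right. -/
def berezinian {m n : ℕ} (shift : ℤ → (DY m n)⟦X⟧ → (DY m n)⟦X⟧)
    (T : Matrix (Idx m n) (Idx m n) (DY m n)⟦X⟧) : (DY m n)⟦X⟧ :=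
  (∑ τ : Equiv.Perm (Fin m), (((Equiv.Perm.sign τ : ℤˣ) : ℤ) : (DY m n)⟦X⟧) *
      (List.ofFn fun k : Fin m =>
        shift (-(k : ℤ)) (T (Sum.inl (τ k)) (Sum.inl k))).prod) *
    ∑ σ : Equiv.Perm (Fin n), (((Equiv.Perm.sign σ : ℤˣ) : ℤ) : (DY m n)⟦X⟧) *
      (List.ofFn fun k : Fin n =>
        shift ((k : ℤ) + 1 - (m : ℤ)) (Ring.inverse T (Sum.inr k) (Sum.inr (σ k)))).prod

/-- The quantum Berezinian `b⁺_{m|n}(u)`, a power series in `u`. -/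
def bPlus (m n : ℕ) : (DY m n)⟦X⟧ := berezinian shiftPlus (Tplus m n)

/-- The quantum Berezinian `b⁻_{m|n}(u)`, a power series in `u⁻¹`. -/
def bMinus (m n : ℕ) : (DY m n)⟦X⟧ := berezinian shiftMinus (Tminus m n)

end DoubleYangian

end

/-! Centrality is checked modulo every power `h^N`, since elements of the completion are determined
by their images in the truncations. There `h` is nilpotent, so every `1 + h • X` is invertible, and
nonzero integers act injectively because the scalars contain ℂ. What is lost is cancellation of `h`.
Hence the argument never uses the commutator of two series `t`; it writes `t = δ + h g` and works
with the relations divided by `h`, which compare `t(u)` with `g(v)`.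

The parameters `u` and `v` live in `A⟦X⟧⟦X⟧`, `u` in the inner variable and `v` in the outer one,
each variable being the parameter itself or its inverse according to the sign of the series.
Denominators are cleared: `ρ` is their product and `w = ρ (u - v)`. The elements `w - p h ρ = ρ (u -
ph - v)` are not zero divisors, and this replaces division by `u - v`. `RTTSystem` collects
everything the algebra needs: the values `T(u - ph)`, their inverses, the divided matrix `g(v)`, and
the relations among them.

For a system the Berezinian is `b = A B`, with `A` the quantum determinant of the even block of `T`
and `B` that of the odd block of the inverse of `T`. The proof follows the Gauss decomposition of `s
= 1 + h g`.

The even block of `g` commutes with `A` by the centrality of the quantum determinant for `gl_m`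
(`rowDet_commute`, an induction through Cramer's rule `inverse_mul_rowDet` and the equality
`colDet_eq_rowDet`). It commutes with `B` because odd-odd entries of the inverse matrix commute with
even-even entries (`RelX.commute_divided_inverse`).

For the coordinate `f` with `s₁₁ f = g₁₂`, neither factor of `b` need commute with `f`, but `w' [A,
f] = ρ A (h f - F)` and `w' [B, f] = -ρ (h f - F) B` (`RTTSystem.colDet_gauss`,
`RTTSystem.rowDet_gauss`). The same `w'` and the same coordinate `F` of `T` occur in both, because
the last factor of `A` and the first factor of `B` have the same argument `u - (m-1)h`; the two
contributions cancel.

Finally, passing to inverse matrices and exchanging the parities gives a system for `gl_{n|m}`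
(`RTTSystem.inverse`) with the same Berezinian (`RTTSystem.systemBer_inverse`). So `b` also commutes
with the odd block and the remaining coordinate of the divided inverse of `g`, and block matrix
algebra recovers every entry of `g` (`RTTSystem.commute`). -/

noncomputable section

namespace DoubleYangian

/-! ### Ordered products and alternating sums -/

section Alternating

variable {R : Type} [Ring R] {m : ℕ}

/-- The product of the factors of `x` at positions `< k`. -/
def prefixProd (x : Fin m → R) (k : ℕ) : R := ((List.ofFn x).take k).prod

/-- The product of the factors of `x` at positions `≥ k`. -/
def suffixProd (x : Fin m → R) (k : ℕ) : R := ((List.ofFn x).drop k).prod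

theorem prefixProd_congr {x y : Fin m → R} {k : ℕ} (H : ∀ j : Fin m, (j : ℕ) < k → x j = y j) :
    prefixProd x k = prefixProd y k := by
  unfold prefixProd
  congr 1
  apply List.ext_getElem
  · simp
  · intro i h₁ h₂
    simp only [List.length_take, List.length_ofFn, lt_min_iff] at h₁
    simpa using H ⟨i, h₁.2⟩ h₁.1

theorem suffixProd_congr {x y : Fin m → R} {k : ℕ} (H : ∀ j : Fin m, k ≤ (j : ℕ) → x j = y j) :
    suffixProd x k = suffixProd y k := by
  unfold suffixProd
  congr 1
  apply List.ext_getElem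
  · simp
  · intro i h₁ h₂
    simp only [List.length_drop, List.length_ofFn] at h₁
    simpa using H ⟨k + i, by omega⟩ (by simp)

theorem prod_eq_prefix_mul_suffix (x : Fin m → R) {k : ℕ} (hk : k + 1 < m) :
    (List.ofFn x).prod =
      prefixProd x k * (x ⟨k, by omega⟩ * x ⟨k + 1, hk⟩) * suffixProd x (k + 2) := by
  have h₁ : (List.ofFn x).drop k = x ⟨k, by omega⟩ :: (List.ofFn x).drop (k + 1) := by
    rw [List.drop_eq_getElem_cons (by simp; omega)]
    simp
  have h₂ : (List.ofFn x).drop (k + 1) = x ⟨k + 1, hk⟩ :: (List.ofFn x).drop (k + 2) := by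
    rw [List.drop_eq_getElem_cons (by simpa using hk)]
    simp
  conv_lhs => rw [← List.take_append_drop k (List.ofFn x), List.prod_append, h₁, h₂]
  simp only [List.prod_cons, prefixProd, suffixProd, mul_assoc]

/-- The transposition of two adjacent positions. -/
def adjSwap {k : ℕ} (hk : k + 1 < m) : Equiv.Perm (Fin m) :=
  Equiv.swap ⟨k, by omega⟩ ⟨k + 1, hk⟩

theorem adjSwap_left {k : ℕ} (hk : k + 1 < m) : adjSwap hk ⟨k, by omega⟩ = ⟨k + 1, hk⟩ :=
  Equiv.swap_apply_left _ _

theorem adjSwap_right {k : ℕ} (hk : k + 1 < m) : adjSwap hk ⟨k + 1, hk⟩ = ⟨k, by omega⟩ :=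
  Equiv.swap_apply_right _ _

theorem adjSwap_of_lt {k : ℕ} (hk : k + 1 < m) {j : Fin m} (hj : (j : ℕ) < k) :
    adjSwap hk j = j := by
  apply Equiv.swap_apply_of_ne_of_ne <;> · intro h; subst h; simp at hj

theorem adjSwap_of_le {k : ℕ} (hk : k + 1 < m) {j : Fin m} (hj : k + 2 ≤ (j : ℕ)) :
    adjSwap hk j = j := by
  apply Equiv.swap_apply_of_ne_of_ne <;> · intro h; subst h; simp at hj

theorem sign_adjSwap {k : ℕ} (hk : k + 1 < m) : Equiv.Perm.sign (adjSwap hk) = -1 :=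
  Equiv.Perm.sign_swap (by simp [Fin.ext_iff])

theorem adjSwap_mul_self {k : ℕ} (hk : k + 1 < m) : adjSwap hk * adjSwap hk = 1 :=
  Equiv.swap_mul_self _ _

theorem perm_induction_adjSwap {P : Equiv.Perm (Fin m) → Prop} (one : P 1)
    (step : ∀ π k (hk : k + 1 < m), P π → P (π * adjSwap hk)) (π : Equiv.Perm (Fin m)) : P π := by
  obtain _ | n := m
  · rwa [Subsingleton.elim π 1]
  · have hπ : π ∈ Submonoid.closure
        (Set.range fun i : Fin n => Equiv.swap i.castSucc i.succ) := by
      rw [Equiv.Perm.mclosure_swap_castSucc_succ]; trivial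
    induction hπ using Submonoid.closure_induction_right with
    | one => exact one
    | mul_right x hx y hy ih =>
      obtain ⟨i, rfl⟩ := hy
      exact step x i (by omega) ih

theorem sum_perm_eq_zero {f : Equiv.Perm (Fin m) → R} {k : ℕ} (hk : k + 1 < m)
    (hf : ∀ τ, f τ + f (τ * adjSwap hk) = 0) : ∑ τ, f τ = 0 := by
  refine Finset.sum_involution (fun τ _ => τ * adjSwap hk) (fun τ _ => hf τ) ?_
    (fun _ _ => Finset.mem_univ _) ?_
  · intro τ _ _ h
    have h1 : adjSwap hk = 1 := by simpa using h
    have := sign_adjSwap hk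
    rw [h1] at this
    simp at this
  · intro τ _
    rw [mul_assoc, adjSwap_mul_self, mul_one]

/-- The alternating sum `∑_τ sgn τ E₀(τ(0), c(0)) E₁(τ(1), c(1)) ⋯`. -/
def altSum (E : Fin m → Fin m → Fin m → R) (c : Fin m → Fin m) : R :=
  ∑ τ : Equiv.Perm (Fin m), ((Equiv.Perm.sign τ : ℤˣ) : ℤ) •
    (List.ofFn fun k => E k (τ k) (c k)).prod

/-- Adjacent factors satisfy the column relation of a Manin matrix. -/
def IsManin (E : Fin m → Fin m → Fin m → R) : Prop :=
  ∀ k (hk : k + 1 < m) (i i' j j' : Fin m),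
    E ⟨k, by omega⟩ i j * E ⟨k + 1, hk⟩ i' j' + E ⟨k, by omega⟩ i j' * E ⟨k + 1, hk⟩ i' j =
      E ⟨k, by omega⟩ i' j * E ⟨k + 1, hk⟩ i j' + E ⟨k, by omega⟩ i' j' * E ⟨k + 1, hk⟩ i j

/-- The terms of `τ` and `τ * adjSwap hk` share all factors outside the positions `k` and `k + 1`.
In these two positions the four products coming from both sums cancel by the Manin relation. -/
theorem altSum_adjSwap {E : Fin m → Fin m → Fin m → R} (hE : IsManin E) (c : Fin m → Fin m)
    {k : ℕ} (hk : k + 1 < m) : altSum E (c ∘ adjSwap hk) = -altSum E c := by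
  rw [eq_neg_iff_add_eq_zero, altSum, altSum, ← Finset.sum_add_distrib]
  apply sum_perm_eq_zero hk
  intro τ
  have hL : ∀ (ρ : Equiv.Perm (Fin m)) (d : Fin m → Fin m),
      (ρ = τ ∨ ρ = τ * adjSwap hk) → (d = c ∨ d = c ∘ adjSwap hk) →
      (List.ofFn fun k => E k (ρ k) (d k)).prod =
        prefixProd (fun j => E j (τ j) (c j)) k *
          (E ⟨k, by omega⟩ (ρ ⟨k, by omega⟩) (d ⟨k, by omega⟩) *
            E ⟨k + 1, hk⟩ (ρ ⟨k + 1, hk⟩) (d ⟨k + 1, hk⟩)) *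
          suffixProd (fun j => E j (τ j) (c j)) (k + 2) := by
    intro ρ d hρ hd
    rw [prod_eq_prefix_mul_suffix _ hk]
    congr 1
    · congr 1
      apply prefixProd_congr
      intro j hj
      rcases hρ with rfl | rfl <;> rcases hd with rfl | rfl <;> simp [adjSwap_of_lt hk hj]
    · apply suffixProd_congr
      intro j hj
      rcases hρ with rfl | rfl <;> rcases hd with rfl | rfl <;> simp [adjSwap_of_le hk hj]
  rw [hL τ _ (Or.inl rfl) (Or.inr rfl), hL τ _ (Or.inl rfl) (Or.inl rfl),
    hL (τ * adjSwap hk) _ (Or.inr rfl) (Or.inr rfl), hL (τ * adjSwap hk) _ (Or.inr rfl) (Or.inl rfl)]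
  simp only [Equiv.Perm.sign_mul, sign_adjSwap, Function.comp_apply, adjSwap_left, adjSwap_right,
    Equiv.Perm.mul_apply, mul_neg, mul_one, Units.val_neg, neg_smul]
  rw [← smul_add, ← neg_add, ← smul_add, ← sub_eq_add_neg, ← smul_sub, ← add_mul, ← add_mul,
    ← mul_add, ← mul_add, add_comm (E _ _ (c ⟨k + 1, hk⟩) * _), hE k hk, sub_eq_zero.2, smul_zero]
  rw [add_comm]

theorem altSum_comp_perm {E : Fin m → Fin m → Fin m → R} (hE : IsManin E) (c : Fin m → Fin m)
    (π : Equiv.Perm (Fin m)) :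
    altSum E (c ∘ π) = ((Equiv.Perm.sign π : ℤˣ) : ℤ) • altSum E c := by
  induction π using perm_induction_adjSwap with
  | one => simp
  | step π k hk ih =>
    have : c ∘ ⇑(π * adjSwap hk) = (c ∘ π) ∘ adjSwap hk := rfl
    rw [this, altSum_adjSwap hE, ih, Equiv.Perm.sign_mul, sign_adjSwap]
    simp

theorem altSum_perm {E : Fin m → Fin m → Fin m → R} (hE : IsManin E) (π : Equiv.Perm (Fin m)) :
    altSum E π = ((Equiv.Perm.sign π : ℤˣ) : ℤ) • altSum E id :=
  altSum_comp_perm hE id π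

/-- Transposing two equal columns fixes `c` but changes the sign, so twice the sum vanishes; absence
of 2-torsion finishes. -/
theorem altSum_eq_zero (htf : ∀ (n : ℤ) (x : R), n ≠ 0 → n • x = 0 → x = 0)
    {E : Fin m → Fin m → Fin m → R} (hE : IsManin E)
    (c : Fin m → Fin m) {i j : Fin m} (hij : i ≠ j) (hc : c i = c j) : altSum E c = 0 := by
  have h1 := altSum_comp_perm hE c (Equiv.swap i j)
  have h2 : c ∘ Equiv.swap i j = c := by
    funext x
    simp only [Function.comp_apply]
    by_cases hxi : x = i
    · subst hxi; simp [hc]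
    · by_cases hxj : x = j
      · subst hxj; simp [hc]
      · rw [Equiv.swap_apply_of_ne_of_ne hxi hxj]
  rw [h2, Equiv.Perm.sign_swap hij] at h1
  refine htf 2 _ (by norm_num) ?_
  rw [two_smul]
  nth_rewrite 1 [h1]
  simp

end Alternating

/-! ### Column and row quantum determinants for the Yangian of `gl_m` -/

section Determinants

variable {R : Type} [Ring R] {m : ℕ}

/-- The relations of the Yangian of `gl_m` between the values of `a` at the points
`u - p h`, `p ∈ ℤ`. -/
def GlTT (a : ℤ → Matrix (Fin m) (Fin m) R) : Prop :=
  ∀ (p q : ℤ) (i j k l : Fin m), (q - p) • (a p i j * a q k l - a q k l * a p i j) =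
    a p k j * a q i l - a q k j * a p i l

/-- The column determinant `∑_τ sgn τ a_{τ(0)c(0)}(u - sh) a_{τ(1)c(1)}(u - (s+1)h) ⋯`. -/
def colDet (a : ℤ → Matrix (Fin m) (Fin m) R) (s : ℤ) (c : Fin m → Fin m) : R :=
  altSum (fun k i j => a (s + (k : ℕ)) i j) c

/-- The row determinant `∑_σ sgn σ a_{r(0)σ(0)}(u - sh) a_{r(1)σ(1)}(u - (s-1)h) ⋯`. -/
def rowDet (a : ℤ → Matrix (Fin m) (Fin m) R) (s : ℤ) (r : Fin m → Fin m) : R :=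
  altSum (fun k i j => a (s - (k : ℕ)) j i) r

/-- When the arguments differ by exactly `h`, the coefficient `q - p` is 1. Adding the relation to
the one with exchanged column indices, the products in reversed order cancel. -/
theorem isManin_col {a : ℤ → Matrix (Fin m) (Fin m) R} (ha : GlTT a) (s : ℤ) :
    IsManin (fun (k : Fin m) i j => a (s + (k : ℕ)) i j) := by
  intro k hk i i' j j'
  have h1 := ha (s + k) (s + k + 1) i j i' j'
  have h2 := ha (s + k) (s + k + 1) i j' i' j
  simp only [add_sub_cancel_left, one_smul] at h1 h2
  simp only [Nat.cast_add, Nat.cast_one, ← add_assoc]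
  have e := congrArg₂ (· + ·) h1 h2
  rw [← sub_eq_zero] at e ⊢
  rw [← e]
  abel

/-- Now `q - p = -1`, and the reversed products cancel in the difference of the relation and its
copy with exchanged column indices. -/
theorem isManin_row {a : ℤ → Matrix (Fin m) (Fin m) R} (ha : GlTT a) (s : ℤ) :
    IsManin (fun (k : Fin m) i j => a (s - (k : ℕ)) j i) := by
  intro k hk i i' j j'
  have h1 := ha (s - k) (s - k - 1) j i j' i'
  have h2 := ha (s - k) (s - k - 1) j' i j i'
  have e1 : s - (k : ℤ) - 1 - (s - k) = -1 := by ring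
  have e2 : s - ((k + 1 : ℕ) : ℤ) = s - k - 1 := by push_cast; ring
  simp only [e1, neg_smul, one_smul] at h1 h2
  simp only [e2]
  rw [← sub_eq_zero] at h1 h2 ⊢
  have h3 := ha (s - k) (s - k - 1) j i' j' i
  simp only [e1, neg_smul, one_smul] at h3
  rw [← sub_eq_zero] at h3
  have e := congrArg₂ (· - ·) h1 h3
  simp only [sub_zero] at e
  rw [← neg_eq_zero, ← e]
  abel

/-- The sum antisymmetrized both in rows and columns. -/
def biDet (a : ℤ → Matrix (Fin m) (Fin m) R) (p : Fin m → ℤ) : R :=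
  ∑ τ : Equiv.Perm (Fin m), ∑ σ : Equiv.Perm (Fin m),
    (((Equiv.Perm.sign τ : ℤˣ) : ℤ) * ((Equiv.Perm.sign σ : ℤˣ) : ℤ)) •
      (List.ofFn fun k => a (p k) (τ k) (σ k)).prod

/-- Double antisymmetrization turns the right side of the exchange relation into minus the
antisymmetrized commutator. With `p₀`, `p₁` the adjacent parameters, `p₁ - p₀ + 1` therefore
annihilates the difference of the two sums. This integer vanishes exactly when `p₁ = p₀ - 1`, which
`p₀ < p₁` excludes. -/
theorem biDet_adjSwap_of_lt (htf : ∀ (n : ℤ) (x : R), n ≠ 0 → n • x = 0 → x = 0)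
    {a : ℤ → Matrix (Fin m) (Fin m) R} (ha : GlTT a) (p : Fin m → ℤ) {k : ℕ} (hk : k + 1 < m)
    (hp : p ⟨k, by omega⟩ < p ⟨k + 1, hk⟩) : biDet a (p ∘ adjSwap hk) = biDet a p := by
  set x : Equiv.Perm (Fin m) → Equiv.Perm (Fin m) → Fin m → R :=
    fun τ σ j => a (p j) (τ j) (σ j) with hx
  set k₀ : Fin m := ⟨k, by omega⟩ with hk₀
  set k₁ : Fin m := ⟨k + 1, hk⟩ with hk₁
  set s := adjSwap hk with hs
  set sg : Equiv.Perm (Fin m) → Equiv.Perm (Fin m) → ℤ := fun τ σ =>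
    ((Equiv.Perm.sign τ : ℤˣ) : ℤ) * ((Equiv.Perm.sign σ : ℤˣ) : ℤ) with hsg
  set mid : (Fin m → Fin m → Fin m → Fin m → R) → R := fun Y =>
    ∑ τ : Equiv.Perm (Fin m), ∑ σ : Equiv.Perm (Fin m), sg τ σ •
      (prefixProd (x τ σ) k * Y (τ k₀) (σ k₀) (τ k₁) (σ k₁) * suffixProd (x τ σ) (k + 2)) with hmid
  have s₀ : s k₀ = k₁ := adjSwap_left hk
  have s₁ : s k₁ = k₀ := adjSwap_right hk
  have hsgτ : ∀ τ σ, sg (τ * s) σ = -sg τ σ := fun τ σ => by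
    simp [hsg, hs, Equiv.Perm.sign_mul, sign_adjSwap]
  have hsgσ : ∀ τ σ, sg τ (σ * s) = -sg τ σ := fun τ σ => by
    simp [hsg, hs, Equiv.Perm.sign_mul, sign_adjSwap]
  have hLτ : ∀ τ σ, prefixProd (x (τ * s) σ) k = prefixProd (x τ σ) k := fun τ σ =>
    prefixProd_congr fun j hj => by simp [hx, hs, adjSwap_of_lt hk hj]
  have hLσ : ∀ τ σ, prefixProd (x τ (σ * s)) k = prefixProd (x τ σ) k := fun τ σ =>
    prefixProd_congr fun j hj => by simp [hx, hs, adjSwap_of_lt hk hj]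
  have hRτ : ∀ τ σ, suffixProd (x (τ * s) σ) (k + 2) = suffixProd (x τ σ) (k + 2) := fun τ σ =>
    suffixProd_congr fun j hj => by simp [hx, hs, adjSwap_of_le hk hj]
  have hRσ : ∀ τ σ, suffixProd (x τ (σ * s)) (k + 2) = suffixProd (x τ σ) (k + 2) := fun τ σ =>
    suffixProd_congr fun j hj => by simp [hx, hs, adjSwap_of_le hk hj]
  have mid_row : ∀ Y, mid (fun i j i' j' => Y i' j i j') = -mid Y := by
    intro Y
    simp only [hmid]
    rw [← Equiv.sum_comp (Equiv.mulRight s), ← Finset.sum_neg_distrib]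
    refine Finset.sum_congr rfl fun τ _ => ?_
    rw [← Finset.sum_neg_distrib]
    refine Finset.sum_congr rfl fun σ _ => ?_
    simp only [Equiv.coe_mulRight, hsgτ, hLτ, hRτ, Equiv.Perm.mul_apply, s₀, s₁, neg_smul]
  have mid_col : ∀ Y, mid (fun i j i' j' => Y i j' i' j) = -mid Y := by
    intro Y
    simp only [hmid]
    rw [← Finset.sum_neg_distrib]
    refine Finset.sum_congr rfl fun τ _ => ?_
    rw [← Equiv.sum_comp (Equiv.mulRight s), ← Finset.sum_neg_distrib]
    refine Finset.sum_congr rfl fun σ _ => ?_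
    simp only [Equiv.coe_mulRight, hsgσ, hLσ, hRσ, Equiv.Perm.mul_apply, s₀, s₁, neg_smul]
  have mid_sub : ∀ Y Z, mid (fun i j i' j' => Y i j i' j' - Z i j i' j') = mid Y - mid Z := by
    intro Y Z
    simp only [hmid, mul_sub, sub_mul, smul_sub, Finset.sum_sub_distrib]
  have mid_smul : ∀ (c : ℤ) Y, mid (fun i j i' j' => c • Y i j i' j') = c • mid Y := by
    intro c Y
    simp only [hmid, mul_smul_comm, smul_mul_assoc, Finset.smul_sum, smul_comm c]
  have hX : biDet a p = mid fun i j i' j' => a (p k₀) i j * a (p k₁) i' j' := by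
    simp only [hmid, biDet]
    refine Finset.sum_congr rfl fun τ _ => Finset.sum_congr rfl fun σ _ => ?_
    rw [prod_eq_prefix_mul_suffix _ hk]
  have hY : biDet a (p ∘ s) = mid fun i j i' j' => a (p k₁) i' j' * a (p k₀) i j := by
    simp only [hmid, biDet]
    rw [← Equiv.sum_comp (Equiv.mulRight s)]
    refine Finset.sum_congr rfl fun τ _ => ?_
    rw [← Equiv.sum_comp (Equiv.mulRight s)]
    refine Finset.sum_congr rfl fun σ _ => ?_
    have e : ((Equiv.Perm.sign (τ * s) : ℤˣ) : ℤ) * ((Equiv.Perm.sign (σ * s) : ℤˣ) : ℤ) = sg τ σ := by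
      change sg (τ * s) (σ * s) = _
      rw [hsgτ, hsgσ, neg_neg]
    rw [prod_eq_prefix_mul_suffix _ hk]
    simp only [Equiv.coe_mulRight, e, Function.comp_apply, Equiv.Perm.mul_apply]
    rw [show (⟨k, by omega⟩ : Fin m) = k₀ from rfl, show (⟨k + 1, hk⟩ : Fin m) = k₁ from rfl, s₀, s₁]
    congr 2
    · congr 1
      exact prefixProd_congr fun j hj => by simp [hx, hs, adjSwap_of_lt hk hj]
    · exact suffixProd_congr fun j hj => by simp [hx, hs, adjSwap_of_le hk hj]
  have key := mid_smul (p k₁ - p k₀)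
    (fun i j i' j' => a (p k₀) i j * a (p k₁) i' j' - a (p k₁) i' j' * a (p k₀) i j)
  simp only [ha (p k₀) (p k₁)] at key
  rw [mid_sub (fun i j i' j' => a (p k₀) i' j * a (p k₁) i j')
      (fun i j i' j' => a (p k₁) i' j * a (p k₀) i j'),
    mid_sub (fun i j i' j' => a (p k₀) i j * a (p k₁) i' j')
      (fun i j i' j' => a (p k₁) i' j' * a (p k₀) i j),
    mid_row (fun i j i' j' => a (p k₀) i j * a (p k₁) i' j'),
    mid_col (fun i j i' j' => a (p k₁) i' j' * a (p k₀) i j), ← hX, ← hY] at key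
  have h0 : (p k₁ - p k₀ + 1) • (biDet a p - biDet a (p ∘ s)) = 0 := by
    rw [add_smul, ← key, one_smul]
    abel
  exact (sub_eq_zero.1 (htf _ _ (by omega) h0)).symm

theorem biDet_comp_perm (htf : ∀ (n : ℤ) (x : R), n ≠ 0 → n • x = 0 → x = 0)
    {a : ℤ → Matrix (Fin m) (Fin m) R} (ha : GlTT a) (p : Fin m → ℤ) (hp : Function.Injective p)
    (π : Equiv.Perm (Fin m)) : biDet a (p ∘ π) = biDet a p := by
  induction π using perm_induction_adjSwap with
  | one => rfl
  | step π k hk ih =>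
    have e : p ∘ ⇑(π * adjSwap hk) = (p ∘ π) ∘ adjSwap hk := rfl
    rw [← ih, e]
    rcases lt_trichotomy ((p ∘ π) ⟨k, by omega⟩) ((p ∘ π) ⟨k + 1, hk⟩) with h | h | h
    · exact biDet_adjSwap_of_lt htf ha _ hk h
    · have := (hp.comp π.injective) h
      simp at this
    -- A descent becomes an ascent after the swap, so the adjacent case is applied to the swapped
    -- sequence and read backwards.
    · have e2 : ((p ∘ π) ∘ adjSwap hk) ∘ adjSwap hk = p ∘ π := by
        have := adjSwap_mul_self hk
        funext j
        have hj := congrArg (fun f : Equiv.Perm (Fin m) => f j) this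
        simp only [Equiv.Perm.mul_apply, Equiv.Perm.one_apply] at hj
        simp only [Function.comp_apply, hj]
      conv_rhs => rw [← e2]
      refine (biDet_adjSwap_of_lt htf ha _ hk ?_).symm
      simpa only [Function.comp_apply, adjSwap_left, adjSwap_right] using h

theorem sign_smul_sign_smul (σ : Equiv.Perm (Fin m)) (x : R) :
    ((Equiv.Perm.sign σ : ℤˣ) : ℤ) • ((Equiv.Perm.sign σ : ℤˣ) : ℤ) • x = x := by
  rw [smul_smul, ← Units.val_mul, Int.units_mul_self, Units.val_one, one_smul]

/-- The column determinant with decreasing arguments equals the row determinant with increasing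
arguments. -/
theorem colDet_eq_rowDet (htf : ∀ (n : ℤ) (x : R), n ≠ 0 → n • x = 0 → x = 0)
    {a : ℤ → Matrix (Fin m) (Fin m) R} (ha : GlTT a) (s : ℤ) :
    colDet a s id = rowDet a (s + m - 1) id := by
  -- For a fixed column permutation the inner sum is a column determinant with permuted columns. Its
  -- sign is compensated, so all `m!` inner sums agree. Rows behave likewise for the reversed
  -- sequence of arguments, and `m!` is cancelled at the end.
  have h₁ : biDet a (fun k => s + (k : ℕ)) = (m.factorial : ℤ) • colDet a s id := by
    rw [biDet, Finset.sum_comm]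
    have e₀ : ∀ (σ τ : Equiv.Perm (Fin m)) (x : R),
        (((Equiv.Perm.sign τ : ℤˣ) : ℤ) * ((Equiv.Perm.sign σ : ℤˣ) : ℤ)) • x =
          ((Equiv.Perm.sign σ : ℤˣ) : ℤ) • ((Equiv.Perm.sign τ : ℤˣ) : ℤ) • x :=
      fun σ τ x => by rw [mul_comm, mul_smul]
    simp only [e₀]
    have e : ∀ σ : Equiv.Perm (Fin m), ∑ τ : Equiv.Perm (Fin m),
        ((Equiv.Perm.sign σ : ℤˣ) : ℤ) • ((Equiv.Perm.sign τ : ℤˣ) : ℤ) •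
          (List.ofFn fun k : Fin m => a (s + (k : ℕ)) (τ k) (σ k)).prod = colDet a s id := by
      intro σ
      rw [← Finset.smul_sum]
      change _ • altSum (fun k i j => a (s + (k : ℕ)) i j) σ = _
      rw [altSum_perm (isManin_col ha s), sign_smul_sign_smul]
      rfl
    simp only [e, Finset.sum_const, Finset.card_univ, Fintype.card_perm, Fintype.card_fin]
    rw [natCast_zsmul]
  have h₂ : biDet a (fun k => s + m - 1 - (k : ℕ)) = (m.factorial : ℤ) • rowDet a (s + m - 1) id := by
    rw [biDet]
    simp only [mul_smul]
    have e : ∀ τ : Equiv.Perm (Fin m), ∑ σ : Equiv.Perm (Fin m),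
        ((Equiv.Perm.sign τ : ℤˣ) : ℤ) • ((Equiv.Perm.sign σ : ℤˣ) : ℤ) •
          (List.ofFn fun k : Fin m => a (s + m - 1 - (k : ℕ)) (τ k) (σ k)).prod =
        rowDet a (s + m - 1) id := by
      intro τ
      rw [← Finset.smul_sum]
      change _ • altSum (fun k i j => a (s + m - 1 - (k : ℕ)) j i) τ = _
      rw [altSum_perm (isManin_row ha _), sign_smul_sign_smul]
      rfl
    simp only [e, Finset.sum_const, Finset.card_univ, Fintype.card_perm, Fintype.card_fin]
    rw [natCast_zsmul]
  have h₃ : (fun k : Fin m => s + m - 1 - ((k : ℕ) : ℤ)) =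
      (fun k : Fin m => s + ((k : ℕ) : ℤ)) ∘ (Fin.revPerm : Equiv.Perm (Fin m)) := by
    funext k
    have := k.2
    simp only [Function.comp_apply, Fin.revPerm_apply, Fin.val_rev]
    omega
  rw [h₃, biDet_comp_perm htf ha _ (by intro i j h; simpa [Fin.ext_iff] using h), h₁] at h₂
  have h₄ : (m.factorial : ℤ) • (colDet a s id - rowDet a (s + m - 1) id) = 0 := by
    rw [smul_sub, h₂, sub_self]
  exact sub_eq_zero.1 (htf _ _ (by exact_mod_cast m.factorial_ne_zero) h₄)

end Determinants

/-! ### Super `RTT` relations -/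

section RingLevel

variable {K R : Type} [CommRing K] [Ring R] [Algebra K R]

/-- With `S = 1 + h G` and inverse `S'`, the divided inverse is `G' = -S' G`, since `S' = 1 + h G'`.
The formula is the derivation rule for `S'` divided by `h`; as `h` may be nilpotent, it is verified
directly and not by cancellation. -/
theorem commutator_divided_inverse {h : K} {t G S' : R} (h₁ : (1 + h • G) * S' = 1)
    (h₂ : S' * (1 + h • G) = 1) :
    t * -(S' * G) - -(S' * G) * t = -(S' * (t * G - G * t) * S') := by
  have e₁ : S' * G = G * S' := by
    have : S' * (G * (1 + h • G)) * S' = S' * ((1 + h • G) * G) * S' := by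
      simp only [mul_add, add_mul, mul_one, one_mul, mul_smul_comm, smul_mul_assoc]
    rw [← mul_assoc, mul_assoc _ _ S', h₁, mul_one, ← mul_assoc S', h₂, one_mul] at this
    exact this
  have e₂ : S' = 1 - h • (S' * G) := by
    rw [mul_add, mul_one, mul_smul_comm] at h₂
    rw [← h₂]; abel
  have e₃ : S' * (t * G - G * t) * S' = S' * t * (S' * G) - (S' * G) * t * S' := by
    rw [mul_sub, sub_mul]
    congr 1
    · rw [e₁]; simp only [mul_assoc]
    · simp only [mul_assoc]
  rw [e₃]
  generalize S' * G = Y at *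
  rw [e₂]
  simp only [sub_mul, mul_sub, one_mul, mul_one, smul_mul_assoc, mul_smul_comm]
  noncomm_ring

variable {h ρ w : K} {t t' G S' P : R}

theorem one_add_divided_inverse (h₂ : S' * (1 + h • G) = 1) :
    1 + h • (-(S' * G)) = S' := by
  rw [mul_add, mul_one, mul_smul_comm] at h₂
  rw [← h₂, smul_neg]; abel

/-- Conjugation by `S'` removes the factor `S` from both cubic terms, leaving products of `t`, `P`
and `S'` only. -/
theorem rtt_inverse_right (h₁ : (1 + h • G) * S' = 1) (h₂ : S' * (1 + h • G) = 1)
    (X : w • (t * G - G * t) = ρ • (P * t * (1 + h • G) - (1 + h • G) * t * P)) :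
    w • (t * -(S' * G) - -(S' * G) * t) = ρ • (t * P * S' - S' * P * t) := by
  rw [commutator_divided_inverse h₁ h₂, smul_neg, ← smul_mul_assoc, ← mul_smul_comm, X]
  generalize 1 + h • G = S at *
  have c : ∀ x, S' * (S * x) = x := fun x => by rw [← mul_assoc, h₂, one_mul]
  simp only [mul_smul_comm, smul_mul_assoc, mul_sub, sub_mul, mul_assoc, c, h₁, mul_one]
  rw [← smul_neg, neg_sub]

theorem rtt_inverse_left (h₁ : t * t' = 1) (h₂ : t' * t = 1)
    (Y : w • (t * G - G * t) = ρ • (P * (1 + h • G) * t - t * (1 + h • G) * P)) :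
    w • (t' * G - G * t') = ρ • ((1 + h • G) * P * t' - t' * P * (1 + h • G)) := by
  have e : t' * G - G * t' = -(t' * (t * G - G * t) * t') := by
    have c : ∀ x, t' * (t * x) = x := fun x => by rw [← mul_assoc, h₂, one_mul]
    simp only [mul_sub, sub_mul, mul_assoc, c, h₁, mul_one, neg_sub]
  rw [e, smul_neg, ← smul_mul_assoc, ← mul_smul_comm, Y]
  generalize 1 + h • G = S at *
  have c : ∀ x, t' * (t * x) = x := fun x => by rw [← mul_assoc, h₂, one_mul]
  simp only [mul_smul_comm, smul_mul_assoc, mul_sub, sub_mul, mul_assoc, c, h₁, mul_one]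
  rw [← smul_neg, neg_sub]

/-- Inverting both matrices reverses the order of products, so the two ways of writing the right
side are exchanged and `ρ` changes sign. This is why both forms of the relation are carried along.
-/
theorem rtt_inverse_of_X (h₁ : (1 + h • G) * S' = 1) (h₂ : S' * (1 + h • G) = 1)
    (h₃ : t * t' = 1) (h₄ : t' * t = 1)
    (X : w • (t * G - G * t) = ρ • (P * t * (1 + h • G) - (1 + h • G) * t * P)) :
    w • (t' * -(S' * G) - -(S' * G) * t') = (-ρ) • (P * S' * t' - t' * S' * P) := by
  have e : t' * -(S' * G) - -(S' * G) * t' =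
      -(t' * (t * -(S' * G) - -(S' * G) * t) * t') := by
    have c : ∀ x, t' * (t * x) = x := fun x => by rw [← mul_assoc, h₄, one_mul]
    simp only [mul_sub, sub_mul, mul_assoc, mul_neg, neg_mul, c, h₃, mul_one, neg_sub]
  have c : ∀ x, t' * (t * x) = x := fun x => by rw [← mul_assoc, h₄, one_mul]
  rw [e, smul_neg, ← smul_mul_assoc, ← mul_smul_comm, rtt_inverse_right h₁ h₂ X]
  simp only [mul_smul_comm, smul_mul_assoc, mul_sub, sub_mul, mul_assoc, c, h₃, mul_one, neg_smul]

theorem rtt_inverse_of_Y (h₁ : (1 + h • G) * S' = 1) (h₂ : S' * (1 + h • G) = 1)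
    (h₃ : t * t' = 1) (h₄ : t' * t = 1)
    (Y : w • (t * G - G * t) = ρ • (P * (1 + h • G) * t - t * (1 + h • G) * P)) :
    w • (t' * -(S' * G) - -(S' * G) * t') = (-ρ) • (P * t' * S' - S' * t' * P) := by
  rw [commutator_divided_inverse h₁ h₂, smul_neg, ← smul_mul_assoc, ← mul_smul_comm,
    rtt_inverse_left h₃ h₄ Y]
  generalize 1 + h • G = S at *
  have c : ∀ x, S' * (S * x) = x := fun x => by rw [← mul_assoc, h₂, one_mul]
  simp only [mul_smul_comm, smul_mul_assoc, mul_sub, sub_mul, mul_assoc, c, h₁, mul_one, neg_smul]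

/-- Let `X` and `Y` be the two right sides. Then `X - Y = h (P c + c P)` for the divided commutator
`c`. Multiplying by `w` and using the given relation twice, together with `P X P = -Y`, yields `w²
(X - Y) = (h ρ)² (X - Y)`. Regularity of `w ± h ρ` forces `X = Y`; this reflects the fact that `R(u)
R(-u)` is a scalar. -/
theorem rtt_forms_eq (hP : P * P = 1) (r₁ : ∀ x : R, (w - h * ρ) • x = 0 → x = 0)
    (r₂ : ∀ x : R, (w + h * ρ) • x = 0 → x = 0)
    (XY : w • (t * G - G * t) = ρ • (P * t * (1 + h • G) - (1 + h • G) * t * P) ∨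
      w • (t * G - G * t) = ρ • (P * (1 + h • G) * t - t * (1 + h • G) * P)) :
    P * t * (1 + h • G) - (1 + h • G) * t * P = P * (1 + h • G) * t - t * (1 + h • G) * P := by
  set S := 1 + h • G with hS
  set X := P * t * S - S * t * P with hX
  set Y := P * S * t - t * S * P with hY
  set c := t * G - G * t with hc
  have cP : ∀ x, P * (P * x) = x := fun x => by rw [← mul_assoc, hP, one_mul]
  have e₁ : t * S - S * t = h • c := by
    simp only [hS, hc, mul_add, add_mul, mul_one, one_mul, mul_smul_comm, smul_mul_assoc, smul_sub]
    abel
  have e₂ : X - Y = h • (P * c + c * P) := by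
    rw [smul_add, ← mul_smul_comm, ← smul_mul_assoc, ← e₁]
    simp only [hX, hY]; noncomm_ring
  have e₃ : P * X + X * P = h • (c + P * c * P) := by
    rw [smul_add, ← smul_mul_assoc, ← mul_smul_comm, ← e₁]
    simp only [hX, mul_sub, sub_mul, mul_assoc, cP, hP, mul_one]
    abel
  have e₄ : P * Y + Y * P = -(h • (c + P * c * P)) := by
    rw [smul_add, ← smul_mul_assoc, ← mul_smul_comm, ← e₁]
    simp only [hY, mul_sub, sub_mul, mul_assoc, cP, hP, mul_one]
    abel
  have e₅ : P * X * P = -Y := by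
    simp only [hX, hY, mul_sub, sub_mul, mul_assoc, cP, hP, mul_one]
    abel
  have e₆ : P * Y * P = -X := by
    simp only [hX, hY, mul_sub, sub_mul, mul_assoc, cP, hP, mul_one]
    abel
  have key : (w * w) • (X - Y) = (h * ρ * (h * ρ)) • (X - Y) := by
    rw [mul_smul, e₂, smul_comm w h, smul_add, ← mul_smul_comm, ← smul_mul_assoc]
    rcases XY with H | H
    · rw [H, mul_smul_comm, smul_mul_assoc, ← smul_add, e₃, smul_comm ρ h, smul_smul h h,
        smul_comm w, smul_comm w, smul_add, ← smul_mul_assoc, ← mul_smul_comm, H, mul_smul_comm,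
        smul_mul_assoc, e₅, ← smul_add, ← sub_eq_add_neg, ← e₂]
      simp only [smul_smul]
      congr 1; ring
    · rw [H, mul_smul_comm, smul_mul_assoc, ← smul_add, e₄, smul_neg, smul_comm ρ h, smul_neg,
        smul_neg, smul_smul h h,
        smul_comm w, smul_comm w, smul_add, ← smul_mul_assoc, ← mul_smul_comm, H, mul_smul_comm,
        smul_mul_assoc, e₆, ← smul_add, ← sub_eq_add_neg, ← e₂]
      simp only [smul_smul, ← smul_neg, neg_sub]
      congr 1; ring
  have : (w - h * ρ) • ((w + h * ρ) • (X - Y)) = 0 := by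
    rw [smul_smul, show (w - h * ρ) * (w + h * ρ) = w * w - h * ρ * (h * ρ) by ring, sub_smul, key,
      sub_self]
  exact sub_eq_zero.1 (r₂ _ (r₁ _ this))

end RingLevel

/-! ### Super `RTT` relations in components and as ordinary matrix identities -/

section Components

variable {K R I : Type} [CommRing K] [Ring R] [Algebra K R] [Fintype I] [DecidableEq I]

/-- The sign `(-1)^{ab}` for two parities `a`, `b`. -/
def sgn (K : Type) [CommRing K] (a b : Bool) : K := if a && b then -1 else 1

theorem sgn_comm (a b : Bool) : sgn K a b = sgn K b a := by cases a <;> cases b <;> rfl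

theorem sgn_mul_self (a b : Bool) : sgn K a b * sgn K a b = 1 := by
  cases a <;> cases b <;> simp [sgn]

theorem sgn_mul_self_mul (a b : Bool) (x : K) : sgn K a b * (sgn K a b * x) = x := by
  rw [← mul_assoc, sgn_mul_self, one_mul]

variable (par : I → Bool)

/-- The relation `(u - v) [t_{ij}(u), g_{kl}(v)} = ± (t_{kj}(u) s_{il}(v) - s_{kj}(v) t_{il}(u))`
with `s(v) = 1 + h g(v)` and `ρ (u - v) = w`. -/
def RelX (h ρ w : K) (T G : Matrix I I R) : Prop := ∀ i j k l,
  w • (T i j * G k l - (sgn K (par i) (par k) * sgn K (par i) (par l) * sgn K (par j) (par k) *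
      sgn K (par j) (par l)) • (G k l * T i j)) =
    (ρ * (sgn K (par i) (par j) * sgn K (par i) (par k) * sgn K (par j) (par k))) •
      (T k j * (1 + h • G) i l - (1 + h • G) k j * T i l)

/-- The relation `(u - v) [t_{ij}(u), g_{kl}(v)} = ± (s_{il}(v) t_{kj}(u) - t_{il}(u) s_{kj}(v))`
with `s(v) = 1 + h g(v)` and `ρ (u - v) = w`. -/
def RelY (h ρ w : K) (T G : Matrix I I R) : Prop := ∀ i j k l,
  w • (T i j * G k l - (sgn K (par i) (par k) * sgn K (par i) (par l) * sgn K (par j) (par k) *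
      sgn K (par j) (par l)) • (G k l * T i j)) =
    (ρ * (sgn K (par j) (par k) * sgn K (par j) (par l) * sgn K (par k) (par l))) •
      ((1 + h • G) i l * T k j - T i l * (1 + h • G) k j)

/-- The operator `T₁` on the graded tensor square. -/
def lift₁ (K : Type) [CommRing K] [Algebra K R] (T : Matrix I I R) :
    Matrix (I × I) (I × I) R := fun x y =>
  if x.2 = y.2 then (sgn K (par x.2) (par x.1) * sgn K (par x.2) (par y.1)) • T x.1 y.1 else 0

/-- The operator `T₂` on the graded tensor square. -/
def lift₂ (T : Matrix I I R) : Matrix (I × I) (I × I) R := fun x y =>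
  if x.1 = y.1 then T x.2 y.2 else 0

/-- The super permutation operator. -/
def superPerm (K : Type) [CommRing K] [Algebra K R] : Matrix (I × I) (I × I) R := fun x y =>
  if x.1 = y.2 ∧ x.2 = y.1 then sgn K (par x.1) (par x.2) • 1 else 0

/-- In a product over a middle index `a` the sign of `(k, a)` occurs twice and disappears. Thus the
signs built into `lift₁` absorb the grading, and the tensor square can be treated with ordinary
matrices over `R`. -/
theorem lift₁_mul (T U : Matrix I I R) :
    lift₁ par K (T * U) = lift₁ par K T * lift₁ par K U := by
  ext ⟨i, k⟩ ⟨j, l⟩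
  simp only [lift₁, Matrix.mul_apply, Fintype.sum_prod_type, mul_ite, ite_mul, zero_mul, mul_zero]
  by_cases hkl : k = l
  · subst hkl
    simp only [if_true, Finset.smul_sum]
    refine Finset.sum_congr rfl fun a _ => ?_
    rw [Finset.sum_eq_single k (fun b _ hb => by simp [hb]) (by simp)]
    simp only [if_true]
    rw [smul_mul_smul_comm]
    congr 1
    linear_combination (-(sgn K (par k) (par i)) * sgn K (par k) (par j)) *
      sgn_mul_self (K := K) (par k) (par a)
  · simp [hkl]

theorem lift₁_one : lift₁ (R := R) par K (1 : Matrix I I R) = 1 := by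
  ext ⟨i, k⟩ ⟨j, l⟩
  simp only [lift₁, Matrix.one_apply, Prod.mk.injEq]
  by_cases hkl : k = l <;> by_cases hij : i = j <;> simp [hkl, hij, sgn_mul_self]

theorem lift₂_mul (T U : Matrix I I R) : lift₂ (T * U) = lift₂ T * lift₂ U := by
  ext ⟨i, k⟩ ⟨j, l⟩
  simp only [lift₂, Matrix.mul_apply, Fintype.sum_prod_type, mul_ite, ite_mul, zero_mul, mul_zero]
  by_cases hkl : i = j <;> simp [hkl]

theorem lift₂_one : lift₂ (1 : Matrix I I R) = 1 := by
  ext ⟨i, k⟩ ⟨j, l⟩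
  simp only [lift₂, Matrix.one_apply, Prod.mk.injEq]
  by_cases hkl : k = l <;> by_cases hij : i = j <;> simp [hkl, hij]

theorem lift₂_add (T U : Matrix I I R) : lift₂ (T + U) = lift₂ T + lift₂ U := by
  ext ⟨i, k⟩ ⟨j, l⟩
  by_cases hij : i = j <;> simp [lift₂, hij]

theorem lift₂_neg (T : Matrix I I R) : lift₂ (-T) = -lift₂ T := by
  ext ⟨i, k⟩ ⟨j, l⟩
  by_cases hij : i = j <;> simp [lift₂, hij]

theorem lift₂_smul (c : K) (T : Matrix I I R) : lift₂ (c • T) = c • lift₂ T := by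
  ext ⟨i, k⟩ ⟨j, l⟩
  by_cases hij : i = j <;> simp [lift₂, hij]

theorem lift₂_one_add (c : K) (T : Matrix I I R) : lift₂ (1 + c • T) = 1 + c • lift₂ T := by
  rw [lift₂_add, lift₂_one, lift₂_smul]

theorem lift₁_mul_lift₂ (T U : Matrix I I R) (i k j l : I) :
    (lift₁ par K T * lift₂ U) (i, k) (j, l) =
      (sgn K (par k) (par i) * sgn K (par k) (par j)) • (T i j * U k l) := by
  simp [lift₁, lift₂, Matrix.mul_apply, Fintype.sum_prod_type]

theorem lift₂_mul_lift₁ (T U : Matrix I I R) (i k j l : I) :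
    (lift₂ U * lift₁ par K T) (i, k) (j, l) =
      (sgn K (par l) (par i) * sgn K (par l) (par j)) • (U k l * T i j) := by
  simp [lift₁, lift₂, Matrix.mul_apply, Fintype.sum_prod_type]

theorem superPerm_mul (M : Matrix (I × I) (I × I) R) (i k : I) (y : I × I) :
    (superPerm (R := R) par K * M) (i, k) y = sgn K (par i) (par k) • M (k, i) y := by
  rw [Matrix.mul_apply, Finset.sum_eq_single (k, i)]
  · simp [superPerm]
  · rintro ⟨a, b⟩ _ hb
    simp only [superPerm]
    rw [if_neg, zero_mul]
    rintro ⟨h1, h2⟩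
    exact hb (Prod.ext (by first | exact h2.symm | exact h1) (by first | exact h1.symm | exact h2))
  · simp

theorem mul_superPerm (M : Matrix (I × I) (I × I) R) (x : I × I) (j l : I) :
    (M * superPerm (R := R) par K) x (j, l) = sgn K (par j) (par l) • M x (l, j) := by
  rw [Matrix.mul_apply, Finset.sum_eq_single (l, j)]
  · simp [superPerm, sgn_comm]
  · rintro ⟨a, b⟩ _ hb
    simp only [superPerm]
    rw [if_neg, mul_zero]
    rintro ⟨h1, h2⟩
    exact hb (Prod.ext (by first | exact h2.symm | exact h1) (by first | exact h1.symm | exact h2))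
  · simp

theorem superPerm_mul_self : superPerm (R := R) par K * superPerm par K = 1 := by
  ext ⟨i, k⟩ ⟨j, l⟩
  rw [superPerm_mul, superPerm, Matrix.one_apply]
  by_cases hkl : k = l <;> by_cases hij : i = j <;>
    simp [hkl, hij, sgn_mul_self, sgn_comm, smul_smul]

theorem sgn_smul_eq_zero {a b c d : Bool} {x : R} :
    (sgn K a b * sgn K c d) • x = 0 ↔ x = 0 := by
  refine ⟨fun e => ?_, fun e => by rw [e, smul_zero]⟩
  have := congrArg (fun z => (sgn K c d * sgn K a b) • z) e
  simpa [smul_smul, mul_assoc, sgn_mul_self_mul, sgn_mul_self] using this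

/-- For each of the sixteen parity patterns, an entry of the matrix identity is an invertible sign
times the component relation. -/
theorem relX_defect (h ρ w : K) (T G : Matrix I I R) (i k j l : I) :
    (w • (lift₁ par K T * lift₂ G - lift₂ G * lift₁ par K T) -
      ρ • (superPerm par K * lift₁ par K T * (1 + h • lift₂ G) -
        (1 + h • lift₂ G) * lift₁ par K T * superPerm par K) : Matrix (I × I) (I × I) R) (i, k) (j, l) =
    (sgn K (par k) (par i) * sgn K (par k) (par j)) •
      (w • (T i j * G k l - (sgn K (par i) (par k) * sgn K (par i) (par l) *
        sgn K (par j) (par k) * sgn K (par j) (par l)) • (G k l * T i j)) -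
      (ρ * (sgn K (par i) (par j) * sgn K (par i) (par k) * sgn K (par j) (par k))) •
        (T k j * (1 + h • G) i l - (1 + h • G) k j * T i l)) := by
  rw [← lift₂_one_add, mul_assoc (superPerm par K)]
  generalize 1 + h • G = S
  rw [Matrix.sub_apply, Matrix.smul_apply, Matrix.smul_apply, Matrix.sub_apply, Matrix.sub_apply,
    superPerm_mul, mul_superPerm, lift₁_mul_lift₂, lift₂_mul_lift₁, lift₁_mul_lift₂,
    lift₂_mul_lift₁]
  generalize T i j * G k l = x₁
  generalize G k l * T i j = x₂
  generalize T k j * S i l = x₃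
  generalize S k j * T i l = x₄
  cases par i <;> cases par j <;> cases par k <;> cases par l <;> simp only [sgn, Bool.and_true,
    Bool.and_false, if_true, if_false, Bool.false_eq_true] <;> module

theorem relY_defect (h ρ w : K) (T G : Matrix I I R) (i k j l : I) :
    (w • (lift₁ par K T * lift₂ G - lift₂ G * lift₁ par K T) -
      ρ • (superPerm par K * (1 + h • lift₂ G) * lift₁ par K T -
        lift₁ par K T * (1 + h • lift₂ G) * superPerm par K) : Matrix (I × I) (I × I) R) (i, k) (j, l) =
    (sgn K (par k) (par i) * sgn K (par k) (par j)) •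
      (w • (T i j * G k l - (sgn K (par i) (par k) * sgn K (par i) (par l) *
        sgn K (par j) (par k) * sgn K (par j) (par l)) • (G k l * T i j)) -
      (ρ * (sgn K (par j) (par k) * sgn K (par j) (par l) * sgn K (par k) (par l))) •
        ((1 + h • G) i l * T k j - T i l * (1 + h • G) k j)) := by
  rw [← lift₂_one_add, mul_assoc (superPerm par K)]
  generalize 1 + h • G = S
  rw [Matrix.sub_apply, Matrix.smul_apply, Matrix.smul_apply, Matrix.sub_apply, Matrix.sub_apply,
    superPerm_mul, mul_superPerm, lift₁_mul_lift₂, lift₂_mul_lift₁, lift₁_mul_lift₂,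
    lift₂_mul_lift₁]
  generalize T i j * G k l = x₁
  generalize G k l * T i j = x₂
  generalize S i l * T k j = x₃
  generalize T i l * S k j = x₄
  cases par i <;> cases par j <;> cases par k <;> cases par l <;> simp only [sgn, Bool.and_true,
    Bool.and_false, if_true, if_false, Bool.false_eq_true] <;> module

variable {par} {h ρ w : K} {T T' G S' : Matrix I I R}

theorem relX_iff : RelX par h ρ w T G ↔
    w • (lift₁ par K T * lift₂ G - lift₂ G * lift₁ par K T) =
      ρ • (superPerm par K * lift₁ par K T * (1 + h • lift₂ G) -
        (1 + h • lift₂ G) * lift₁ par K T * superPerm par K) := by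
  rw [← sub_eq_zero, ← Matrix.ext_iff]
  simp only [Prod.forall, relX_defect, Matrix.zero_apply, sgn_smul_eq_zero, sub_eq_zero]
  exact ⟨fun H i k j l => H i j k l, fun H i j k l => H i k j l⟩

theorem relY_iff : RelY par h ρ w T G ↔
    w • (lift₁ par K T * lift₂ G - lift₂ G * lift₁ par K T) =
      ρ • (superPerm par K * (1 + h • lift₂ G) * lift₁ par K T -
        lift₁ par K T * (1 + h • lift₂ G) * superPerm par K) := by
  rw [← sub_eq_zero, ← Matrix.ext_iff]
  simp only [Prod.forall, relY_defect, Matrix.zero_apply, sgn_smul_eq_zero, sub_eq_zero]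
  exact ⟨fun H i k j l => H i j k l, fun H i j k l => H i k j l⟩

theorem relX_iff_relY (r₁ : ∀ x : R, (w - h * ρ) • x = 0 → x = 0)
    (r₂ : ∀ x : R, (w + h * ρ) • x = 0 → x = 0) :
    RelX par h ρ w T G ↔ RelY par h ρ w T G := by
  have r₁' : ∀ x : Matrix (I × I) (I × I) R, (w - h * ρ) • x = 0 → x = 0 := fun x hx => by
    ext i j; exact r₁ _ (congrFun (congrFun hx i) j)
  have r₂' : ∀ x : Matrix (I × I) (I × I) R, (w + h * ρ) • x = 0 → x = 0 := fun x hx => by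
    ext i j; exact r₂ _ (congrFun (congrFun hx i) j)
  rw [relX_iff, relY_iff]
  refine ⟨fun H => ?_, fun H => ?_⟩
  · rw [← rtt_forms_eq (superPerm_mul_self par) r₁' r₂' (Or.inl H), H]
  · rw [rtt_forms_eq (superPerm_mul_self par) r₁' r₂' (Or.inr H), H]

theorem lift₁_mul_eq_one (e : T * T' = 1) : lift₁ par K T * lift₁ par K T' = 1 := by
  rw [← lift₁_mul, e, lift₁_one]

theorem lift₂_mul_eq_one (e : (1 + h • G) * S' = 1) : (1 + h • lift₂ G) * lift₂ S' = 1 := by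
  rw [← lift₂_one_add, ← lift₂_mul, e, lift₂_one]

theorem lift₂_mul_eq_one' (e : S' * (1 + h • G) = 1) : lift₂ S' * (1 + h • lift₂ G) = 1 := by
  rw [← lift₂_one_add, ← lift₂_mul, e, lift₂_one]

theorem RelX.inverse (X : RelX par h ρ w T G) (h₁ : (1 + h • G) * S' = 1)
    (h₂ : S' * (1 + h • G) = 1) (h₃ : T * T' = 1) (h₄ : T' * T = 1) :
    RelY par h (-ρ) w T' (-(S' * G)) := by
  rw [relX_iff] at X
  rw [relY_iff, ← lift₂_one_add, one_add_divided_inverse h₂, lift₂_neg, lift₂_mul]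
  exact rtt_inverse_of_X (lift₂_mul_eq_one h₁) (lift₂_mul_eq_one' h₂) (lift₁_mul_eq_one h₃)
    (lift₁_mul_eq_one h₄) X

theorem RelY.inverse (Y : RelY par h ρ w T G) (h₁ : (1 + h • G) * S' = 1)
    (h₂ : S' * (1 + h • G) = 1) (h₃ : T * T' = 1) (h₄ : T' * T = 1) :
    RelX par h (-ρ) w T' (-(S' * G)) := by
  rw [relY_iff] at Y
  rw [relX_iff, ← lift₂_one_add, one_add_divided_inverse h₂, lift₂_neg, lift₂_mul]
  exact rtt_inverse_of_Y (lift₂_mul_eq_one h₁) (lift₂_mul_eq_one' h₂) (lift₁_mul_eq_one h₃)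
    (lift₁_mul_eq_one h₄) Y

/-- The relation between `t_{ij}(u)` and the entries of the inverse of `1 + h g(v)`. -/
theorem RelX.inverse_right (X : RelX par h ρ w T G) (h₁ : (1 + h • G) * S' = 1)
    (h₂ : S' * (1 + h • G) = 1) (i k j l : I) :
    w • ((sgn K (par k) (par i) * sgn K (par k) (par j)) • (T i j * (-(S' * G)) k l) -
        (sgn K (par l) (par i) * sgn K (par l) (par j)) • ((-(S' * G)) k l * T i j)) =
      ρ • ((if k = j then sgn K (par k) (par i) • (T * S') i l else 0) -
        (if i = l then sgn K (par i) (par j) • (S' * T) k j else 0)) := by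
  rw [relX_iff] at X
  have key := rtt_inverse_right (lift₂_mul_eq_one h₁) (lift₂_mul_eq_one' h₂) X
  rw [← lift₂_mul, ← lift₂_neg] at key
  have := congrFun (congrFun key (i, k)) (j, l)
  rw [Matrix.smul_apply, Matrix.smul_apply, Matrix.sub_apply, Matrix.sub_apply, lift₁_mul_lift₂,
    lift₂_mul_lift₁] at this
  rw [this]
  congr 2
  · rw [mul_assoc, Matrix.mul_apply]
    by_cases hkj : k = j
    · subst hkj
      rw [if_pos rfl, Fintype.sum_prod_type, Matrix.mul_apply, Finset.smul_sum]
      refine Finset.sum_congr rfl fun a _ => ?_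
      simp only [superPerm_mul, lift₁, lift₂, ite_mul, zero_mul, Finset.sum_ite_eq, Finset.mem_univ,
        if_true, smul_mul_smul_comm]
      congr 1
      rw [sgn_comm (par a), mul_assoc, sgn_mul_self, mul_one]
    · rw [if_neg hkj]
      refine Finset.sum_eq_zero ?_
      rintro ⟨a, b⟩ _
      simp only [superPerm_mul, lift₁, lift₂]
      by_cases hkb : k = b
      · subst hkb; simp [hkj]
      · simp [hkb]
  · rw [Matrix.mul_apply]
    by_cases hil : i = l
    · subst hil
      rw [if_pos rfl, Fintype.sum_prod_type, Matrix.mul_apply, Finset.smul_sum]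
      refine Finset.sum_congr rfl fun a _ => ?_
      rw [Finset.sum_eq_single i (fun b _ hb => by simp [lift₁, hb]) (by simp)]
      simp only [mul_superPerm, lift₁, lift₂, if_true, smul_mul_smul_comm]
      congr 1
      rw [sgn_comm (par a), ← mul_assoc, sgn_mul_self, one_mul]
    · rw [if_neg hil]
      refine Finset.sum_eq_zero ?_
      rintro ⟨a, b⟩ _
      simp only [mul_superPerm, lift₁, lift₂]
      by_cases hib : i = b
      · subst hib; simp [hil]
      · simp [hib]

end Components

/-! ### Submatrices, parity change, opposite rings and invertibility -/

section Functoriality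

variable {K R I J : Type} [CommRing K] [Ring R] [Algebra K R] [Fintype I] [DecidableEq I]
  [Fintype J] [DecidableEq J] {par : I → Bool} {h ρ w : K} {T G : Matrix I I R}

theorem one_add_submatrix {e : J → I} (he : Function.Injective e) (c : K) (M : Matrix I I R) :
    1 + c • M.submatrix e e = (1 + c • M).submatrix e e := by
  ext i j
  simp [Matrix.one_apply, he.eq_iff]

theorem RelX.submatrix (X : RelX par h ρ w T G) {e : J → I} (he : Function.Injective e) :
    RelX (par ∘ e) h ρ w (T.submatrix e e) (G.submatrix e e) := by
  intro i j k l
  rw [one_add_submatrix he]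
  exact X (e i) (e j) (e k) (e l)

theorem RelY.submatrix (Y : RelY par h ρ w T G) {e : J → I} (he : Function.Injective e) :
    RelY (par ∘ e) h ρ w (T.submatrix e e) (G.submatrix e e) := by
  intro i j k l
  rw [one_add_submatrix he]
  exact Y (e i) (e j) (e k) (e l)

/-- Flipping all parities preserves the commutator sign, of exponent `(i + j)(k + l)`, but reverses
the sign of exponent `ij + ik + jk`. This compensates the change `ρ ↦ -ρ` caused by inversion. -/
theorem RelX.not (X : RelX par h (-ρ) w T G) : RelX (fun i => !par i) h ρ w T G := by
  intro i j k l
  have := X i j k l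
  revert this
  beta_reduce
  cases par i <;> cases par j <;> cases par k <;> cases par l <;> simp [sgn]

theorem RelY.not (X : RelY par h (-ρ) w T G) : RelY (fun i => !par i) h ρ w T G := by
  intro i j k l
  have := X i j k l
  revert this
  beta_reduce
  cases par i <;> cases par j <;> cases par k <;> cases par l <;> simp [sgn]

/-- The transposed matrix with entries in the opposite ring. -/
def opTranspose (M : Matrix I I R) : Matrix I I Rᵐᵒᵖ := fun i j => MulOpposite.op (M j i)

theorem opTranspose_mul (M N : Matrix I I R) :
    opTranspose (M * N) = opTranspose N * opTranspose M := by
  ext i j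
  simp [opTranspose, Matrix.mul_apply]

theorem opTranspose_one : opTranspose (1 : Matrix I I R) = 1 := by
  ext i j
  simp only [opTranspose, Matrix.one_apply, eq_comm (a := j)]
  split_ifs <;> rfl

theorem opTranspose_add (M N : Matrix I I R) :
    opTranspose (M + N) = opTranspose M + opTranspose N := rfl

theorem opTranspose_sub (M N : Matrix I I R) :
    opTranspose (M - N) = opTranspose M - opTranspose N := rfl

theorem opTranspose_smul (c : K) (M : Matrix I I R) :
    opTranspose (c • M) = c • opTranspose M := rfl

theorem opTranspose_one_add (c : K) (M : Matrix I I R) :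
    1 + c • opTranspose M = opTranspose (1 + c • M) := by
  rw [opTranspose_add, opTranspose_one, opTranspose_smul]

/-- Transposing and reversing products maps the relation at `(j, i, l, k)` to the one at `(i, j, k,
l)`: both sides acquire the same sign up to the commutator sign, as the cases show. It converts
statements about column determinants into statements about row determinants. -/
theorem RelX.op (X : RelX par h ρ w T G) : RelX par h ρ w (opTranspose T) (opTranspose G) := by
  intro i j k l
  have := X j i l k
  rw [opTranspose_one_add]
  generalize 1 + h • G = S at *
  apply MulOpposite.unop_injective
  simp only [opTranspose, MulOpposite.unop_smul, MulOpposite.unop_sub, MulOpposite.unop_mul,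
    MulOpposite.unop_op]
  rw [← sub_eq_zero] at this ⊢
  revert this
  cases par i <;> cases par j <;> cases par k <;> cases par l <;> simp only [sgn, Bool.and_true,
    Bool.and_false, if_true, if_false, Bool.false_eq_true] <;> intro this <;>
    first
    | (rw [← this]; module)
    | (rw [← neg_eq_zero, ← this]; module)

theorem RelY.op (X : RelY par h ρ w T G) : RelY par h ρ w (opTranspose T) (opTranspose G) := by
  intro i j k l
  have := X j i l k
  rw [opTranspose_one_add]
  generalize 1 + h • G = S at *
  apply MulOpposite.unop_injective
  simp only [opTranspose, MulOpposite.unop_smul, MulOpposite.unop_sub, MulOpposite.unop_mul,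
    MulOpposite.unop_op]
  rw [← sub_eq_zero] at this ⊢
  revert this
  cases par i <;> cases par j <;> cases par k <;> cases par l <;> simp only [sgn, Bool.and_true,
    Bool.and_false, if_true, if_false, Bool.false_eq_true] <;> intro this <;>
    first
    | (rw [← this]; module)
    | (rw [← neg_eq_zero, ← this]; module)

theorem isUnit_one_add_smul {N : ℕ} (hN : ∀ x : R, h ^ N • x = 0) (X : Matrix I I R) :
    IsUnit (1 + h • X) := by
  apply IsNilpotent.isUnit_one_add
  refine ⟨N, ?_⟩
  rw [smul_pow]
  ext i j
  exact hN _

theorem exists_inverse_one_add_smul {N : ℕ} (hN : ∀ x : R, h ^ N • x = 0) (X : Matrix I I R) :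
    ∃ M : Matrix I I R, (1 + h • X) * M = 1 ∧ M * (1 + h • X) = 1 := by
  obtain ⟨u, hu⟩ := isUnit_one_add_smul hN X
  exact ⟨↑u⁻¹, by rw [← hu, Units.mul_inv], by rw [← hu, Units.inv_mul]⟩

end Functoriality

/-! ### The quantum determinant of the Yangian of `gl_m` -/

section QuantumDeterminant

variable {K R : Type} [CommRing K] [Ring R] [Algebra K R] {m : ℕ}

/-- The relations between `a(u)` and `g(v)`, `w = ρ (u - v)`, for the Yangian of `gl_m`. -/
def GlTG (h ρ w : K) (a g : Matrix (Fin m) (Fin m) R) : Prop := ∀ i j k l,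
  w • (a i j * g k l - g k l * a i j) =
      ρ • (a k j * (1 + h • g) i l - (1 + h • g) k j * a i l) ∧
    w • (a i j * g k l - g k l * a i j) =
      ρ • ((1 + h • g) i l * a k j - a i l * (1 + h • g) k j)

theorem GlTG.submatrix {h ρ w : K} {a g : Matrix (Fin m) (Fin m) R} (H : GlTG h ρ w a g) {m' : ℕ}
    {e : Fin m' → Fin m} (he : Function.Injective e) :
    GlTG h ρ w (a.submatrix e e) (g.submatrix e e) := by
  intro i j k l
  rw [one_add_submatrix he]
  exact H (e i) (e j) (e k) (e l)

theorem GlTT.submatrix {a : ℤ → Matrix (Fin m) (Fin m) R} (H : GlTT a) {m' : ℕ}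
    (e : Fin m' → Fin m) : GlTT fun p => (a p).submatrix e e :=
  fun p q i j k l => H p q (e i) (e j) (e k) (e l)

/-- Permuting rows and permuting columns each contribute the sign of `π`. The lemma allows any
chosen index to be moved to position 0. -/
theorem rowDet_relabel {a : ℤ → Matrix (Fin m) (Fin m) R} (ha : GlTT a) (s : ℤ)
    (π : Equiv.Perm (Fin m)) :
    rowDet (fun p => (a p).submatrix π π) s id = rowDet a s id := by
  have h₁ : rowDet (fun p => (a p).submatrix π π) s id =
      ((Equiv.Perm.sign π : ℤˣ) : ℤ) • rowDet a s π := by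
    unfold rowDet altSum
    rw [Finset.smul_sum, ← Equiv.sum_comp (Equiv.mulLeft π⁻¹)]
    refine Finset.sum_congr rfl fun τ _ => ?_
    rw [smul_smul, Equiv.coe_mulLeft, Equiv.Perm.sign_mul, Equiv.Perm.sign_inv, Units.val_mul]
    simp
  rw [h₁]
  unfold rowDet
  rw [altSum_perm (isManin_row ha s), sign_smul_sign_smul]

/-- Cramer's rule for the upper left entry of the inverse matrix. -/
theorem inverse_mul_rowDet (htf : ∀ (n : ℤ) (x : R), n ≠ 0 → n • x = 0 → x = 0)
    {a : ℤ → Matrix (Fin (m + 1)) (Fin (m + 1)) R} (ha : GlTT a) (s : ℤ)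
    {α : Matrix (Fin (m + 1)) (Fin (m + 1)) R} (hα : α * a s = 1) :
    α 0 0 * rowDet a s id =
      rowDet (fun p => (a p).submatrix Fin.succ Fin.succ) (s - 1) id := by
  -- Adding the terms with `j ≠ 0` is harmless: they are determinants with a repeated row.
  have h₁ : ∑ j, α 0 j * rowDet a s (Fin.cons j Fin.succ) = α 0 0 * rowDet a s id := by
    rw [Finset.sum_eq_single 0]
    · congr 2
      funext i
      refine Fin.cases ?_ (fun i => ?_) i <;> simp
    · intro j _ hj
      obtain ⟨i, rfl⟩ := Fin.exists_succ_eq.2 hj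
      unfold rowDet
      rw [altSum_eq_zero htf (isManin_row ha s) _ (i := 0) (j := i.succ)
        (Fin.succ_ne_zero i).symm (by simp), mul_zero]
    · simp
  rw [← h₁]
  have h₂ : ∀ j, rowDet a s (Fin.cons j Fin.succ) = ∑ σ : Equiv.Perm (Fin (m + 1)),
      ((Equiv.Perm.sign σ : ℤˣ) : ℤ) • (a s j (σ 0) *
        (List.ofFn fun k : Fin m => a (s - 1 - (k : ℕ)) k.succ (σ k.succ)).prod) := by
    intro j
    unfold rowDet altSum
    refine Finset.sum_congr rfl fun σ _ => ?_
    rw [List.ofFn_succ, List.prod_cons]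
    congr 2
    · simp
    · congr 2
      funext k
      simp only [Fin.cons_succ, Fin.val_succ, Nat.cast_add, Nat.cast_one]
      rw [sub_sub, add_comm (1 : ℤ)]
  simp only [h₂, Finset.mul_sum]
  rw [Finset.sum_comm]
  -- The first factor of the determinant has argument `s`, so summing against row 0 of the inverse
  -- of `a s` gives a Kronecker delta that retains only the `σ` fixing 0.
  have h₃ : ∀ σ : Equiv.Perm (Fin (m + 1)), ∑ j, α 0 j * (((Equiv.Perm.sign σ : ℤˣ) : ℤ) •
      (a s j (σ 0) * (List.ofFn fun k : Fin m => a (s - 1 - (k : ℕ)) k.succ (σ k.succ)).prod)) =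
      ((Equiv.Perm.sign σ : ℤˣ) : ℤ) • ((if 0 = σ 0 then 1 else 0) *
        (List.ofFn fun k : Fin m => a (s - 1 - (k : ℕ)) k.succ (σ k.succ)).prod) := by
    intro σ
    have := congrFun (congrFun hα 0) (σ 0)
    rw [Matrix.mul_apply, Matrix.one_apply] at this
    rw [← this, Finset.sum_mul, Finset.smul_sum]
    exact Finset.sum_congr rfl fun j _ => by rw [mul_smul_comm, mul_assoc]
  simp only [h₃]
  rw [← Equiv.sum_comp Equiv.Perm.decomposeFin.symm, Fintype.sum_prod_type,
    Finset.sum_eq_single 0]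
  · unfold rowDet altSum
    refine Finset.sum_congr rfl fun σ _ => ?_
    simp [Equiv.Perm.decomposeFin.symm_sign]
  · intro j _ hj
    refine Finset.sum_eq_zero fun σ _ => ?_
    simp [hj.symm]
  · simp

/-- The entry `a'₀₀` of the inverse matrix commutes with `g_{kl}` for `k, l ≠ 0`. -/
theorem GlTG.inverse_commute {h ρ w : K} {a g α : Matrix (Fin m) (Fin m) R} (H : GlTG h ρ w a g)
    (hw : ∀ x : R, w • x = 0 → x = 0) (h₁ : α * a = 1) (h₂ : a * α = 1) {i k l : Fin m}
    (hk : k ≠ i) (hl : l ≠ i) : Commute (α i i) (g k l) := by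
  set D : Matrix (Fin m) (Fin m) R := Matrix.diagonal fun _ => g k l with hD
  have e₁ : w • (a * D - D * a) =
      ρ • (Matrix.of (fun i j => (1 + h • g) i l * a k j - a i l * (1 + h • g) k j)) := by
    ext x y
    have := (H x y k l).2
    simpa [hD, Matrix.mul_diagonal, Matrix.diagonal_mul] using this
  have e₂ : D * α - α * D = α * (a * D - D * a) * α := by
    rw [mul_sub, sub_mul, ← mul_assoc α a D, h₁, one_mul, mul_assoc α (D * a) α, mul_assoc D a α,
      h₂, mul_one]
  have e₃ : w • (D * α - α * D) = ρ • (α *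
      (Matrix.of (fun i j => (1 + h • g) i l * a k j - a i l * (1 + h • g) k j)) * α) := by
    rw [e₂, ← smul_mul_assoc, ← mul_smul_comm, e₁, mul_smul_comm, smul_mul_assoc]
  have e₄ := congrFun (congrFun e₃ i) i
  have e₅ : (α * (Matrix.of (fun i j => (1 + h • g) i l * a k j - a i l * (1 + h • g) k j)) * α)
      i i = 0 := by
    -- After multiplication by `α` on both sides, each of the two terms contains an off-diagonal
    -- entry of `a α = 1` or `α a = 1`; this is where `k ≠ i` and `l ≠ i` enter.
    have f₁ : ∑ y, a k y * α y i = 0 := by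
      have := congrFun (congrFun h₂ k) i
      rwa [Matrix.mul_apply, Matrix.one_apply, if_neg hk] at this
    have f₂ : ∑ x, α i x * a x l = 0 := by
      have := congrFun (congrFun h₁ i) l
      rwa [Matrix.mul_apply, Matrix.one_apply, if_neg hl.symm] at this
    simp only [Matrix.mul_apply, Matrix.of_apply, mul_sub, Finset.sum_sub_distrib, sub_mul]
    have f₃ : ∑ y, (∑ x, α i x * ((1 + h • g) x l * a k y)) * α y i = 0 := by
      have : ∀ y, (∑ x, α i x * ((1 + h • g) x l * a k y)) * α y i =
          (∑ x, α i x * (1 + h • g) x l) * (a k y * α y i) := fun y => by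
        simp only [Finset.sum_mul, mul_assoc]
      simp only [this]
      rw [← Finset.mul_sum, f₁, mul_zero]
    have f₄ : ∑ y, (∑ x, α i x * (a x l * (1 + h • g) k y)) * α y i = 0 := by
      have : ∀ y, (∑ x, α i x * (a x l * (1 + h • g) k y)) * α y i =
          (∑ x, α i x * a x l) * ((1 + h • g) k y * α y i) := fun y => by
        simp only [Finset.sum_mul, mul_assoc]
      simp only [this, f₂, zero_mul, Finset.sum_const_zero]
    rw [f₃, f₄, sub_zero]
  rw [Matrix.smul_apply, Matrix.smul_apply, e₅, smul_zero] at e₄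
  have e₆ := hw _ e₄
  simp only [hD, Matrix.sub_apply, Matrix.mul_diagonal, Matrix.diagonal_mul] at e₆
  exact (sub_eq_zero.1 e₆).symm

theorem colDet_two (a : ℤ → Matrix (Fin 2) (Fin 2) R) (s : ℤ) (c : Fin 2 → Fin 2) :
    colDet a s c = a s 0 (c 0) * a (s + 1) 1 (c 1) - a s 1 (c 0) * a (s + 1) 0 (c 1) := by
  have : (Finset.univ : Finset (Equiv.Perm (Fin 2))) = {1, Equiv.swap 0 1} := by decide
  unfold colDet altSum
  rw [this, Finset.sum_pair (by decide)]
  simp [List.ofFn_succ, sub_eq_add_neg]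

/-- The off-diagonal 2 × 2 case has no third index to expand along, so it is computed directly from
the column determinant `a₀₀ b₁₁ - a₁₀ b₀₁`, where `b` is taken one shift after `a`. -/
theorem rowDet_two_commute (htf : ∀ (n : ℤ) (x : R), n ≠ 0 → n • x = 0 → x = 0) {h ρ w : K}
    (hw : ∀ (p : ℤ) (x : R), (w - p * (h * ρ)) • x = 0 → x = 0)
    {a : ℤ → Matrix (Fin 2) (Fin 2) R} {g : Matrix (Fin 2) (Fin 2) R} (ha : GlTT a)
    (H : ∀ p : ℤ, GlTG h ρ (w - p * (h * ρ)) (a p) g) (s : ℤ) :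
    Commute (rowDet a s id) (g 0 1) := by
  have e : s = s - 1 + (2 : ℕ) - 1 := by push_cast; ring
  rw [e, ← colDet_eq_rowDet htf ha]
  generalize s - 1 = s
  rw [colDet_two]
  have H₅ : a s 0 1 * a (s + 1) 1 1 = a s 1 1 * a (s + 1) 0 1 := by
    have := altSum_eq_zero htf (isManin_col ha s) (fun _ => 1) (i := 0) (j := 1) (by decide) rfl
    change colDet a s _ = 0 at this
    rw [colDet_two] at this
    exact sub_eq_zero.1 this
  have H₁ := (H s 0 0 0 1).1
  have H₂ := (H s 1 0 0 1).1
  have H₃ := (H (s + 1) 1 1 0 1).2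
  have H₄ := (H (s + 1) 0 1 0 1).1
  have e₁ : w - ((s + 1 : ℤ) : K) * (h * ρ) = w - (s : K) * (h * ρ) - h * ρ := by push_cast; ring
  have hw₀ := hw s
  have hw₁ := hw (s + 1)
  have hw₂ := hw (s + 2)
  have e₂ : w - ((s + 2 : ℤ) : K) * (h * ρ) = w - (s : K) * (h * ρ) - h * ρ - h * ρ := by
    push_cast; ring
  rw [e₁] at H₃ H₄ hw₁
  rw [e₂] at hw₂
  generalize w - (s : K) * (h * ρ) = w₀ at *
  have s₀₁ : (1 + h • g) 0 1 = h • g 0 1 := by simp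
  rw [s₀₁] at H₁ H₃ H₄
  generalize (1 + h • g) 0 0 = s₀₀ at *
  generalize (1 + h • g) 1 1 = s₁₁ at *
  generalize g 0 1 = G at *
  -- Here the right side is `h ρ` times the same commutator, and moving it to the left shifts the
  -- spectral factor by one more step.
  have H₄' : a (s + 1) 0 1 * G - G * a (s + 1) 0 1 = 0 := by
    apply hw₂
    rw [sub_smul, H₄]
    simp only [id, mul_smul_comm, smul_mul_assoc]
    module
  simp only [id] at *
  generalize a s 0 0 = a₀₀ at *
  generalize a s 0 1 = a₀₁ at *
  generalize a s 1 0 = a₁₀ at *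
  generalize a s 1 1 = a₁₁ at *
  generalize a (s + 1) 1 1 = b₁₁ at *
  generalize a (s + 1) 0 1 = b₀₁ at *
  -- The commutator is multiplied by both spectral factors, `w₀` for `a` and `w₀ - h ρ` for `b`, so
  -- that all individual relations can be substituted.
  refine sub_eq_zero.1 (hw₀ _ (hw₁ _ ?_))
  have d : (a₀₀ * b₁₁ - a₁₀ * b₀₁) * G - G * (a₀₀ * b₁₁ - a₁₀ * b₀₁) =
      (a₀₀ * G - G * a₀₀) * b₁₁ + a₀₀ * (b₁₁ * G - G * b₁₁) - (a₁₀ * G - G * a₁₀) * b₀₁ -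
        a₁₀ * (b₀₁ * G - G * b₀₁) := by noncomm_ring
  have f₁ : (w₀ - h * ρ) • (G * b₁₁) =
      (w₀ - h * ρ) • (b₁₁ * G) - ρ • (s₁₁ * b₀₁ - b₁₁ * h • G) := by
    rw [← H₃, ← smul_sub, sub_sub_cancel]
  rw [d, H₄', mul_zero, sub_zero]
  have d₂ : (w₀ - h * ρ) • w₀ • ((a₀₀ * G - G * a₀₀) * b₁₁ + a₀₀ * (b₁₁ * G - G * b₁₁) -
      (a₁₀ * G - G * a₁₀) * b₀₁) =
      (w₀ - h * ρ) • ((w₀ • (a₀₀ * G - G * a₀₀)) * b₁₁) +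
        w₀ • (a₀₀ * ((w₀ - h * ρ) • (b₁₁ * G - G * b₁₁))) -
        (w₀ - h * ρ) • ((w₀ • (a₁₀ * G - G * a₁₀)) * b₀₁) := by
    simp only [smul_mul_assoc, mul_smul_comm]
    module
  have d₃ : (w₀ - h * ρ) • ((ρ • (a₀₀ * h • G - s₀₀ * a₀₁)) * b₁₁) +
        w₀ • (a₀₀ * (ρ • (s₁₁ * b₀₁ - b₁₁ * h • G))) -
        (w₀ - h * ρ) • ((ρ • (a₀₀ * s₁₁ - s₀₀ * a₁₁)) * b₀₁) =
      (ρ * h) • (a₀₀ * ((w₀ - h * ρ) • (G * b₁₁))) +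
        w₀ • (a₀₀ * (ρ • (s₁₁ * b₀₁ - b₁₁ * h • G))) -
        ((w₀ - h * ρ) * ρ) • (a₀₀ * (s₁₁ * b₀₁)) -
        ((w₀ - h * ρ) * ρ) • (s₀₀ * (a₀₁ * b₁₁ - a₁₁ * b₀₁)) := by
    simp only [smul_mul_assoc, mul_smul_comm, mul_sub, sub_mul, smul_sub, mul_assoc]
    module
  rw [d₂, H₁, H₂, H₃, d₃, f₁, H₅, sub_self, mul_zero, smul_zero, sub_zero]
  simp only [mul_smul_comm, mul_sub]
  module

theorem rowDet_two_commute_of_ne (htf : ∀ (n : ℤ) (x : R), n ≠ 0 → n • x = 0 → x = 0) {h ρ w : K}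
    (hw : ∀ (p : ℤ) (x : R), (w - p * (h * ρ)) • x = 0 → x = 0)
    {a : ℤ → Matrix (Fin 2) (Fin 2) R} {g : Matrix (Fin 2) (Fin 2) R} (ha : GlTT a)
    (H : ∀ p : ℤ, GlTG h ρ (w - p * (h * ρ)) (a p) g) (s : ℤ) {k l : Fin 2} (hkl : k ≠ l) :
    Commute (rowDet a s id) (g k l) := by
  match k, l, hkl with
  | 0, 1, _ => exact rowDet_two_commute htf hw ha H s
  | 1, 0, _ =>
    rw [← rowDet_relabel ha s (Equiv.swap 0 1)]
    exact rowDet_two_commute htf hw (ha.submatrix (Equiv.swap 0 1))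
      (fun p => (H p).submatrix (Equiv.swap (0 : Fin 2) 1).injective) s
  | 0, 0, h => exact absurd rfl h
  | 1, 1, h => exact absurd rfl h

/-- The quantum determinant commutes with `g_{kl}(v)`. -/
theorem rowDet_commute (htf : ∀ (n : ℤ) (x : R), n ≠ 0 → n • x = 0 → x = 0) {h ρ w : K} {N : ℕ}
    (hN : ∀ x : R, h ^ N • x = 0) (hw : ∀ (p : ℤ) (x : R), (w - p * (h * ρ)) • x = 0 → x = 0)
    (m : ℕ) : ∀ {a : ℤ → Matrix (Fin m) (Fin m) R} {g : Matrix (Fin m) (Fin m) R} (_ : GlTT a)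
    (_ : ∀ p : ℤ, GlTG h ρ (w - p * (h * ρ)) (a p) g) (_ : ∀ p, ∃ X, a p = 1 + h • X) (s : ℤ)
    (k l : Fin m), Commute (rowDet a s id) (g k l) := by
  induction m with
  | zero => intro a g _ _ _ s k; exact k.elim0
  | succ m ih =>
    intro a g ha H hX s k l
    -- the case where some index differs from `k` and `l`
    have third : ∀ r : Fin (m + 1), r ≠ k → r ≠ l → Commute (rowDet a s id) (g k l) := by
      intro r hrk hrl
      set π : Equiv.Perm (Fin (m + 1)) := Equiv.swap 0 r with hπ
      have hπr : π 0 = r := Equiv.swap_apply_left _ _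
      have hk : π k ≠ 0 := fun e => hrk (by rw [← hπr, ← e, hπ, Equiv.swap_apply_self])
      have hl : π l ≠ 0 := fun e => hrl (by rw [← hπr, ← e, hπ, Equiv.swap_apply_self])
      obtain ⟨k', hk'⟩ := Fin.exists_succ_eq.2 hk
      obtain ⟨l', hl'⟩ := Fin.exists_succ_eq.2 hl
      set b : ℤ → Matrix (Fin (m + 1)) (Fin (m + 1)) R := fun p => (a p).submatrix π π with hb
      have hbT : GlTT b := ha.submatrix π
      have hbG : ∀ p : ℤ, GlTG h ρ (w - p * (h * ρ)) (b p) (g.submatrix π π) :=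
        fun p => (H p).submatrix π.injective
      have hg : g k l = g.submatrix π π k'.succ l'.succ := by
        rw [Matrix.submatrix_apply, hk', hl', hπ, Equiv.swap_apply_self, Equiv.swap_apply_self]
      have hbX : ∀ p, ∃ X, b p = 1 + h • X := fun p => by
        obtain ⟨X, hX⟩ := hX p
        exact ⟨X.submatrix π π, by rw [one_add_submatrix π.injective, ← hX]⟩
      rw [← rowDet_relabel ha s π, hg]
      change Commute (rowDet b s id) _
      obtain ⟨X, hX⟩ := hbX s
      obtain ⟨α, hα₁, hα₂⟩ := exists_inverse_one_add_smul hN X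
      rw [← hX] at hα₁ hα₂
      have c₁ : Commute (α 0 0) (g.submatrix π π k'.succ l'.succ) :=
        (hbG s).inverse_commute (hw s) hα₂ hα₁ (Fin.succ_ne_zero _) (Fin.succ_ne_zero _)
      have c₂ : Commute (rowDet (fun p => (b p).submatrix Fin.succ Fin.succ) (s - 1) id)
          (g.submatrix π π k'.succ l'.succ) :=
        ih (hbT.submatrix _) (fun p => (hbG p).submatrix (Fin.succ_injective _)) (fun p => by
          obtain ⟨X, hX⟩ := hbX p
          exact ⟨X.submatrix Fin.succ Fin.succ,
            by rw [one_add_submatrix (Fin.succ_injective _), ← hX]⟩) (s - 1) k' l'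
      -- By Cramer's rule the minor, which commutes with the entry by induction, is `α₀₀` times the
      -- determinant. Since `α₀₀` is a unit commuting with the entry, the determinant commutes too.
      rw [← inverse_mul_rowDet htf hbT s hα₂] at c₂
      have e : α = 1 + h • (-(α * X)) := by
        rw [hX, mul_add, mul_one, mul_smul_comm] at hα₂
        rw [← hα₂, smul_neg]; abel
      obtain ⟨u, hu⟩ : IsUnit (α 0 0) := by
        have : α 0 0 = 1 + h • (-(α * X)) 0 0 := by
          conv_lhs => rw [e]
          simp
        rw [this]
        apply IsNilpotent.isUnit_one_add
        exact ⟨N, by rw [smul_pow, hN]⟩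
      rw [← hu] at c₁ c₂
      have := (c₁.units_inv_left).mul_left c₂
      rwa [← mul_assoc, Units.inv_mul, one_mul] at this
    obtain _ | _ | m := m
    -- For size 1 the right side is `h ρ` times the commutator itself, so the regular element with
    -- index `s + 1` annihilates the commutator.
    · obtain rfl : k = 0 := Subsingleton.elim (α := Fin 1) _ _
      obtain rfl : l = 0 := Subsingleton.elim (α := Fin 1) _ _
      have e : rowDet a s id = a s 0 0 := by
        simp [rowDet, altSum, List.ofFn_succ]
      rw [e]
      refine sub_eq_zero.1 (hw (s + 1) _ ?_)
      have := (H s 0 0 0 0).1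
      have e₁ : w - ((s + 1 : ℤ) : K) * (h * ρ) = w - (s : K) * (h * ρ) - h * ρ := by
        push_cast; ring
      rw [e₁, sub_smul, this]
      simp only [Matrix.add_apply, Matrix.one_apply_eq, Matrix.smul_apply, mul_add, add_mul,
        mul_one, one_mul, mul_smul_comm, smul_mul_assoc]
      module
    · by_cases hkl : k = l
      · subst hkl
        have : ∃ r : Fin 2, r ≠ k := exists_ne k
        obtain ⟨r, hr⟩ := this
        exact third r hr hr
      · exact rowDet_two_commute_of_ne htf hw ha H s hkl
    · have hc : ({k, l} : Finset (Fin (m + 1 + 1 + 1))).card <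
          (Finset.univ : Finset (Fin (m + 1 + 1 + 1))).card :=
        lt_of_le_of_lt Finset.card_le_two (by simp)
      obtain ⟨r, -, hr⟩ := Finset.exists_mem_notMem_of_card_lt_card hc
      simp only [Finset.mem_insert, Finset.mem_singleton, not_or] at hr
      exact third r hr.1 hr.2

end QuantumDeterminant

/-! ### Determinants over the opposite ring and commutation with inverses -/

section Determinants

variable {K R : Type} [CommRing K] [Ring R] [Algebra K R] {m : ℕ}

theorem altSum_commute {E : Fin m → Fin m → Fin m → R} {c : Fin m → Fin m} {x : R}
    (H : ∀ k i j, Commute (E k i j) x) : Commute (altSum E c) x := by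
  unfold altSum
  refine Commute.sum_left _ _ _ fun τ _ => ?_
  refine Commute.smul_left ?_ _
  refine Commute.list_prod_left _ _ fun y hy => ?_
  obtain ⟨k, rfl⟩ := List.mem_ofFn.1 hy
  exact H _ _ _

theorem colDet_succ (a : ℤ → Matrix (Fin (m + 1)) (Fin (m + 1)) R) (s : ℤ)
    (c : Fin (m + 1) → Fin (m + 1)) :
    colDet a s c = ∑ τ : Equiv.Perm (Fin (m + 1)), ((Equiv.Perm.sign τ : ℤˣ) : ℤ) •
      ((List.ofFn fun k : Fin m => a (s + (k : ℕ)) (τ k.castSucc) (c k.castSucc)).prod *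
        a (s + m) (τ (Fin.last m)) (c (Fin.last m))) := by
  unfold colDet altSum
  refine Finset.sum_congr rfl fun τ _ => ?_
  rw [List.ofFn_succ', List.concat_eq_append, List.prod_append, List.prod_singleton]
  simp

theorem ofFn_op_prod (x : Fin m → R) : (List.ofFn fun k => MulOpposite.op (x k)).prod =
    MulOpposite.op (List.ofFn fun k => x k.rev).prod := by
  induction m with
  | zero => simp
  | succ m ih =>
    rw [List.ofFn_succ, List.prod_cons, ih fun k => x k.succ, List.ofFn_succ',
      List.concat_eq_append, List.prod_append, List.prod_singleton, MulOpposite.op_mul]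
    simp only [Fin.rev_last, Fin.rev_castSucc]

/-- Reversing words reverses the positions. The sign of the reversal permutation is absorbed by
permuting the rows, and the first argument of the row determinant becomes `s + m - 1`. -/
theorem colDet_opTranspose {a : ℤ → Matrix (Fin m) (Fin m) R} (ha : GlTT a) (s : ℤ) :
    colDet (fun p => opTranspose (a p)) s id = MulOpposite.op (rowDet a (s + m - 1) id) := by
  have e : rowDet a (s + m - 1) id =
      ((Equiv.Perm.sign (Fin.revPerm : Equiv.Perm (Fin m)) : ℤˣ) : ℤ) •
        rowDet a (s + m - 1) (Fin.revPerm : Equiv.Perm (Fin m)) := by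
    unfold rowDet
    rw [altSum_perm (isManin_row ha _), sign_smul_sign_smul]
  rw [e, MulOpposite.op_smul]
  unfold colDet rowDet altSum
  rw [← MulOpposite.opAddEquiv_apply, map_sum, Finset.smul_sum,
    ← Equiv.sum_comp (Equiv.mulRight (Fin.revPerm : Equiv.Perm (Fin m)))]
  refine Finset.sum_congr rfl fun τ _ => ?_
  rw [MulOpposite.opAddEquiv_apply, MulOpposite.op_smul, Equiv.coe_mulRight, Equiv.Perm.sign_mul,
    Units.val_mul, smul_smul, mul_comm]
  congr 1
  simp only [opTranspose, ofFn_op_prod]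
  congr 3
  funext k
  simp only [Equiv.Perm.mul_apply, Fin.revPerm_apply, Fin.rev_rev, id, Fin.val_rev]
  congr 1
  have := k.2
  omega

theorem commute_inverse_apply {I : Type} [Fintype I] [DecidableEq I] {M M' : Matrix I I R}
    (h₁ : M * M' = 1) (h₂ : M' * M = 1) {x : R} (H : ∀ i j, Commute x (M i j)) (i j : I) :
    Commute x (M' i j) := by
  set D : Matrix I I R := Matrix.diagonal fun _ => x with hD
  have e : D * M = M * D := by
    ext i j
    simpa [hD, Matrix.mul_diagonal, Matrix.diagonal_mul] using (H i j).eq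
  have e₂ : D * M' = M' * D := by
    calc D * M' = M' * M * (D * M') := by rw [h₂, one_mul]
      _ = M' * (D * M) * M' := by rw [e]; simp only [mul_assoc]
      _ = M' * D * (M * M') := by simp only [mul_assoc]
      _ = M' * D := by rw [h₁, mul_one]
  have := congrFun (congrFun e₂ i) j
  simp only [hD, Matrix.mul_diagonal, Matrix.diagonal_mul] at this
  exact this

end Determinants

/-! ### Systems of super `RTT` relations -/

section Systems

variable {K R : Type} [CommRing K] [Ring R] [Algebra K R] {m n : ℕ} {h ρ w : K}

/-- The parity of an index as a Boolean. -/
abbrev isOdd {m n : ℕ} (i : Idx m n) : Bool := i.isRight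

theorem toBlocks₁₂_mul (M N : Matrix (Idx m n) (Idx m n) R) : (M * N).toBlocks₁₂ =
    M.toBlocks₁₁ * N.toBlocks₁₂ + M.toBlocks₁₂ * N.toBlocks₂₂ := by
  ext i j
  simp [Matrix.toBlocks₁₂, Matrix.toBlocks₁₁, Matrix.toBlocks₂₂, Matrix.mul_apply,
    Fintype.sum_sum_type]

theorem toBlocks₂₁_mul (M N : Matrix (Idx m n) (Idx m n) R) : (M * N).toBlocks₂₁ =
    M.toBlocks₂₁ * N.toBlocks₁₁ + M.toBlocks₂₂ * N.toBlocks₂₁ := by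
  ext i j
  simp [Matrix.toBlocks₂₁, Matrix.toBlocks₁₁, Matrix.toBlocks₂₂, Matrix.mul_apply,
    Fintype.sum_sum_type]

theorem toBlocks₂₂_mul (M N : Matrix (Idx m n) (Idx m n) R) : (M * N).toBlocks₂₂ =
    M.toBlocks₂₁ * N.toBlocks₁₂ + M.toBlocks₂₂ * N.toBlocks₂₂ := by
  ext i j
  simp [Matrix.toBlocks₁₂, Matrix.toBlocks₂₁, Matrix.toBlocks₂₂, Matrix.mul_apply,
    Fintype.sum_sum_type]

variable {T G S' : Matrix (Idx m n) (Idx m n) R}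

/-- The even entries of `T(u)` commute with the odd-odd entries of the divided inverse of
`T(v)`. -/
theorem RelX.commute_divided_inverse (X : RelX isOdd h ρ w T G)
    (hw : ∀ x : R, w • x = 0 → x = 0) (h₁ : (1 + h • G) * S' = 1) (h₂ : S' * (1 + h • G) = 1)
    (i j : Fin m) (k l : Fin n) :
    Commute (T (Sum.inl i) (Sum.inl j)) ((-(S' * G)) (Sum.inr k) (Sum.inr l)) := by
  -- With `i, j` even and `k, l` odd, both Kronecker deltas on the right vanish and all signs are 1.
  have := X.inverse_right h₁ h₂ (Sum.inl i) (Sum.inr k) (Sum.inl j) (Sum.inr l)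
  simp only [sgn, isOdd, Sum.isRight_inl, Sum.isRight_inr, Bool.and_false, Bool.false_eq_true, if_false,
    mul_one, one_smul, reduceCtorEq, sub_self, smul_zero] at this
  exact sub_eq_zero.1 (hw _ this)

theorem RelX.commute_inverse (X : RelX isOdd h ρ w T G)
    (hw : ∀ x : R, w • x = 0 → x = 0) (h₁ : (1 + h • G) * S' = 1) (h₂ : S' * (1 + h • G) = 1)
    (i j : Fin m) (k l : Fin n) :
    Commute (T (Sum.inl i) (Sum.inl j)) (S' (Sum.inr k) (Sum.inr l)) := by
  rw [← one_add_divided_inverse h₂, Matrix.add_apply, Matrix.smul_apply, Matrix.one_apply]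
  refine Commute.add_right ?_ ((X.commute_divided_inverse hw h₁ h₂ i j k l).smul_right h)
  split_ifs
  · exact Commute.one_right _
  · exact Commute.zero_right _

/-- The relation between the even entries of `T(u)` and the Gauss coordinate
`s₀₀(v)⁻¹ s₀₁(v) = h f(v)`. -/
theorem RelX.gauss (X : RelX isOdd h ρ w T G) {N : ℕ} (hN : ∀ x : R, h ^ N • x = 0)
    (hw : ∀ x : R, w • x = 0 → x = 0) (h₁ : (1 + h • G) * S' = 1) (h₂ : S' * (1 + h • G) = 1)
    {f : Matrix (Fin m) (Fin n) R} (hf : (1 + h • G).toBlocks₁₁ * f = G.toBlocks₁₂)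
    (i j k : Fin m) (l : Fin n) :
    w • (T (Sum.inl i) (Sum.inl j) * f k l - f k l * T (Sum.inl i) (Sum.inl j)) =
      if k = j then ρ • (T.toBlocks₁₁ * h • f - T.toBlocks₁₂) i l else 0 := by
  set G' := -(S' * G) with hG'
  have hS' : S' = 1 + h • G' := (one_add_divided_inverse h₂).symm
  have e₁ : S'.toBlocks₂₂ = 1 + h • G'.toBlocks₂₂ := by
    rw [hS']; ext a b; simp [Matrix.toBlocks₂₂, Matrix.one_apply]
  have e₂ : S'.toBlocks₁₂ = h • G'.toBlocks₁₂ := by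
    rw [hS']; ext a b; simp [Matrix.toBlocks₁₂]
  obtain ⟨D, hD₁, hD₂⟩ := exists_inverse_one_add_smul hN G'.toBlocks₂₂
  rw [← e₁] at hD₁ hD₂
  obtain ⟨σ, hσ₁, hσ₂⟩ := exists_inverse_one_add_smul hN G.toBlocks₁₁
  have e₃ : (1 + h • G).toBlocks₁₁ = 1 + h • G.toBlocks₁₁ := by
    ext a b; simp [Matrix.toBlocks₁₁, Matrix.one_apply]
  rw [← e₃] at hσ₁ hσ₂
  have e₄ : (1 + h • G).toBlocks₁₂ = h • G.toBlocks₁₂ := by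
    ext a b; simp [Matrix.toBlocks₁₂]
  -- This is the upper right block of `(1 + h g) G' = -g`, after cancelling the invertible even
  -- block. It expresses `f` through `G'₁₂` and the inverse `D` of `S'₂₂`.
  have e₅ : G'.toBlocks₁₂ = -(f * S'.toBlocks₂₂) := by
    have : (1 + h • G) * G' = -G := by rw [hG', mul_neg, ← mul_assoc, h₁, one_mul]
    have := congrArg Matrix.toBlocks₁₂ this
    rw [toBlocks₁₂_mul, e₄, ← hf] at this
    have t₂ : (1 + h • G).toBlocks₁₁ * (G'.toBlocks₁₂ + f * S'.toBlocks₂₂) = 0 := by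
      have t₃ : (-G).toBlocks₁₂ = -((1 + h • G).toBlocks₁₁ * f) := by rw [hf]; rfl
      rw [t₃] at this
      rw [e₁, Matrix.mul_add, Matrix.mul_add, Matrix.mul_one, Matrix.mul_add, Matrix.mul_smul,
        Matrix.mul_smul]
      rw [Matrix.smul_mul, Matrix.mul_assoc] at this
      rw [add_left_comm, this, add_neg_cancel]
    have t₄ := congrArg (fun Y => σ * Y) t₂
    simp only [← Matrix.mul_assoc, hσ₂, Matrix.one_mul, Matrix.mul_zero] at t₄
    exact eq_neg_of_add_eq_zero_left t₄
  have e₆ : f = -(G'.toBlocks₁₂ * D) := by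
    rw [e₅, Matrix.neg_mul, neg_neg, Matrix.mul_assoc, hD₁, Matrix.mul_one]
  -- The commutator with `f = -G'₁₂ D` reduces to the one with `G'₁₂`, because `D` inverts a matrix
  -- whose entries commute with the even entries of `T`.
  have cD : ∀ r, Commute (T (Sum.inl i) (Sum.inl j)) (D r l) := fun r =>
    commute_inverse_apply hD₁ hD₂ (fun x y => X.commute_inverse hw h₁ h₂ i j x y) r l
  have e₇ : T (Sum.inl i) (Sum.inl j) * f k l - f k l * T (Sum.inl i) (Sum.inl j) =
      -∑ r, (T (Sum.inl i) (Sum.inl j) * G' (Sum.inl k) (Sum.inr r) -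
        G' (Sum.inl k) (Sum.inr r) * T (Sum.inl i) (Sum.inl j)) * D r l := by
    rw [e₆]
    simp only [Matrix.neg_apply, Matrix.mul_apply, mul_neg, neg_mul, Finset.mul_sum,
      Finset.sum_mul, sub_mul, Finset.sum_sub_distrib, Matrix.toBlocks₁₂, Matrix.of_apply]
    rw [neg_sub_neg, neg_sub]
    congr 1
    · exact Finset.sum_congr rfl fun r _ => by rw [mul_assoc, ← (cD r).eq, mul_assoc]
    · exact Finset.sum_congr rfl fun r _ => by rw [mul_assoc]
  have e₈ : ∀ r, w • (T (Sum.inl i) (Sum.inl j) * G' (Sum.inl k) (Sum.inr r) -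
        G' (Sum.inl k) (Sum.inr r) * T (Sum.inl i) (Sum.inl j)) =
      ρ • (if k = j then (T * S') (Sum.inl i) (Sum.inr r) else 0) := by
    intro r
    have := X.inverse_right h₁ h₂ (Sum.inl i) (Sum.inl k) (Sum.inl j) (Sum.inr r)
    simpa only [sgn, isOdd, Sum.isRight_inl, Sum.isRight_inr, Bool.and_false, Bool.false_eq_true,
      if_false, mul_one, one_smul, reduceCtorEq, sub_zero, Sum.inl.injEq] using this
  rw [e₇, smul_neg, Finset.smul_sum]
  simp only [← smul_mul_assoc, e₈]
  by_cases hkj : k = j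
  · simp only [hkj, if_true]
    have e₉ : (T * S').toBlocks₁₂ * D = -(T.toBlocks₁₁ * h • f - T.toBlocks₁₂) := by
      rw [toBlocks₁₂_mul, Matrix.add_mul, Matrix.mul_assoc, Matrix.mul_assoc, hD₁, Matrix.mul_one,
        e₂, Matrix.smul_mul, e₆]
      simp only [smul_neg, Matrix.mul_neg]
      abel
    have e₁₀ := congrFun (congrFun e₉ i) l
    rw [Matrix.mul_apply, Matrix.neg_apply] at e₁₀
    rw [eq_neg_iff_add_eq_zero, add_comm, ← eq_neg_iff_add_eq_zero] at e₁₀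
    rw [e₁₀, smul_neg, Finset.smul_sum]
    congr 1
    exact Finset.sum_congr rfl fun r _ => by rw [smul_mul_assoc]; rfl
  · simp [hkj]

/-- The values `T p` of a generator matrix at the points `u - p h` together with a generator matrix
`1 + h g` at a point `v`, subject to the super `RTT` relations, where `w = ρ (u - v)`. -/
structure RTTSystem (m n : ℕ) (h ρ w : K) (T T' : ℤ → Matrix (Idx m n) (Idx m n) R)
    (g S' : Matrix (Idx m n) (Idx m n) R) : Prop where
  ttX : ∀ p q : ℤ, RelX (K := K) isOdd 1 1 ((q - p : ℤ) : K) (T p) (T q - 1)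
  ttY : ∀ p q : ℤ, RelY (K := K) isOdd 1 1 ((q - p : ℤ) : K) (T p) (T q - 1)
  tgX : ∀ p : ℤ, RelX isOdd h ρ (w - p * (h * ρ)) (T p) g
  tgY : ∀ p : ℤ, RelY isOdd h ρ (w - p * (h * ρ)) (T p) g
  mul_inv : ∀ p, T p * T' p = 1
  inv_mul : ∀ p, T' p * T p = 1
  smul_inv : (1 + h • g) * S' = 1
  inv_smul : S' * (1 + h • g) = 1
  regular : ∀ (p : ℤ) (x : R), (w - p * (h * ρ)) • x = 0 → x = 0
  torsionFree : ∀ (k : ℤ) (x : R), k ≠ 0 → k • x = 0 → x = 0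
  nilpotent : ∃ N : ℕ, ∀ x : R, h ^ N • x = 0
  one_add : ∀ p, ∃ X, T p = 1 + h • X
  comm : ∀ (p q : ℤ) (i j : Fin m) (k l : Fin n),
    Commute (T p (Sum.inl i) (Sum.inl j)) (T' q (Sum.inr k) (Sum.inr l))

/-- Reindexing that exchanges the even and the odd part. -/
def swapIdx (M : Matrix (Idx m n) (Idx m n) R) : Matrix (Idx n m) (Idx n m) R :=
  M.submatrix Sum.swap Sum.swap

theorem swapIdx_mul (M N : Matrix (Idx m n) (Idx m n) R) :
    swapIdx (M * N) = swapIdx M * swapIdx N :=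
  (Matrix.submatrix_mul_equiv M N _ (Equiv.sumComm (Fin n) (Fin m)) _).symm

theorem swapIdx_one : swapIdx (1 : Matrix (Idx m n) (Idx m n) R) = 1 :=
  Matrix.submatrix_one_equiv (Equiv.sumComm (Fin n) (Fin m))

theorem swapIdx_one_add (c : K) (M : Matrix (Idx m n) (Idx m n) R) :
    1 + c • swapIdx M = swapIdx (1 + c • M) := by
  rw [← swapIdx_one]; rfl

theorem RelX.swapIdx (X : RelX isOdd h (-ρ) w T G) :
    RelX isOdd h ρ w (swapIdx T) (swapIdx G) := by
  have := X.not.submatrix (e := Sum.swap) (Equiv.sumComm (Fin n) (Fin m)).injective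
  have e : (isOdd : Idx n m → Bool) = (fun i : Idx m n => !isOdd i) ∘ Sum.swap := by
    funext i
    rcases i with i | i <;> rfl
  rw [e]
  exact this

theorem RelY.swapIdx (X : RelY isOdd h (-ρ) w T G) :
    RelY isOdd h ρ w (swapIdx T) (swapIdx G) := by
  have := X.not.submatrix (e := Sum.swap) (Equiv.sumComm (Fin n) (Fin m)).injective
  have e : (isOdd : Idx n m → Bool) = (fun i : Idx m n => !isOdd i) ∘ Sum.swap := by
    funext i
    rcases i with i | i <;> rfl
  rw [e]
  exact this

variable {T T' : ℤ → Matrix (Idx m n) (Idx m n) R} {g : Matrix (Idx m n) (Idx m n) R}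

/-- The inverse matrices form a system for `gl_{n|m}`. -/
theorem RTTSystem.inverse (H : RTTSystem m n h ρ w T T' g S') :
    RTTSystem n m h ρ w (fun p => swapIdx (T' p)) (fun p => swapIdx (T p)) (swapIdx (-(S' * g)))
      (swapIdx (1 + h • g)) := by
  have e : ∀ p : ℤ, 1 + (1 : K) • (T p - 1) = T p := fun p => by rw [one_smul]; abel
  -- In the relations among the `T p` the parameter `h` is 1, and the divided inverse of `T p - 1`
  -- is then `T' p - 1`.
  have e' : ∀ p : ℤ, swapIdx (T' p) - 1 = swapIdx (-(T' p * (T p - 1))) := fun p => by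
    rw [mul_sub, H.inv_mul, mul_one, neg_sub, ← swapIdx_one]; rfl
  refine ⟨?_, ?_, ?_, ?_, ?_, ?_, ?_, ?_, H.regular, H.torsionFree, H.nilpotent, ?_, ?_⟩
  · intro p q
    rw [e']
    exact ((H.ttY p q).inverse (by rw [e, H.mul_inv]) (by rw [e, H.inv_mul]) (H.mul_inv p)
      (H.inv_mul p)).swapIdx
  · intro p q
    rw [e']
    exact ((H.ttX p q).inverse (by rw [e, H.mul_inv]) (by rw [e, H.inv_mul]) (H.mul_inv p)
      (H.inv_mul p)).swapIdx
  · intro p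
    exact ((H.tgY p).inverse H.smul_inv H.inv_smul (H.mul_inv p) (H.inv_mul p)).swapIdx
  · intro p
    exact ((H.tgX p).inverse H.smul_inv H.inv_smul (H.mul_inv p) (H.inv_mul p)).swapIdx
  · intro p; rw [← swapIdx_mul, H.inv_mul, swapIdx_one]
  · intro p; rw [← swapIdx_mul, H.mul_inv, swapIdx_one]
  · rw [swapIdx_one_add, one_add_divided_inverse H.inv_smul, ← swapIdx_mul, H.inv_smul, swapIdx_one]
  · rw [swapIdx_one_add, one_add_divided_inverse H.inv_smul, ← swapIdx_mul, H.smul_inv, swapIdx_one]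
  · intro p
    obtain ⟨X, hX⟩ := H.one_add p
    refine ⟨swapIdx (-(T' p * X)), ?_⟩
    rw [swapIdx_one_add, one_add_divided_inverse]
    rw [← hX, H.inv_mul]
  · intro p q i j k l
    exact (H.comm q p k l i j).symm

/-- The transposed matrices over the opposite ring form a system. -/
theorem RTTSystem.op (H : RTTSystem m n h ρ w T T' g S') :
    RTTSystem m n h ρ w (fun p => opTranspose (T p)) (fun p => opTranspose (T' p)) (opTranspose g)
      (opTranspose S') := by
  refine ⟨?_, ?_, ?_, ?_, ?_, ?_, ?_, ?_, ?_, ?_, ?_, ?_, ?_⟩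
  · intro p q
    rw [← opTranspose_one, ← opTranspose_sub]; exact (H.ttX p q).op
  · intro p q
    rw [← opTranspose_one, ← opTranspose_sub]; exact (H.ttY p q).op
  · intro p; exact (H.tgX p).op
  · intro p; exact (H.tgY p).op
  · intro p; rw [← opTranspose_mul, H.inv_mul, opTranspose_one]
  · intro p; rw [← opTranspose_mul, H.mul_inv, opTranspose_one]
  · rw [opTranspose_one_add, ← opTranspose_mul, H.inv_smul, opTranspose_one]
  · rw [opTranspose_one_add, ← opTranspose_mul, H.smul_inv, opTranspose_one]
  · intro p x hx
    exact MulOpposite.unop_injective (H.regular p x.unop (congrArg MulOpposite.unop hx))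
  · intro k x hk hx
    exact MulOpposite.unop_injective (H.torsionFree k x.unop hk (congrArg MulOpposite.unop hx))
  · obtain ⟨N, hN⟩ := H.nilpotent
    exact ⟨N, fun x => MulOpposite.unop_injective (hN x.unop)⟩
  · intro p
    obtain ⟨X, hX⟩ := H.one_add p
    exact ⟨opTranspose X, by rw [opTranspose_one_add, hX]⟩
  · intro p q i j k l
    exact (H.comm p q j i l k).op

theorem RTTSystem.glTT (H : RTTSystem m n h ρ w T T' g S') :
    GlTT fun p => (T p).toBlocks₁₁ := by
  intro p q i j k l
  have := H.ttX p q (Sum.inl i) (Sum.inl j) (Sum.inl k) (Sum.inl l)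
  have e : 1 + (1 : K) • (T q - 1) = T q := by rw [one_smul]; abel
  have e₂ : T p (Sum.inl i) (Sum.inl j) * (1 : Matrix (Idx m n) (Idx m n) R) (Sum.inl k) (Sum.inl l) =
      (1 : Matrix (Idx m n) (Idx m n) R) (Sum.inl k) (Sum.inl l) * T p (Sum.inl i) (Sum.inl j) := by
    rw [Matrix.one_apply]; split_ifs <;> simp
  rw [e] at this
  simp only [sgn, isOdd, Sum.isRight_inl, Bool.and_false, Bool.false_eq_true, if_false, mul_one,
    one_smul, Matrix.sub_apply, mul_sub, sub_mul, e₂] at this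
  rw [sub_sub_sub_cancel_right, Int.cast_smul_eq_zsmul] at this
  exact this

theorem RTTSystem.glTG (H : RTTSystem m n h ρ w T T' g S') (p : ℤ) :
    GlTG h ρ (w - p * (h * ρ)) (T p).toBlocks₁₁ g.toBlocks₁₁ := by
  intro i j k l
  have X := H.tgX p (Sum.inl i) (Sum.inl j) (Sum.inl k) (Sum.inl l)
  have Y := H.tgY p (Sum.inl i) (Sum.inl j) (Sum.inl k) (Sum.inl l)
  have e : 1 + h • g.toBlocks₁₁ = (1 + h • g).toBlocks₁₁ := by
    ext a b; simp [Matrix.toBlocks₁₁, Matrix.one_apply]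
  rw [e]
  simp only [sgn, isOdd, Sum.isRight_inl, Bool.and_false, Bool.false_eq_true, if_false, mul_one,
    one_smul] at X Y
  exact ⟨X, Y⟩

end Systems

/-! ### Centrality of the quantum Berezinian of a system -/

section Berezinian

variable {K R : Type} [CommRing K] [Ring R] [Algebra K R] {m n : ℕ} {h ρ w : K}
  {T T' : ℤ → Matrix (Idx m n) (Idx m n) R} {g S' : Matrix (Idx m n) (Idx m n) R}

/-- The commutation of the quantum determinant of the even block with the Gauss coordinates. -/
theorem RTTSystem.colDet_gauss (H : RTTSystem m n h ρ w T T' g S') (s : ℤ)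
    {f F : Matrix (Fin m) (Fin n) R} (hf : (1 + h • g).toBlocks₁₁ * f = g.toBlocks₁₂)
    (hF : (T (s + m - 1)).toBlocks₁₁ * F = (T (s + m - 1)).toBlocks₁₂) (k : Fin m) (l : Fin n) :
    (w - ((s + m - 1 : ℤ) : K) * (h * ρ)) •
      (colDet (fun p => (T p).toBlocks₁₁) s id * f k l -
        f k l * colDet (fun p => (T p).toBlocks₁₁) s id) =
      ρ • (colDet (fun p => (T p).toBlocks₁₁) s id * (h • f - F) k l) := by
  obtain _ | m := m
  · exact k.elim0
  obtain ⟨N, hN⟩ := H.nilpotent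
  have R3 := fun p i j => (H.tgX p).gauss hN (H.regular p) H.smul_inv H.inv_smul hf i j k l
  set a : ℤ → Matrix (Fin (m + 1)) (Fin (m + 1)) R := fun p => (T p).toBlocks₁₁ with ha
  have hTT : GlTT a := H.glTT
  -- Column `k` is moved to the last position, at the cost of a sign, because only factors from this
  -- column fail to commute with `f k l`.
  set σ : Equiv.Perm (Fin (m + 1)) := Equiv.swap k (Fin.last m) with hσ
  have hlast : σ (Fin.last m) = k := Equiv.swap_apply_right _ _
  have e₁ : colDet a s id = ((Equiv.Perm.sign σ : ℤˣ) : ℤ) • colDet a s σ := by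
    unfold colDet
    rw [altSum_perm (isManin_col hTT s), sign_smul_sign_smul]
  have hp : s + ((m + 1 : ℕ) : ℤ) - 1 = s + m := by push_cast; ring
  rw [hp] at hF ⊢
  have hne : ∀ i : Fin m, σ i.castSucc ≠ k := fun i hi => by
    rw [← hlast] at hi
    exact (Fin.castSucc_lt_last i).ne (σ.injective hi)
  set w' := w - ((s + m : ℤ) : K) * (h * ρ) with hw'
  set pre : Equiv.Perm (Fin (m + 1)) → R := fun τ =>
    (List.ofFn fun i : Fin m => a (s + (i : ℕ)) (τ i.castSucc) (σ i.castSucc)).prod with hpre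
  have cpre : ∀ τ, Commute (pre τ) (f k l) := by
    intro τ
    refine Commute.list_prod_left _ _ fun y hy => ?_
    obtain ⟨i, rfl⟩ := List.mem_ofFn.1 hy
    have := R3 (s + (i : ℕ)) (τ i.castSucc) (σ i.castSucc)
    rw [if_neg (hne i).symm] at this
    exact sub_eq_zero.1 (H.regular _ _ this)
  have e₂ : colDet a s σ = ∑ τ : Equiv.Perm (Fin (m + 1)), ((Equiv.Perm.sign τ : ℤˣ) : ℤ) •
      (pre τ * a (s + m) (τ (Fin.last m)) k) := by
    rw [colDet_succ]; simp only [hlast, hpre]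
  -- Replacing the last column by `x` repeats a column unless `x = k`. Hence, of the sum over `x`
  -- produced by the last factor, only a multiple of the original determinant survives.
  have e₃ : ∀ x, ∑ τ : Equiv.Perm (Fin (m + 1)), ((Equiv.Perm.sign τ : ℤˣ) : ℤ) •
      (pre τ * a (s + m) (τ (Fin.last m)) x) = if x = k then colDet a s σ else 0 := by
    intro x
    split_ifs with hx
    · rw [hx, e₂]
    · set c : Fin (m + 1) → Fin (m + 1) := Fin.snoc (fun i : Fin m => σ i.castSucc) x with hc
      have e₄ : colDet a s c = ∑ τ : Equiv.Perm (Fin (m + 1)), ((Equiv.Perm.sign τ : ℤˣ) : ℤ) •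
          (pre τ * a (s + m) (τ (Fin.last m)) x) := by
        rw [colDet_succ]
        simp only [hc, Fin.snoc_castSucc, Fin.snoc_last, hpre]
      rw [← e₄]
      have hx' : σ.symm x ≠ Fin.last m := fun hi => hx (by rw [← hlast, ← hi, σ.apply_symm_apply])
      obtain ⟨i, hi⟩ := Fin.exists_castSucc_eq.2 hx'
      refine altSum_eq_zero H.torsionFree (isManin_col hTT s) c (i := i.castSucc) (j := Fin.last m)
        (Fin.castSucc_lt_last i).ne ?_
      simp only [hc, Fin.snoc_last]
      rw [Fin.snoc_castSucc, hi, Equiv.apply_symm_apply]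
  have e₅ : w' • (colDet a s σ * f k l - f k l * colDet a s σ) =
      ρ • (colDet a s σ * (h • f - F) k l) := by
    have d₁ : colDet a s σ * f k l - f k l * colDet a s σ =
        ∑ τ : Equiv.Perm (Fin (m + 1)), ((Equiv.Perm.sign τ : ℤˣ) : ℤ) • (pre τ *
          (a (s + m) (τ (Fin.last m)) k * f k l - f k l * a (s + m) (τ (Fin.last m)) k)) := by
      rw [e₂, Finset.sum_mul, Finset.mul_sum, ← Finset.sum_sub_distrib]
      refine Finset.sum_congr rfl fun τ _ => ?_
      rw [smul_mul_assoc, mul_smul_comm, ← smul_sub, mul_sub, ← mul_assoc (f k l), ← (cpre τ).eq]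
      simp only [mul_assoc]
    have d₂ : ∀ i, w' • (a (s + m) i k * f k l - f k l * a (s + m) i k) =
        ρ • ∑ x, a (s + m) i x * (h • f - F) x l := by
      intro i
      have := R3 (s + m) i k
      rw [if_pos rfl, ← hF, ← Matrix.mul_sub] at this
      exact this
    rw [d₁, Finset.smul_sum]
    have d₃ : ∀ τ : Equiv.Perm (Fin (m + 1)), w' • ((Equiv.Perm.sign τ : ℤˣ) : ℤ) • (pre τ *
          (a (s + m) (τ (Fin.last m)) k * f k l - f k l * a (s + m) (τ (Fin.last m)) k)) =
        ρ • ∑ x, (((Equiv.Perm.sign τ : ℤˣ) : ℤ) • (pre τ * a (s + m) (τ (Fin.last m)) x)) *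
          (h • f - F) x l := by
      intro τ
      rw [smul_comm, ← mul_smul_comm, d₂, mul_smul_comm, smul_comm, Finset.mul_sum, Finset.smul_sum]
      simp only [smul_mul_assoc, mul_assoc]
    simp only [d₃]
    rw [← Finset.smul_sum, Finset.sum_comm]
    simp only [← Finset.sum_mul, e₃, ite_mul, zero_mul, Finset.sum_ite_eq', Finset.mem_univ, if_true]
  rw [e₁, smul_mul_assoc, mul_smul_comm, ← smul_sub, smul_comm, e₅, smul_comm, smul_mul_assoc]

/-- The quantum Berezinian of a system. -/
def systemBer (T T' : ℤ → Matrix (Idx m n) (Idx m n) R) (s : ℤ) : R :=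
  colDet (fun p => (T p).toBlocks₁₁) s id * rowDet (fun p => (T' p).toBlocks₂₂) (s + m - 1) id

theorem RTTSystem.glTT' (H : RTTSystem m n h ρ w T T' g S') :
    GlTT fun p => (T' p).toBlocks₂₂ :=
  H.inverse.glTT

/-- This is `RTTSystem.colDet_gauss` for the inverse system over the opposite ring. The Gauss
coordinates there are the transposes of `-f` and `-F`, since `T₁₁ T'₁₂ + T₁₂ T'₂₂ = 0` gives `T'₁₂ =
-F T'₂₂`, and similarly for the divided inverse. -/
theorem RTTSystem.rowDet_gauss (H : RTTSystem m n h ρ w T T' g S') (p : ℤ)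
    {f F : Matrix (Fin m) (Fin n) R} (hf : (1 + h • g).toBlocks₁₁ * f = g.toBlocks₁₂)
    (hF : (T p).toBlocks₁₁ * F = (T p).toBlocks₁₂) (k : Fin m) (l : Fin n) :
    (w - (p : K) * (h * ρ)) •
      (rowDet (fun p => (T' p).toBlocks₂₂) p id * f k l -
        f k l * rowDet (fun p => (T' p).toBlocks₂₂) p id) =
      -(ρ • ((h • f - F) k l * rowDet (fun p => (T' p).toBlocks₂₂) p id)) := by
  obtain ⟨N, hN⟩ := H.nilpotent
  have hF' : (T' p).toBlocks₁₂ = -(F * (T' p).toBlocks₂₂) := by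
    obtain ⟨X, hX⟩ := H.one_add p
    have e : (T p).toBlocks₁₁ = 1 + h • X.toBlocks₁₁ := by
      rw [hX]; ext a b; simp [Matrix.toBlocks₁₁, Matrix.one_apply]
    obtain ⟨α, hα₁, hα₂⟩ := exists_inverse_one_add_smul hN X.toBlocks₁₁
    rw [← e] at hα₁ hα₂
    have := congrArg Matrix.toBlocks₁₂ (H.mul_inv p)
    rw [toBlocks₁₂_mul, ← hF, Matrix.mul_assoc, ← Matrix.mul_add] at this
    have t := congrArg (fun Y => α * Y) this
    have z : (1 : Matrix (Idx m n) (Idx m n) R).toBlocks₁₂ = 0 := by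
      ext a b; simp [Matrix.toBlocks₁₂]
    simp only [← Matrix.mul_assoc, hα₂, Matrix.one_mul, z, Matrix.mul_zero] at t
    exact eq_neg_of_add_eq_zero_left t
  have hf' : (-(S' * g)).toBlocks₁₂ = -(f * S'.toBlocks₂₂) := by
    obtain ⟨σ, hσ₁, hσ₂⟩ := exists_inverse_one_add_smul hN g.toBlocks₁₁
    have e₃ : (1 + h • g).toBlocks₁₁ = 1 + h • g.toBlocks₁₁ := by
      ext a b; simp [Matrix.toBlocks₁₁, Matrix.one_apply]
    rw [← e₃] at hσ₁ hσ₂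
    have e₄ : (1 + h • g).toBlocks₁₂ = h • g.toBlocks₁₂ := by
      ext a b; simp [Matrix.toBlocks₁₂]
    have e₅ : S'.toBlocks₂₂ = 1 + h • (-(S' * g)).toBlocks₂₂ := by
      conv_lhs => rw [← one_add_divided_inverse H.inv_smul]
      ext a b; simp [Matrix.toBlocks₂₂, Matrix.one_apply]
    have t₁ : (1 + h • g) * (-(S' * g)) = -g := by
      rw [mul_neg, ← mul_assoc, H.smul_inv, one_mul]
    have t₂ := congrArg Matrix.toBlocks₁₂ t₁
    have t₃ : (-g).toBlocks₁₂ = -((1 + h • g).toBlocks₁₁ * f) := by rw [hf]; rfl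
    rw [toBlocks₁₂_mul, e₄, ← hf, t₃] at t₂
    have t₄ : (1 + h • g).toBlocks₁₁ * ((-(S' * g)).toBlocks₁₂ + f * S'.toBlocks₂₂) = 0 := by
      rw [e₅, Matrix.mul_add, Matrix.mul_add, Matrix.mul_one, Matrix.mul_add, Matrix.mul_smul,
        Matrix.mul_smul]
      rw [Matrix.smul_mul, Matrix.mul_assoc] at t₂
      rw [add_left_comm, t₂, add_neg_cancel]
    have t₅ := congrArg (fun Y => σ * Y) t₄
    simp only [← Matrix.mul_assoc, hσ₂, Matrix.one_mul, Matrix.mul_zero] at t₅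
    exact eq_neg_of_add_eq_zero_left t₅
  -- Chosen so that the last argument of a column determinant of size `n` starting at `s` is `p`.
  set s := p - n + 1 with hs
  have hp : s + n - 1 = p := by rw [hs]; ring
  have key := H.inverse.op.colDet_gauss s (f := Matrix.of fun i j => MulOpposite.op (-(f j i)))
    (F := Matrix.of fun i j => MulOpposite.op (-(F j i))) ?_ ?_ l k
  · rw [hp] at key
    have e : (fun p => (opTranspose (swapIdx (T' p))).toBlocks₁₁) =
        fun p => opTranspose (T' p).toBlocks₂₂ := rfl
    rw [e, colDet_opTranspose H.glTT', hp] at key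
    set B := rowDet (fun p => (T' p).toBlocks₂₂) p id
    have e₁ : (w - (p : K) * (h * ρ)) • (-(f k l) * B - B * -(f k l)) =
        ρ • ((h • -(f k l) - -(F k l)) * B) := congrArg MulOpposite.unop key
    have e₂ : (h • f - F) k l = h • f k l - F k l := rfl
    rw [e₂]
    generalize w - (p : K) * (h * ρ) = w' at *
    calc w' • (B * f k l - f k l * B) = w' • (-(f k l) * B - B * -(f k l)) := by
          congr 1; noncomm_ring
      _ = _ := by
          rw [e₁, ← smul_neg, ← neg_mul]
          congr 2
          rw [smul_neg]; abel
  · rw [opTranspose_one_add, swapIdx_one_add, one_add_divided_inverse H.inv_smul]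
    ext i j
    have := congrFun (congrFun hf' j) i
    apply MulOpposite.unop_injective
    simp only [Matrix.mul_apply, Matrix.neg_apply] at this
    rw [Matrix.mul_apply, Finset.unop_sum]
    refine Eq.trans ?_ this.symm
    rw [← Finset.sum_neg_distrib]
    refine Finset.sum_congr rfl fun x _ => ?_
    exact neg_mul _ _
  · rw [hp]
    ext i j
    have := congrFun (congrFun hF' j) i
    apply MulOpposite.unop_injective
    simp only [Matrix.mul_apply, Matrix.neg_apply] at this
    rw [Matrix.mul_apply, Finset.unop_sum]
    refine Eq.trans ?_ this.symm
    rw [← Finset.sum_neg_distrib]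
    refine Finset.sum_congr rfl fun x _ => ?_
    exact neg_mul _ _

theorem RTTSystem.divided_inverse_inverse (H : RTTSystem m n h ρ w T T' g S') :
    -((1 + h • g) * -(S' * g)) = g := by
  rw [mul_neg, neg_neg, ← mul_assoc, H.smul_inv, one_mul]

/-- The quantum Berezinian commutes with the even block of `g(v)`. -/
theorem RTTSystem.commute_even (H : RTTSystem m n h ρ w T T' g S') (s : ℤ) (k l : Fin m) :
    Commute (systemBer T T' s) (g (Sum.inl k) (Sum.inl l)) := by
  obtain ⟨N, hN⟩ := H.nilpotent
  refine Commute.mul_left ?_ ?_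
  · rw [colDet_eq_rowDet H.torsionFree H.glTT]
    refine rowDet_commute H.torsionFree hN H.regular m H.glTT H.glTG (fun p => ?_) _ k l
    obtain ⟨X, hX⟩ := H.one_add p
    refine ⟨X.toBlocks₁₁, ?_⟩
    rw [hX]; ext a b; simp [Matrix.toBlocks₁₁, Matrix.one_apply]
  · refine altSum_commute fun q i j => ?_
    -- In the inverse system the entries of `T'₂₂` are the even ones. The divided inverse of the
    -- divided inverse is `g`, whose even block now sits in the odd position.
    have := (H.inverse.tgX (s + m - 1 - (q : ℕ))).commute_divided_inverse (H.regular _)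
      H.inverse.smul_inv H.inverse.inv_smul j i k l
    rw [← swapIdx_mul] at this
    change Commute _ ((-((1 + h • g) * -(S' * g))) (Sum.inl k) (Sum.inl l)) at this
    rw [H.divided_inverse_inverse] at this
    exact this

/-- The quantum Berezinian commutes with the Gauss coordinates. -/
theorem RTTSystem.commute_gauss (H : RTTSystem m n h ρ w T T' g S') (s : ℤ)
    {f : Matrix (Fin m) (Fin n) R} (hf : (1 + h • g).toBlocks₁₁ * f = g.toBlocks₁₂) (k : Fin m)
    (l : Fin n) : Commute (systemBer T T' s) (f k l) := by
  obtain ⟨N, hN⟩ := H.nilpotent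
  obtain ⟨X, hX⟩ := H.one_add (s + m - 1)
  have e : (T (s + m - 1)).toBlocks₁₁ = 1 + h • X.toBlocks₁₁ := by
    rw [hX]; ext a b; simp [Matrix.toBlocks₁₁, Matrix.one_apply]
  obtain ⟨α, hα₁, hα₂⟩ := exists_inverse_one_add_smul hN X.toBlocks₁₁
  rw [← e] at hα₁ hα₂
  have hF : (T (s + m - 1)).toBlocks₁₁ * (α * (T (s + m - 1)).toBlocks₁₂) =
      (T (s + m - 1)).toBlocks₁₂ := by
    rw [← Matrix.mul_assoc, hα₁, Matrix.one_mul]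
  have h₁ := H.colDet_gauss s hf hF k l
  have h₂ := H.rowDet_gauss (s + m - 1) hf hF k l
  refine sub_eq_zero.1 (H.regular (s + m - 1) _ ?_)
  unfold systemBer
  generalize colDet (fun p => (T p).toBlocks₁₁) s id = A at *
  generalize rowDet (fun p => (T' p).toBlocks₂₂) (s + m - 1) id = B at *
  -- Leibniz rule: after multiplication by the common spectral factor the two terms become `± ρ A (h
  -- f - F) B`.
  have d : A * B * f k l - f k l * (A * B) =
      (A * f k l - f k l * A) * B + A * (B * f k l - f k l * B) := by noncomm_ring
  rw [d, smul_add, ← smul_mul_assoc, ← mul_smul_comm, h₁, h₂, smul_mul_assoc, mul_neg,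
    mul_smul_comm, mul_assoc, add_neg_cancel]

/-- Exchanging the roles of the blocks turns `A B` into `B A`, with row and column determinants
interchanged. The factors commute because the entries of `T₁₁` and `T'₂₂` do. The start `s + m - n`
makes the arguments of both determinants match the original ones. -/
theorem RTTSystem.systemBer_inverse (H : RTTSystem m n h ρ w T T' g S') (s : ℤ) :
    systemBer (fun p => swapIdx (T' p)) (fun p => swapIdx (T p)) (s + m - n) =
      systemBer T T' s := by
  have e₁ : colDet (fun p => (swapIdx (T' p)).toBlocks₁₁) (s + m - n) id =
      rowDet (fun p => (T' p).toBlocks₂₂) (s + m - 1) id := by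
    have := colDet_eq_rowDet H.torsionFree H.glTT' (s + m - n)
    rw [show s + m - n + n - 1 = s + m - 1 by ring] at this
    exact this
  have e₂ : rowDet (fun p => (swapIdx (T p)).toBlocks₂₂) (s + m - n + n - 1) id =
      colDet (fun p => (T p).toBlocks₁₁) s id := by
    rw [colDet_eq_rowDet H.torsionFree H.glTT, show s + m - n + n - 1 = s + m - 1 by ring]
    rfl
  unfold systemBer
  rw [e₁, e₂]
  refine (Commute.eq ?_).symm
  refine altSum_commute fun k i j => Commute.symm (altSum_commute fun k' i' j' => ?_)
  exact (H.comm _ _ _ _ _ _).symm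

theorem commute_matrix_mul {ι κ μ : Type} [Fintype κ] {x : R} {M : Matrix ι κ R} {N : Matrix κ μ R}
    (hM : ∀ i j, Commute x (M i j)) (hN : ∀ i j, Commute x (N i j)) (i : ι) (j : μ) :
    Commute x ((M * N) i j) := by
  rw [Matrix.mul_apply]
  exact Commute.sum_right _ _ _ fun k _ => (hM i k).mul_right (hN k j)

theorem commute_one_add_smul {ι : Type} [DecidableEq ι] {x : R} {M : Matrix ι ι R}
    (hM : ∀ i j, Commute x (M i j)) (i j : ι) : Commute x ((1 + h • M) i j) := by
  rw [Matrix.add_apply, Matrix.one_apply]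
  refine Commute.add_right ?_ ((hM i j).smul_right h)
  split_ifs
  · exact Commute.one_right _
  · exact Commute.zero_right _

/-- The quantum Berezinian of a system commutes with all entries of `g(v)`. -/
theorem RTTSystem.commute (H : RTTSystem m n h ρ w T T' g S') (s : ℤ) (i j : Idx m n) :
    Commute (systemBer T T' s) (g i j) := by
  obtain ⟨N, hN⟩ := H.nilpotent
  set b := systemBer T T' s with hb
  set g' := -(S' * g) with hg'
  have hS' : S' = 1 + h • g' := (one_add_divided_inverse H.inv_smul).symm
  have e₁ : (1 + h • g).toBlocks₁₁ = 1 + h • g.toBlocks₁₁ := by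
    ext a b; simp [Matrix.toBlocks₁₁, Matrix.one_apply]
  have e₂ : S'.toBlocks₂₂ = 1 + h • g'.toBlocks₂₂ := by
    rw [hS']; ext a b; simp [Matrix.toBlocks₂₂, Matrix.one_apply]
  have e₃ : S'.toBlocks₂₁ = h • g'.toBlocks₂₁ := by
    rw [hS']; ext a b; simp [Matrix.toBlocks₂₁]
  obtain ⟨σ, hσ₁, hσ₂⟩ := exists_inverse_one_add_smul hN g.toBlocks₁₁
  obtain ⟨D, hD₁, hD₂⟩ := exists_inverse_one_add_smul hN g'.toBlocks₂₂
  have hf : (1 + h • g).toBlocks₁₁ * (σ * g.toBlocks₁₂) = g.toBlocks₁₂ := by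
    rw [e₁, ← Matrix.mul_assoc, hσ₁, Matrix.one_mul]
  have hf' : S'.toBlocks₂₂ * (D * g'.toBlocks₂₁) = g'.toBlocks₂₁ := by
    rw [e₂, ← Matrix.mul_assoc, hD₁, Matrix.one_mul]
  have c₀₀ : ∀ i j, Commute b (g.toBlocks₁₁ i j) := H.commute_even s
  have c₁₁' : ∀ i j, Commute b (g'.toBlocks₂₂ i j) := fun i j => by
    have := H.inverse.commute_even (s + m - n) i j
    rwa [H.systemBer_inverse] at this
  have c_f : ∀ i j, Commute b ((σ * g.toBlocks₁₂) i j) := H.commute_gauss s hf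
  have c_f' : ∀ i j, Commute b ((D * g'.toBlocks₂₁) i j) := fun i j => by
    have := H.inverse.commute_gauss (s + m - n) (f := D * g'.toBlocks₂₁) (by
      rw [swapIdx_one_add, one_add_divided_inverse H.inv_smul]
      exact hf') i j
    rwa [H.systemBer_inverse] at this
  have c₀₁ : ∀ i j, Commute b (g.toBlocks₁₂ i j) := by
    rw [← hf, e₁]
    exact commute_matrix_mul (commute_one_add_smul c₀₀) c_f
  have cS : ∀ i j, Commute b ((1 + h • g'.toBlocks₂₂) i j) := commute_one_add_smul c₁₁'
  have c₁₀' : ∀ i j, Commute b (g'.toBlocks₂₁ i j) := by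
    rw [← hf', e₂]
    exact commute_matrix_mul cS c_f'
  have cD : ∀ i j, Commute b (D i j) := commute_inverse_apply hD₁ hD₂ cS
  have t : S' * g = -g' := by rw [hg', neg_neg]
  -- The remaining blocks of `g` are found from the lower blocks of `S' g = -g'`, solving with the
  -- inverse `D` of `S'₂₂`.
  have solve : ∀ {μ : Type} (Y Z W : Matrix (Fin n) μ R), Z + S'.toBlocks₂₂ * Y = -W →
      (∀ i j, Commute b (Z i j)) → (∀ i j, Commute b (W i j)) → ∀ i j, Commute b (Y i j) := by
    intro μ Y Z W e hZ hW
    have : Y = D * (-W - Z) := by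
      rw [← e, add_sub_cancel_left, e₂, ← Matrix.mul_assoc, hD₂, Matrix.one_mul]
    rw [this]
    exact commute_matrix_mul cD fun i j => (hW i j).neg_right.sub_right (hZ i j)
  have c₁₀ : ∀ i j, Commute b (g.toBlocks₂₁ i j) := by
    have := congrArg Matrix.toBlocks₂₁ t
    rw [toBlocks₂₁_mul] at this
    refine solve _ _ _ this (commute_matrix_mul ?_ c₀₀) c₁₀'
    rw [e₃]
    exact fun i j => (c₁₀' i j).smul_right h
  have c₁₁ : ∀ i j, Commute b (g.toBlocks₂₂ i j) := by
    have := congrArg Matrix.toBlocks₂₂ t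
    rw [toBlocks₂₂_mul] at this
    refine solve _ _ _ this (commute_matrix_mul ?_ c₀₁) c₁₁'
    rw [e₃]
    exact fun i j => (c₁₀' i j).smul_right h
  rcases i with i | i <;> rcases j with j | j
  · exact c₀₀ i j
  · exact c₀₁ i j
  · exact c₁₀ i j
  · exact c₁₁ i j

end Berezinian

/-! ### Substitutions in power series with noncommuting coefficients -/

section Substitution

open PowerSeries

variable {k A : Type} [CommRing k] [Ring A] [Algebra k A]

theorem commute_map_algebraMap (γ : k⟦X⟧) (f : A⟦X⟧) :
    Commute (PowerSeries.map (algebraMap k A) γ) f := by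
  ext n
  rw [coeff_mul, coeff_mul, ← Finset.Nat.sum_antidiagonal_swap]
  refine Finset.sum_congr rfl fun x _ => ?_
  rw [coeff_map, coeff_map]
  exact Algebra.commutes _ _

/-- The coefficientwise extension of an algebra structure to power series. -/
abbrev powerSeriesAlgebra : Algebra k⟦X⟧ A⟦X⟧ :=
  RingHom.toAlgebra' (PowerSeries.map (algebraMap k A)) commute_map_algebraMap

attribute [local instance] powerSeriesAlgebra

theorem powerSeries_smul_def (γ : k⟦X⟧) (f : A⟦X⟧) :
    γ • f = PowerSeries.map (algebraMap k A) γ * f := rfl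

theorem powerSeries_algebraMap (γ : k⟦X⟧) :
    algebraMap k⟦X⟧ A⟦X⟧ γ = PowerSeries.map (algebraMap k A) γ := rfl

theorem C_smul (c : k) (f : A⟦X⟧) (n : ℕ) :
    coeff n ((C c : k⟦X⟧) • f) = c • coeff n f := by
  rw [powerSeries_smul_def, map_C, coeff_C_mul, Algebra.smul_def]

theorem X_smul (f : A⟦X⟧) : (X : k⟦X⟧) • f = X * f := by
  rw [powerSeries_smul_def, map_X]

theorem C_pow_smul_eq_zero {h : k} {N : ℕ} (hN : ∀ x : A, h ^ N • x = 0) (f : A⟦X⟧) :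
    (C h : k⟦X⟧) ^ N • f = 0 := by
  ext n
  rw [← map_pow, C_smul, hN, map_zero]

/-- A power series with regular constant coefficient is regular. -/
theorem smul_regular_of_constantCoeff {F : k⟦X⟧}
    (hF : ∀ x : A, constantCoeff F • x = 0 → x = 0) (f : A⟦X⟧) (hf : F • f = 0) : f = 0 := by
  ext n
  induction n using Nat.strong_induction_on with
  | _ n ih =>
    have := congrArg (coeff n) hf
    rw [powerSeries_smul_def, coeff_mul, Finset.sum_eq_single (0, n)] at this
    · rw [coeff_map, coeff_zero_eq_constantCoeff_apply, ← Algebra.smul_def] at this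
      exact hF _ this
    · rintro ⟨i, j⟩ hij hne
      rw [Finset.HasAntidiagonal.mem_antidiagonal] at hij
      have hj : j < n := by
        rcases Nat.eq_zero_or_pos i with rfl | hi
        · simp only [zero_add] at hij
          exact absurd (by rw [hij]) hne
        · simp only at hij; omega
      simp only [ih j hj, map_zero, mul_zero]
    · intro hn
      exact absurd (Finset.HasAntidiagonal.mem_antidiagonal.2 (zero_add n)) hn

/-- Write `γ = X a + h b`. A product of `r` such factors contributing to the coefficient of `X^s`
contains at most `s` factors `X a`, hence at least `r - s ≥ N` factors `h b`. -/
theorem dvd_coeff_pow {h : k} {γ : k⟦X⟧} (hγ : h ∣ constantCoeff γ) {N s r : ℕ}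
    (hr : s + N ≤ r) : h ^ N ∣ coeff s (γ ^ r) := by
  obtain ⟨b, hb⟩ := hγ
  obtain ⟨a, ha⟩ : X ∣ γ - C (constantCoeff γ) := X_dvd_iff.2 (by simp)
  have e : γ = X * a + C (h * b) := by rw [← hb, ← ha]; ring
  rw [e, add_pow, map_sum]
  refine Finset.dvd_sum fun i hi => ?_
  by_cases his : s < i
  · have : coeff s ((X * a) ^ i * C (h * b) ^ (r - i) * ((r.choose i : ℕ) : k⟦X⟧)) = 0 := by
      rw [mul_pow, mul_assoc, mul_assoc, coeff_X_pow_mul', if_neg (by omega)]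
    rw [this]
    exact dvd_zero _
  · have : (X * a) ^ i * C (h * b) ^ (r - i) * ((r.choose i : ℕ) : k⟦X⟧) =
        C (h ^ N) * (C (h ^ (r - i - N)) * C (b ^ (r - i)) * (X * a) ^ i *
          ((r.choose i : ℕ) : k⟦X⟧)) := by
      have e₂ : h ^ (r - i) = h ^ N * h ^ (r - i - N) := by
        rw [← pow_add]; congr 1; omega
      rw [← map_pow, mul_pow h b, e₂, map_mul, map_mul]; ring
    rw [this, coeff_C_mul]
    exact dvd_mul_right _ _

variable {h : k} {N : ℕ}

theorem coeff_mul_pow_eq_zero (hN : ∀ x : A, h ^ N • x = 0) {γ : k⟦X⟧}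
    (hγ : h ∣ constantCoeff γ) {s r : ℕ} (hr : s + N ≤ r) (f : A⟦X⟧) :
    coeff s (f * PowerSeries.map (algebraMap k A) γ ^ r) = 0 := by
  rw [coeff_mul]
  refine Finset.sum_eq_zero fun x hx => ?_
  rw [Finset.HasAntidiagonal.mem_antidiagonal] at hx
  obtain ⟨d, hd⟩ := dvd_coeff_pow hγ (show x.2 + N ≤ r by omega)
  rw [← map_pow, coeff_map, hd, ← Algebra.commutes, ← Algebra.smul_def, mul_smul, hN]

/-- Evaluation of a polynomial at a central element. -/
def evalPoly (γ : k⟦X⟧) : Polynomial A⟦X⟧ →+* A⟦X⟧ :=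
  Polynomial.eval₂RingHom' (RingHom.id _) (PowerSeries.map (algebraMap k A) γ)
    fun f => (commute_map_algebraMap γ f).symm

theorem coeff_evalPoly_eq_zero (hN : ∀ x : A, h ^ N • x = 0) {γ : k⟦X⟧}
    (hγ : h ∣ constantCoeff γ) {s : ℕ} {P : Polynomial A⟦X⟧}
    (hP : ∀ i < s + N, P.coeff i = 0) : coeff s (evalPoly γ P) = 0 := by
  change coeff s (Polynomial.eval₂ _ _ P) = 0
  rw [Polynomial.eval₂_eq_sum, Polynomial.sum_def, map_sum]
  refine Finset.sum_eq_zero fun i hi => ?_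
  refine coeff_mul_pow_eq_zero hN hγ ?_ _
  by_contra hc
  exact Polynomial.mem_support_iff.1 hi (hP i (not_le.1 hc))

/-- Modulo `h^N`, the coefficient at `s` sees only powers of `γ` below `s + N`. This makes
substitution into power series a finite computation and justifies the truncation bound in `evalAt`.
-/
theorem coeff_evalPoly_congr (hN : ∀ x : A, h ^ N • x = 0) {γ : k⟦X⟧}
    (hγ : h ∣ constantCoeff γ) {s : ℕ} {P Q : Polynomial A⟦X⟧}
    (hP : ∀ i < s + N, P.coeff i = Q.coeff i) :
    coeff s (evalPoly γ P) = coeff s (evalPoly γ Q) := by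
  rw [← sub_eq_zero, ← map_sub, ← map_sub]
  refine coeff_evalPoly_eq_zero hN hγ fun i hi => ?_
  rw [Polynomial.coeff_sub, hP i hi, sub_self]

/-- Evaluation of a power series at a central element `γ` whose constant coefficient is divisible
by the nilpotent element `h`. -/
def evalAt (hN : ∀ x : A, h ^ N • x = 0) {γ : k⟦X⟧} (hγ : h ∣ constantCoeff γ) :
    A⟦X⟧⟦X⟧ →+* A⟦X⟧ where
  toFun F := PowerSeries.mk fun s => coeff s (evalPoly γ (trunc (s + N) F))
  map_zero' := by ext s; simp
  map_one' := by
    ext s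
    rw [coeff_mk]
    conv_rhs => rw [← map_one (evalPoly (A := A) γ)]
    refine coeff_evalPoly_congr hN hγ fun i hi => ?_
    rw [coeff_trunc, if_pos hi, coeff_one, Polynomial.coeff_one]
  map_add' F G := by ext s; simp
  map_mul' F G := by
    ext s
    rw [coeff_mk, coeff_mul]
    have e : ∀ F : A⟦X⟧⟦X⟧, ∀ x ≤ s, coeff x (evalPoly γ (trunc (x + N) F)) =
        coeff x (evalPoly γ (trunc (s + N) F)) := fun F x hx =>
      coeff_evalPoly_congr hN hγ fun i hi => by
        rw [coeff_trunc, coeff_trunc, if_pos hi, if_pos (by omega)]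
    have e₂ : ∑ p ∈ Finset.HasAntidiagonal.antidiagonal s,
        coeff p.1 (PowerSeries.mk fun s => coeff s (evalPoly γ (trunc (s + N) F))) *
        coeff p.2 (PowerSeries.mk fun s => coeff s (evalPoly γ (trunc (s + N) G))) =
        coeff s (evalPoly γ (trunc (s + N) F * trunc (s + N) G)) := by
      rw [map_mul, coeff_mul]
      refine Finset.sum_congr rfl fun p hp => ?_
      rw [Finset.HasAntidiagonal.mem_antidiagonal] at hp
      rw [coeff_mk, coeff_mk, e F _ (by omega), e G _ (by omega)]
    rw [e₂]
    refine coeff_evalPoly_congr hN hγ fun i hi => ?_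
    rw [coeff_trunc, if_pos hi, coeff_mul, Polynomial.coeff_mul]
    refine Finset.sum_congr rfl fun p hp => ?_
    rw [Finset.HasAntidiagonal.mem_antidiagonal] at hp
    rw [coeff_trunc, coeff_trunc, if_pos (by omega), if_pos (by omega)]

variable (hN : ∀ x : A, h ^ N • x = 0) {γ : k⟦X⟧} (hγ : h ∣ constantCoeff γ)

theorem coeff_evalAt {s M : ℕ} (hM : s + N ≤ M) (F : A⟦X⟧⟦X⟧) :
    coeff s (evalAt hN hγ F) = coeff s (evalPoly γ (trunc M F)) := by
  refine (coeff_mk s fun s => coeff s (evalPoly γ (trunc (s + N) F))).trans ?_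
  refine coeff_evalPoly_congr hN hγ fun i hi => ?_
  rw [coeff_trunc, coeff_trunc, if_pos hi, if_pos (by omega)]

theorem evalAt_C (f : A⟦X⟧) : evalAt hN hγ (C f) = f := by
  ext s
  rw [coeff_evalAt hN hγ (Nat.le_succ (s + N)), trunc_C]
  congr 1
  exact Polynomial.eval₂_C _ _

theorem evalAt_X : evalAt hN hγ X = PowerSeries.map (algebraMap k A) γ := by
  ext s
  rw [coeff_evalAt hN hγ (M := s + N + 2) (by omega), trunc_X]
  congr 1
  exact Polynomial.eval₂_X _ _

/-- The substitution of `γ` for the variable of a power series. -/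
def shift : A⟦X⟧ →+* A⟦X⟧ := (evalAt hN hγ).comp (PowerSeries.map C)

theorem coeff_shift {s M : ℕ} (hM : s + N ≤ M) (f : A⟦X⟧) :
    coeff s (shift hN hγ f) = ∑ i ∈ Finset.range M, coeff s (γ ^ i) • coeff i f := by
  rw [shift, RingHom.comp_apply, coeff_evalAt hN hγ hM]
  change coeff s (Polynomial.eval₂ _ _ _) = _
  rw [eval₂_trunc_eq_sum_range, map_sum]
  refine Finset.sum_congr rfl fun i _ => ?_
  rw [RingHom.id_apply, coeff_map, coeff_C_mul, ← map_pow, coeff_map, Algebra.smul_def,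
    Algebra.commutes]

theorem shift_C (a : A) : shift hN hγ (C a) = C a := by
  rw [shift, RingHom.comp_apply, map_C, evalAt_C]

theorem shift_X : shift hN hγ X = PowerSeries.map (algebraMap k A) γ := by
  rw [shift, RingHom.comp_apply, map_X, evalAt_X]

/-- A shift of the inner variable `u` leaves series in the outer variable `v` unchanged. -/
theorem map_shift_map_C (f : A⟦X⟧) :
    PowerSeries.map (shift hN hγ) (PowerSeries.map C f) = PowerSeries.map C f := by
  ext i : 1
  rw [coeff_map, coeff_map, shift_C]

end Substitution

/-! ### The points `u - ph` -/

section Points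

open PowerSeries

variable {k : Type} [CommRing k]

/-- The numerator of the spectral parameter: `u` is the variable of the series `T⁺(u)`, and the
inverse of the variable of `T⁻(u)`. -/
def Sgn.num {R : Type} [One R] : Sgn → R → R
  | .plus, x => x
  | .minus, _ => 1

/-- The denominator of the spectral parameter. -/
def Sgn.den {R : Type} [One R] : Sgn → R → R
  | .plus, _ => 1
  | .minus, x => x

/-- The binomial series `(1 - c x)ᵃ`. -/
def binom (c : k) (a : ℤ) : k⟦X⟧ := rescale (-c) (binomialSeries k a)

theorem binom_add (c : k) (a b : ℤ) : binom c (a + b) = binom c a * binom c b := by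
  rw [binom, binomialSeries_add, map_mul]; rfl

theorem binom_zero (c : k) : binom c 0 = 1 := by
  rw [binom, binomialSeries_zero, map_one]

theorem binom_one (c : k) : binom c 1 = 1 - C c * X := by
  have := binomialSeries_nat (R := ℤ) (A := k) 1
  rw [binom, show (1 : ℤ) = ((1 : ℕ) : ℤ) by rfl, this, pow_one, map_add, map_one, rescale_X,
    map_neg]
  ring

theorem binom_neg_pow (c : k) (r : ℕ) : binom c (-1) ^ r = binom c (-r) := by
  induction r with
  | zero => simp [binom_zero]
  | succ r ih => rw [pow_succ, ih, ← binom_add]; congr 1; push_cast; ring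

theorem coeff_binom (c : k) (a : ℤ) (n : ℕ) :
    coeff n (binom c a) = ((Ring.choose a n : ℤ) : k) * (-c) ^ n := by
  rw [binom, coeff_rescale, binomialSeries_coeff, zsmul_one, mul_comm]

/-- The value of the variable of the power series `T^s` at the spectral parameter `u - ph`. -/
def Sgn.point (h : k) : Sgn → ℤ → k⟦X⟧
  | .plus, p => X - C ((p : k) * h)
  | .minus, p => X * binom ((p : k) * h) (-1)

/-- The common factor of the numerator and the denominator of `u - ph`. -/
def Sgn.scale (h : k) : Sgn → ℤ → k⟦X⟧
  | .plus, _ => 1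
  | .minus, p => 1 - C ((p : k) * h) * X

theorem dvd_constantCoeff_point (h : k) (s : Sgn) (p : ℤ) : h ∣ constantCoeff (s.point h p) := by
  cases s
  · simp [Sgn.point]
  · simp [Sgn.point]

/-- The fraction representing `u - ph` is rescaled to have the same denominator as `u`, so a shift
changes only the numerator. -/
theorem scale_mul_num (h : k) (s : Sgn) (p : ℤ) : s.scale h p * s.num (s.point h p) =
    s.num X - C ((p : k) * h) * s.den X := by
  cases s
  · simp [Sgn.point, Sgn.num, Sgn.den, Sgn.scale]
  · simp [Sgn.num, Sgn.den, Sgn.scale]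

theorem scale_mul_den (h : k) (s : Sgn) (p : ℤ) : s.scale h p * s.den (s.point h p) = s.den X := by
  cases s
  · simp [Sgn.den, Sgn.scale]
  · have e : (1 - C ((p : k) * h) * X) * binom ((p : k) * h) (-1) = 1 := by
      rw [← binom_one, ← binom_add, add_neg_cancel, binom_zero]
    simp only [Sgn.den, Sgn.scale, Sgn.point]
    rw [mul_left_comm, e, mul_one]

theorem coeff_point_pow_plus (h : k) (p : ℤ) (r s : ℕ) : coeff s (Sgn.plus.point h p ^ r) =
    if s ≤ r then (((r.choose s : ℤ) * (-p) ^ (r - s) : ℤ) : k) * h ^ (r - s) else 0 := by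
  have e : Sgn.plus.point h p ^ r =
      (((Polynomial.X + Polynomial.C (-((p : k) * h))) ^ r : Polynomial k) : k⟦X⟧) := by
    rw [Polynomial.coe_pow, Polynomial.coe_add, Polynomial.coe_X, Polynomial.coe_C, map_neg,
      ← sub_eq_add_neg]
    rfl
  rw [e, Polynomial.coeff_coe, Polynomial.coeff_X_add_C_pow]
  split_ifs with hs
  · push_cast
    rw [← neg_mul, mul_pow]; ring
  · rw [Nat.choose_eq_zero_of_lt (not_le.1 hs), Nat.cast_zero, mul_zero]

theorem coeff_point_pow_minus (h : k) (p : ℤ) (r s : ℕ) : coeff s (Sgn.minus.point h p ^ r) =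
    if r ≤ s then ((Ring.choose (-(r : ℤ)) (s - r) * (-p) ^ (s - r) : ℤ) : k) * h ^ (s - r)
    else 0 := by
  simp only [Sgn.point]
  rw [mul_pow, coeff_X_pow_mul', binom_neg_pow, coeff_binom]
  split_ifs
  · push_cast
    rw [← neg_mul, mul_pow]; ring
  · rfl

end Points

/-! ### The system of `RTT` relations of the double Yangian -/

section Transport

variable {K K' R R' I : Type} [CommRing K] [CommRing K'] [Ring R] [Ring R'] [Algebra K R]
  [Algebra K' R'] [DecidableEq I] {par : I → Bool}

theorem sgn_eq_intCast (a b : Bool) : sgn K a b = ((sgn ℤ a b : ℤ) : K) := by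
  cases a <;> cases b <;> simp [sgn]

/-- The homomorphism need not be linear over the scalars, since substitutions move the spectral
variable. Only the images of `h`, `ρ`, `w` matter, up to the factor `d` that restores cleared
denominators; the signs are integers and are preserved. -/
theorem RelX.map {h ρ w : K} {h' ρ' w' : K'} {T G : Matrix I I R} (H : RelX par h ρ w T G)
    (F : R →+* R') (d : K') (hh : F (algebraMap K R h) = algebraMap K' R' h')
    (hρ : algebraMap K' R' d * F (algebraMap K R ρ) = algebraMap K' R' ρ')
    (hw : algebraMap K' R' d * F (algebraMap K R w) = algebraMap K' R' w') :
    RelX par h' ρ' w' (T.map F) (G.map F) := by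
  intro i j k l
  have e : (1 + h' • G.map F) = (1 + h • G).map F := by
    ext a b
    simp only [Matrix.add_apply, Matrix.smul_apply, Matrix.map_apply, Algebra.smul_def, map_add,
      map_mul, hh, Matrix.one_apply]
    split_ifs <;> simp
  have key : ∀ (z₁ z₂ : ℤ) (x y z : R), w • (x - (z₁ : K) • y) = (ρ * (z₂ : K)) • z →
      w' • (F x - (z₁ : K') • F y) = (ρ' * (z₂ : K')) • F z := by
    intro z₁ z₂ x y z hx
    have := congrArg (fun x => algebraMap K' R' d * F x) hx
    simp only [mul_smul, Int.cast_smul_eq_zsmul] at this ⊢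
    rw [Algebra.smul_def w, Algebra.smul_def ρ, map_mul, map_mul, ← mul_assoc, ← mul_assoc, hw, hρ,
      map_sub, map_zsmul, map_zsmul] at this
    rw [Algebra.smul_def w', Algebra.smul_def ρ']
    exact this
  rw [e]
  have := H i j k l
  simp only [sgn_eq_intCast (K := K), ← Int.cast_mul] at this
  simp only [sgn_eq_intCast (K := K'), ← Int.cast_mul]
  have := key _ _ _ _ _ this
  rw [map_mul, map_mul, map_sub, map_mul, map_mul] at this
  exact this

end Transport

/-! ### Generator series in two spectral variables -/

section Realization

open PowerSeries

attribute [local instance] powerSeriesAlgebra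

variable {𝕜 A : Type} [CommRing 𝕜] [Ring A] [Algebra 𝕜 A] {m n : ℕ}

/-- The index of the coefficient of the `r`-th power of the variable in a generator series. -/
def Sgn.exponent : Sgn → ℕ → ℤ
  | .plus, r => r
  | .minus, r => -r

/-- A sequence of coefficients which occurs in a series of sign `s`. -/
def Sgn.Supports : Sgn → (ℤ → A) → Prop
  | .plus, f => ∀ a, a < 0 → f a = 0
  | .minus, f => ∀ a, 0 < a → f a = 0

/-- The generator series with the given coefficients. -/
def series (s : Sgn) (f : ℤ → A) : A⟦X⟧ := PowerSeries.mk fun r => f (s.exponent r)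

/-- The shifted index which occurs in the `RTT` relations. -/
def Sgn.index : Sgn → ℕ → ℤ
  | .plus, r => r
  | .minus, r => 1 - r

/-- The index is chosen so that multiplication by the numerator and by the denominator produces the
pair `a - 1`, `a` of the `RTT` relations for both signs. At the boundary `r = 0` the missing
coefficient is 0 by the support condition. -/
theorem coeff_num_smul_series {s : Sgn} {f : ℤ → A} (hf : s.Supports f) (r : ℕ) :
    coeff r ((s.num X : 𝕜⟦X⟧) • series s f) = f (s.index r - 1) := by
  cases s
  · simp only [Sgn.num, X_smul, Sgn.index]
    rcases r with _ | r
    · rw [coeff_zero_X_mul]; exact (hf _ (by simp)).symm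
    · rw [coeff_succ_X_mul, series, coeff_mk]; congr 1; simp [Sgn.exponent]
  · simp only [Sgn.num, one_smul, Sgn.index]
    rw [series, coeff_mk]; congr 1; simp [Sgn.exponent]

theorem coeff_den_smul_series {s : Sgn} {f : ℤ → A} (hf : s.Supports f) (r : ℕ) :
    coeff r ((s.den X : 𝕜⟦X⟧) • series s f) = f (s.index r) := by
  cases s
  · simp only [Sgn.den, one_smul, Sgn.index]
    rw [series, coeff_mk]; rfl
  · simp only [Sgn.den, X_smul, Sgn.index]
    rcases r with _ | r
    · rw [coeff_zero_X_mul]; exact (hf _ (by simp)).symm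
    · rw [coeff_succ_X_mul, series, coeff_mk]; congr 1; simp [Sgn.exponent]

/-- Coefficients `t^s_a = δ_{a0} + h g^s_a` of generator matrices, subject to the `RTT` relations
divided by `h`. -/
structure RTTCoeffs (h : 𝕜) (t g : Sgn → ℤ → Matrix (Idx m n) (Idx m n) A) : Prop where
  eq_one_add : ∀ s a, t s a = (if a = 0 then 1 else 0) + h • g s a
  supports : ∀ (s : Sgn) i j, s.Supports fun a => g s a i j
  rel : ∀ s₁ s₂, (s₁ = s₂ ∨ (s₁ = .minus ∧ s₂ = .plus)) → ∀ (a b : ℤ) (i j k l : Idx m n),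
    (t s₁ (a - 1) i j * g s₂ b k l -
      (sgn ℤ (isOdd i) (isOdd k) * sgn ℤ (isOdd i) (isOdd l) * sgn ℤ (isOdd j) (isOdd k) *
        sgn ℤ (isOdd j) (isOdd l)) • (g s₂ b k l * t s₁ (a - 1) i j)) -
    (t s₁ a i j * g s₂ (b - 1) k l -
      (sgn ℤ (isOdd i) (isOdd k) * sgn ℤ (isOdd i) (isOdd l) * sgn ℤ (isOdd j) (isOdd k) *
        sgn ℤ (isOdd j) (isOdd l)) • (g s₂ (b - 1) k l * t s₁ a i j)) =
    (sgn ℤ (isOdd i) (isOdd j) * sgn ℤ (isOdd i) (isOdd k) * sgn ℤ (isOdd j) (isOdd k)) •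
      (t s₁ a k j * t s₂ b i l - t s₂ b k j * t s₁ a i l)
  torsionFree : ∀ (c : ℤ) (x : A), c ≠ 0 → c • x = 0 → x = 0

/-- The matrix of generator series. -/
def seriesMatrix (s : Sgn) (f : Sgn → ℤ → Matrix (Idx m n) (Idx m n) A) :
    Matrix (Idx m n) (Idx m n) A⟦X⟧ := fun i j => series s fun a => f s a i j

/-- `u - v` times the denominators of `u` and `v`. -/
def specDiff (s₁ s₂ : Sgn) : 𝕜⟦X⟧⟦X⟧ :=
  C (s₁.num X) * s₂.den X - C (s₁.den X) * s₂.num X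

/-- The product of the denominators of `u` and `v`. -/
def specDen (s₁ s₂ : Sgn) : 𝕜⟦X⟧⟦X⟧ := C (s₁.den X) * s₂.den X

theorem den_smul_C_mul (s : Sgn) (f f' : A⟦X⟧) : (s.den X : 𝕜⟦X⟧⟦X⟧) •
    (C f * PowerSeries.map C f') = C f * PowerSeries.map C ((s.den X : 𝕜⟦X⟧) • f') := by
  cases s
  · simp only [Sgn.den, one_smul]
  · simp only [Sgn.den, X_smul, map_mul, map_X]
    rw [X_mul, X_mul, mul_assoc]

theorem num_smul_C_mul (s : Sgn) (f f' : A⟦X⟧) : (s.num X : 𝕜⟦X⟧⟦X⟧) •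
    (C f * PowerSeries.map C f') = C f * PowerSeries.map C ((s.num X : 𝕜⟦X⟧) • f') := by
  cases s
  · simp only [Sgn.num, X_smul, map_mul, map_X]
    rw [X_mul, X_mul, mul_assoc]
  · simp only [Sgn.num, one_smul]

theorem den_smul_mul_C (s : Sgn) (f f' : A⟦X⟧) : (s.den X : 𝕜⟦X⟧⟦X⟧) •
    (PowerSeries.map C f' * C f) = PowerSeries.map C ((s.den X : 𝕜⟦X⟧) • f') * C f := by
  cases s
  · simp only [Sgn.den, one_smul]
  · simp only [Sgn.den, X_smul, map_mul, map_X, mul_assoc]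

theorem num_smul_mul_C (s : Sgn) (f f' : A⟦X⟧) : (s.num X : 𝕜⟦X⟧⟦X⟧) •
    (PowerSeries.map C f' * C f) = PowerSeries.map C ((s.num X : 𝕜⟦X⟧) • f') * C f := by
  cases s
  · simp only [Sgn.num, X_smul, map_mul, map_X, mul_assoc]
  · simp only [Sgn.num, one_smul]

theorem C_smul_C_mul (c : 𝕜⟦X⟧) (f : A⟦X⟧) (y : A⟦X⟧⟦X⟧) :
    (C c : 𝕜⟦X⟧⟦X⟧) • (C f * y) = C (c • f) * y := by
  rw [powerSeries_smul_def, map_C, ← mul_assoc, ← map_mul]; rfl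

theorem C_smul_mul_C (c : 𝕜⟦X⟧) (f : A⟦X⟧) (y : A⟦X⟧⟦X⟧) :
    (C c : 𝕜⟦X⟧⟦X⟧) • (y * C f) = y * C (c • f) := by
  rw [← mul_smul_comm, powerSeries_smul_def, map_C, ← map_mul]; rfl

theorem coeff_C_mul_map_C (f f' : A⟦X⟧) (a b : ℕ) :
    coeff a (coeff b (C f * PowerSeries.map C f')) = coeff a f * coeff b f' := by
  rw [coeff_C_mul, coeff_map, coeff_mul_C]

theorem coeff_map_C_mul_C (f f' : A⟦X⟧) (a b : ℕ) :
    coeff a (coeff b (PowerSeries.map C f' * C f)) = coeff b f' * coeff a f := by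
  rw [coeff_mul_C, coeff_map, coeff_C_mul]

variable {h : 𝕜} {t g : Sgn → ℤ → Matrix (Idx m n) (Idx m n) A}

theorem RTTCoeffs.supports_t (H : RTTCoeffs h t g) (s : Sgn) (i j : Idx m n) :
    s.Supports fun a => t s a i j := by
  have := H.supports s i j
  cases s
  · intro a ha
    have e : g .plus a i j = 0 := this a ha
    simp [H.eq_one_add, ha.ne, e]
  · intro a ha
    have e : g .minus a i j = 0 := this a ha
    simp [H.eq_one_add, ha.ne', e]

theorem RTTCoeffs.seriesMatrix_eq (H : RTTCoeffs h t g) (s : Sgn) :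
    seriesMatrix s t = 1 + (C h : 𝕜⟦X⟧) • seriesMatrix s g := by
  ext i j r
  simp only [seriesMatrix, series, coeff_mk, Matrix.add_apply, map_add, Matrix.smul_apply, C_smul,
    H.eq_one_add, Matrix.one_apply]
  congr 1
  have e : s.exponent r = 0 ↔ r = 0 := by cases s <;> simp [Sgn.exponent]
  by_cases hr : r = 0 <;> by_cases hij : i = j <;>
    simp [(show s.exponent 0 = 0 by cases s <;> simp [Sgn.exponent]), e, hr, hij, coeff_one, Matrix.one_apply]

theorem one_add_map_map_C (h : 𝕜) (M : Matrix (Idx m n) (Idx m n) A⟦X⟧) :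
    1 + (C (C h) : 𝕜⟦X⟧⟦X⟧) • M.map (PowerSeries.map C) =
      (1 + (C h : 𝕜⟦X⟧) • M).map (PowerSeries.map C) := by
  refine Matrix.ext fun i j => ?_
  simp only [Matrix.add_apply, Matrix.smul_apply, Matrix.map_apply, map_add, Matrix.one_apply]
  congr 1
  · split_ifs <;> simp
  · rw [powerSeries_smul_def, powerSeries_smul_def, map_C, map_C,
      (PowerSeries.map (C : A →+* A⟦X⟧)).map_mul, map_C, powerSeries_algebraMap, map_C]

theorem coeff_specDiff_smul {s₁ s₂ : Sgn} {f f' : ℤ → A} (hf : s₁.Supports f)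
    (hf' : s₂.Supports f') (ε : ℤ) (a b : ℕ) :
    coeff a (coeff b ((specDiff s₁ s₂ : 𝕜⟦X⟧⟦X⟧) • (C (series s₁ f) * PowerSeries.map C (series s₂ f') -
      (ε : 𝕜⟦X⟧⟦X⟧) • (PowerSeries.map C (series s₂ f') * C (series s₁ f))))) =
    (f (s₁.index a - 1) * f' (s₂.index b) - ε • (f' (s₂.index b) * f (s₁.index a - 1))) -
      (f (s₁.index a) * f' (s₂.index b - 1) - ε • (f' (s₂.index b - 1) * f (s₁.index a))) := by
  rw [smul_sub, smul_comm, Int.cast_smul_eq_zsmul]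
  simp only [specDiff, sub_smul, mul_smul, den_smul_C_mul, num_smul_C_mul, den_smul_mul_C,
    num_smul_mul_C, C_smul_C_mul, C_smul_mul_C, map_sub, map_zsmul, coeff_C_mul_map_C,
    coeff_map_C_mul_C, coeff_num_smul_series hf, coeff_den_smul_series hf,
    coeff_num_smul_series hf', coeff_den_smul_series hf', smul_sub]
  abel

theorem coeff_specDen_smul_C_mul {s₁ s₂ : Sgn} {f f' : ℤ → A} (hf : s₁.Supports f)
    (hf' : s₂.Supports f') (a b : ℕ) :
    coeff a (coeff b ((specDen s₁ s₂ : 𝕜⟦X⟧⟦X⟧) •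
      (C (series s₁ f) * PowerSeries.map C (series s₂ f')))) =
    f (s₁.index a) * f' (s₂.index b) := by
  simp only [specDen, mul_smul, den_smul_C_mul, C_smul_C_mul, coeff_C_mul_map_C,
    coeff_den_smul_series hf, coeff_den_smul_series hf']

theorem coeff_specDen_smul_mul_C {s₁ s₂ : Sgn} {f f' : ℤ → A} (hf : s₁.Supports f)
    (hf' : s₂.Supports f') (a b : ℕ) :
    coeff a (coeff b ((specDen s₁ s₂ : 𝕜⟦X⟧⟦X⟧) •
      (PowerSeries.map C (series s₂ f') * C (series s₁ f)))) =
    f' (s₂.index b) * f (s₁.index a) := by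
  simp only [specDen, mul_smul, den_smul_mul_C, C_smul_mul_C, coeff_map_C_mul_C,
    coeff_den_smul_series hf, coeff_den_smul_series hf']

theorem RTTCoeffs.relX_of_rel (H : RTTCoeffs h t g) {s₁ s₂ : Sgn}
    (hs : s₁ = s₂ ∨ (s₁ = .minus ∧ s₂ = .plus)) :
    RelX isOdd (C (C h) : 𝕜⟦X⟧⟦X⟧) (specDen s₁ s₂) (specDiff s₁ s₂)
      ((seriesMatrix s₁ t).map C) ((seriesMatrix s₂ g).map (PowerSeries.map C)) := by
  intro i j k l
  rw [one_add_map_map_C, ← H.seriesMatrix_eq]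
  simp only [sgn_eq_intCast (K := 𝕜⟦X⟧⟦X⟧), ← Int.cast_mul]
  ext b a
  simp only [Matrix.map_apply, seriesMatrix]
  rw [coeff_specDiff_smul (H.supports_t _ _ _) (H.supports _ _ _), mul_comm (specDen s₁ s₂),
    mul_smul _ (specDen s₁ s₂), Int.cast_smul_eq_zsmul, smul_sub (specDen s₁ s₂), H.rel s₁ s₂ hs, map_zsmul,
    map_zsmul, map_sub, map_sub, coeff_specDen_smul_C_mul (H.supports_t _ _ _) (H.supports_t _ _ _),
    coeff_specDen_smul_mul_C (H.supports_t _ _ _) (H.supports_t _ _ _)]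

/-- Identity matrices have zero supercommutator with everything, so both sides reduce to `h` times
the supercommutator of the divided coefficients. This transfers the division by `h` from one factor
to the other. -/
theorem RTTCoeffs.bracket_swap (H : RTTCoeffs h t g) (s₁ s₂ : Sgn) (a b : ℤ)
    (i j k l : Idx m n) {ε : ℤ} (hε : ε = sgn ℤ (isOdd i) (isOdd k) * sgn ℤ (isOdd i) (isOdd l) *
      sgn ℤ (isOdd j) (isOdd k) * sgn ℤ (isOdd j) (isOdd l)) :
    t s₁ a i j * g s₂ b k l - ε • (g s₂ b k l * t s₁ a i j) =
      -(ε • (t s₂ b k l * g s₁ a i j - ε • (g s₁ a i j * t s₂ b k l))) := by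
  have e₁ : ε * ε = 1 := by
    rw [hε]
    generalize isOdd i = p₁
    generalize isOdd j = p₂
    generalize isOdd k = p₃
    generalize isOdd l = p₄
    revert p₁ p₂ p₃ p₄
    decide
  have e₂ : ∀ (x : A) (c : Prop) [Decidable c],
      (if c then (1 : Matrix (Idx m n) (Idx m n) A) else 0) i j * x -
        ε • (x * (if c then (1 : Matrix (Idx m n) (Idx m n) A) else 0) i j) = 0 := by
    intro x c _
    split_ifs
    · rw [Matrix.one_apply]
      split_ifs with hij
      · have : ε = 1 := by
          rw [hε, hij]
          generalize isOdd j = p₂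
          generalize isOdd k = p₃
          generalize isOdd l = p₄
          revert p₂ p₃ p₄
          decide
        rw [this]; simp
      · simp
    · simp
  have e₃ : ∀ (x : A) (c : Prop) [Decidable c],
      (if c then (1 : Matrix (Idx m n) (Idx m n) A) else 0) k l * x -
        ε • (x * (if c then (1 : Matrix (Idx m n) (Idx m n) A) else 0) k l) = 0 := by
    intro x c _
    split_ifs
    · rw [Matrix.one_apply]
      split_ifs with hij
      · have : ε = 1 := by
          rw [hε, hij]
          generalize isOdd j = p₂
          generalize isOdd i = p₃
          generalize isOdd l = p₄
          revert p₂ p₃ p₄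
          decide
        rw [this]; simp
      · simp
    · simp
  rw [H.eq_one_add s₁, H.eq_one_add s₂]
  have f₁ := e₂ (g s₂ b k l) (a = 0)
  have f₂ := e₃ (g s₁ a i j) (b = 0)
  simp only [Matrix.add_apply, Matrix.smul_apply, add_mul, mul_add, smul_add, add_sub_add_comm, f₁,
    f₂, zero_add, smul_mul_assoc, mul_smul_comm, smul_sub, smul_smul, e₁, one_smul]
  simp only [smul_comm ε h]
  abel

/-- Reading the relation with the roles of `u` and `v` exchanged gives the second form. It covers
the pair (plus, minus), for which no relation is imposed directly. -/
theorem RTTCoeffs.relY_of_rel (H : RTTCoeffs h t g) {s₁ s₂ : Sgn}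
    (hs : s₂ = s₁ ∨ (s₂ = .minus ∧ s₁ = .plus)) :
    RelY isOdd (C (C h) : 𝕜⟦X⟧⟦X⟧) (specDen s₁ s₂) (specDiff s₁ s₂)
      ((seriesMatrix s₁ t).map C) ((seriesMatrix s₂ g).map (PowerSeries.map C)) := by
  intro i j k l
  rw [one_add_map_map_C, ← H.seriesMatrix_eq]
  simp only [sgn_eq_intCast (K := 𝕜⟦X⟧⟦X⟧), ← Int.cast_mul]
  have e : ∀ x : A, (sgn ℤ (isOdd j) (isOdd k) * sgn ℤ (isOdd j) (isOdd l) *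
      sgn ℤ (isOdd k) (isOdd l)) • x =
      (sgn ℤ (isOdd i) (isOdd k) * sgn ℤ (isOdd i) (isOdd l) *
        sgn ℤ (isOdd j) (isOdd k) * sgn ℤ (isOdd j) (isOdd l)) •
      (sgn ℤ (isOdd k) (isOdd l) * sgn ℤ (isOdd k) (isOdd i) * sgn ℤ (isOdd l) (isOdd i)) • x := by
    intro x
    rw [smul_smul]
    congr 1
    generalize isOdd i = p₁
    generalize isOdd j = p₂
    generalize isOdd k = p₃
    generalize isOdd l = p₄
    revert p₁ p₂ p₃ p₄
    decide
  have e' : sgn ℤ (isOdd k) (isOdd i) * sgn ℤ (isOdd k) (isOdd j) * sgn ℤ (isOdd l) (isOdd i) *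
      sgn ℤ (isOdd l) (isOdd j) = sgn ℤ (isOdd i) (isOdd k) * sgn ℤ (isOdd i) (isOdd l) *
        sgn ℤ (isOdd j) (isOdd k) * sgn ℤ (isOdd j) (isOdd l) := by
    rw [sgn_comm (isOdd k), sgn_comm (isOdd k), sgn_comm (isOdd l), sgn_comm (isOdd l)]
    ring
  ext b a
  have := H.rel s₂ s₁ hs (s₂.index b) (s₁.index a) k l i j
  rw [e'] at this
  have B₁ := H.bracket_swap s₁ s₂ (s₁.index a - 1) (s₂.index b) i j k l rfl
  have B₂ := H.bracket_swap s₁ s₂ (s₁.index a) (s₂.index b - 1) i j k l rfl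
  simp only [Matrix.map_apply, seriesMatrix]
  rw [coeff_specDiff_smul (H.supports_t _ _ _) (H.supports _ _ _), mul_comm (specDen s₁ s₂),
    mul_smul _ (specDen s₁ s₂), Int.cast_smul_eq_zsmul, smul_sub (specDen s₁ s₂), map_zsmul,
    map_zsmul, map_sub, map_sub, coeff_specDen_smul_C_mul (H.supports_t _ _ _) (H.supports_t _ _ _),
    coeff_specDen_smul_mul_C (H.supports_t _ _ _) (H.supports_t _ _ _), B₁, B₂, e, ← this, neg_sub_neg, ← smul_sub]

end Realization

/-- At two points of the same series the difference is an integer multiple of `h`. That `h` is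
absorbed into `h • G`, so only the regular factor `ρ` is cancelled. -/
theorem RelX.cancel {K R I : Type} [CommRing K] [Ring R] [Algebra K R] [DecidableEq I]
    {par : I → Bool} {h ρ z : K} {T G : Matrix I I R} (X : RelX par h ρ (z * (h * ρ)) T G)
    (hρ : ∀ x : R, ρ • x = 0 → x = 0) : RelX par 1 1 z T (h • G) := by
  intro i j k l
  have H := X i j k l
  refine sub_eq_zero.1 (hρ _ ?_)
  rw [smul_sub, one_smul, one_mul, sub_eq_zero, ← mul_smul ρ (_ * _ * _), ← H, Matrix.smul_apply,
    mul_smul_comm, smul_mul_assoc, smul_comm _ h, ← smul_sub, smul_smul,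
    smul_smul]
  congr 1
  ring

theorem RelX.symm {K R I : Type} [CommRing K] [Ring R] [Algebra K R] [DecidableEq I]
    {par : I → Bool} {z : K} {T S : Matrix I I R} (X : RelX par 1 1 z T (S - 1)) :
    RelY par 1 1 (-z) S (T - 1) := by
  intro i j k l
  have H := X k l i j
  simp only [one_smul, add_sub_cancel, one_mul] at H ⊢
  have e₁ : ∀ (M : Matrix I I R) (i j k l : I), M i j * (1 : Matrix I I R) k l -
      (sgn K (par i) (par k) * sgn K (par i) (par l) * sgn K (par j) (par k) *
        sgn K (par j) (par l)) • ((1 : Matrix I I R) k l * M i j) = 0 := by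
    intro M i j k l
    rw [Matrix.one_apply]
    split_ifs with hkl
    · rw [hkl]
      cases par i <;> cases par j <;> cases par l <;> simp [sgn]
    · simp
  have e₂ : ∀ (M N : Matrix I I R) (i j k l : I), M i j * (N - 1) k l -
      (sgn K (par i) (par k) * sgn K (par i) (par l) * sgn K (par j) (par k) *
        sgn K (par j) (par l)) • ((N - 1) k l * M i j) = M i j * N k l -
      (sgn K (par i) (par k) * sgn K (par i) (par l) * sgn K (par j) (par k) *
        sgn K (par j) (par l)) • (N k l * M i j) := by
    intro M N i j k l
    rw [Matrix.sub_apply, mul_sub, sub_mul, smul_sub, sub_sub_sub_comm, e₁, sub_zero]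
  rw [e₂] at H ⊢
  have e₃ : S i j * T k l - (sgn K (par i) (par k) * sgn K (par i) (par l) *
        sgn K (par j) (par k) * sgn K (par j) (par l)) • (T k l * S i j) =
      -((sgn K (par i) (par k) * sgn K (par i) (par l) * sgn K (par j) (par k) *
        sgn K (par j) (par l)) • (T k l * S i j - (sgn K (par k) (par i) * sgn K (par k) (par j) *
        sgn K (par l) (par i) * sgn K (par l) (par j)) • (S i j * T k l))) := by
    cases par i <;> cases par j <;> cases par k <;> cases par l <;> simp [sgn]
  rw [e₃, smul_neg, neg_smul, neg_neg, smul_comm, H, smul_smul]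
  congr 1
  cases par i <;> cases par j <;> cases par k <;> cases par l <;> simp [sgn]

section System

open PowerSeries

attribute [local instance] powerSeriesAlgebra

variable {𝕜 A : Type} [CommRing 𝕜] [Ring A] [Algebra 𝕜 A] {m n : ℕ}

/-! ### Regularity of the spectral factors -/

/-- For the plus sign, `x f = p h f` gives `x^N f = p^N h^N f = 0`, hence `f = 0`. For the minus
sign the factor has constant coefficient 1. -/
theorem num_sub_regular {h : 𝕜} {N : ℕ} (hN : ∀ x : A, h ^ N • x = 0) (s : Sgn) (p : ℤ)
    (f : A⟦X⟧) (hf : (s.num X - C ((p : 𝕜) * h) * s.den X : 𝕜⟦X⟧) • f = 0) : f = 0 := by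
  cases s
  · simp only [Sgn.num, Sgn.den, mul_one, sub_smul, sub_eq_zero] at hf
    have e : ∀ r : ℕ, (X : 𝕜⟦X⟧) ^ r • f = (C ((p : 𝕜) * h) : 𝕜⟦X⟧) ^ r • f := by
      intro r
      induction r with
      | zero => simp
      | succ r ih => rw [pow_succ, mul_smul, hf, smul_comm, ih, smul_smul, pow_succ']
    have e₂ : (X : 𝕜⟦X⟧) ^ N • f = 0 := by
      rw [e, ← map_pow, mul_pow, map_mul, mul_smul, map_pow C h, C_pow_smul_eq_zero hN, smul_zero]
    ext r
    have := congrArg (coeff (r + N)) e₂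
    rw [powerSeries_smul_def, map_pow, map_X, coeff_X_pow_mul] at this
    exact this
  · refine smul_regular_of_constantCoeff (fun x hx => ?_) f hf
    simpa [Sgn.num, Sgn.den] using hx

theorem den_regular (s : Sgn) (f : A⟦X⟧) (hf : (s.den X : 𝕜⟦X⟧) • f = 0) : f = 0 := by
  cases s
  · simpa [Sgn.den] using hf
  · simp only [Sgn.den, X_smul] at hf
    ext r
    have := congrArg (coeff (r + 1)) hf
    rwa [coeff_succ_X_mul] at this

/-- It suffices to look at the constant coefficient in the outer variable, which is a shifted
numerator or, up to sign, a denominator in `u`. -/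
theorem specDiff_sub_regular {h : 𝕜} {N : ℕ} (hN : ∀ x : A, h ^ N • x = 0) (s₁ s₂ : Sgn) (p : ℤ)
    (x : A⟦X⟧⟦X⟧)
    (hx : (specDiff s₁ s₂ - (p : 𝕜⟦X⟧⟦X⟧) * (C (C h) * specDen s₁ s₂)) • x = 0) : x = 0 := by
  refine smul_regular_of_constantCoeff (fun f hf => ?_) x hx
  have e : constantCoeff (specDiff s₁ s₂ - (p : 𝕜⟦X⟧⟦X⟧) * (C (C h) * specDen s₁ s₂)) =
      match s₂ with
      | .plus => s₁.num X - C ((p : 𝕜) * h) * s₁.den X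
      | .minus => -(s₁.den X) := by
    cases s₂
    · simp [specDiff, specDen, Sgn.num, Sgn.den, mul_assoc]
    · simp [specDiff, specDen, Sgn.num, Sgn.den]
  rw [e] at hf
  cases s₂
  · exact num_sub_regular hN s₁ p f hf
  · simp only [neg_smul, neg_eq_zero] at hf
    exact den_regular s₁ f hf

/-! ### Shifts of the spectral parameters -/

variable {h : 𝕜} {N : ℕ}

/-- The shift `f(u) ↦ f(u - ph)` of series in the variable of sign `s`. -/
abbrev shiftSgn (hN : ∀ x : A, h ^ N • x = 0) (s : Sgn) (p : ℤ) : A⟦X⟧ →+* A⟦X⟧ :=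
  shift hN (dvd_constantCoeff_point h s p)

theorem algebraMap_num (s : Sgn) (γ : 𝕜⟦X⟧) :
    algebraMap 𝕜⟦X⟧ A⟦X⟧ (s.num γ) = s.num (algebraMap 𝕜⟦X⟧ A⟦X⟧ γ) := by
  cases s
  · rfl
  · exact map_one _

theorem algebraMap_den (s : Sgn) (γ : 𝕜⟦X⟧) :
    algebraMap 𝕜⟦X⟧ A⟦X⟧ (s.den γ) = s.den (algebraMap 𝕜⟦X⟧ A⟦X⟧ γ) := by
  cases s
  · exact map_one _
  · rfl

theorem map_num {R R' : Type} [Ring R] [Ring R'] (F : R →+* R') (s : Sgn) (x : R) :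
    F (s.num x) = s.num (F x) := by
  cases s
  · rfl
  · exact map_one F

theorem map_den {R R' : Type} [Ring R] [Ring R'] (F : R →+* R') (s : Sgn) (x : R) :
    F (s.den x) = s.den (F x) := by
  cases s
  · exact map_one F
  · rfl

theorem algebraMap_C (c : 𝕜⟦X⟧) : algebraMap 𝕜⟦X⟧⟦X⟧ A⟦X⟧⟦X⟧ (C c) = C (algebraMap 𝕜⟦X⟧ A⟦X⟧ c) :=
  map_C _ _

theorem algebraMap_X : algebraMap 𝕜⟦X⟧ A⟦X⟧ X = X := map_X _

theorem algebraMap_C' (c : 𝕜) : algebraMap 𝕜⟦X⟧ A⟦X⟧ (C c) = C (algebraMap 𝕜 A c) := map_C _ _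

variable (hN : ∀ x : A, h ^ N • x = 0)

theorem shiftSgn_X (s : Sgn) (p : ℤ) :
    shiftSgn hN s p X = algebraMap 𝕜⟦X⟧ A⟦X⟧ (s.point h p) := shift_X _ _

theorem shiftSgn_C_smul (s : Sgn) (p : ℤ) (c : 𝕜) (f : A⟦X⟧) :
    shiftSgn hN s p ((C c : 𝕜⟦X⟧) • f) = (C c : 𝕜⟦X⟧) • shiftSgn hN s p f := by
  rw [Algebra.smul_def, Algebra.smul_def, map_mul, algebraMap_C', shift_C]

variable {t g : Sgn → ℤ → Matrix (Idx m n) (Idx m n) A}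

theorem map_map_shift (M : Matrix (Idx m n) (Idx m n) A⟦X⟧) (σ : A⟦X⟧ →+* A⟦X⟧) :
    (M.map C).map (PowerSeries.map σ) = (M.map σ).map C := by
  exact Matrix.ext fun i j => map_C _ _

theorem RTTCoeffs.relX_shift_of_relX {s₁ s₂ : Sgn}
    (X₀ : RelX isOdd (C (C h) : 𝕜⟦X⟧⟦X⟧) (specDen s₁ s₂) (specDiff s₁ s₂)
      ((seriesMatrix s₁ t).map C) ((seriesMatrix s₂ g).map (PowerSeries.map C))) (p : ℤ) :
    RelX isOdd (C (C h) : 𝕜⟦X⟧⟦X⟧) (specDen s₁ s₂)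
      (specDiff s₁ s₂ - (p : 𝕜⟦X⟧⟦X⟧) * (C (C h) * specDen s₁ s₂))
      (((seriesMatrix s₁ t).map (shiftSgn hN s₁ p)).map C)
      ((seriesMatrix s₂ g).map (PowerSeries.map C)) := by
  have e : ((seriesMatrix s₂ g).map (PowerSeries.map C)).map (PowerSeries.map (shiftSgn hN s₁ p)) =
      (seriesMatrix s₂ g).map (PowerSeries.map C) :=
    Matrix.ext fun i j => map_shift_map_C hN (dvd_constantCoeff_point h s₁ p) _
  have e₁ : PowerSeries.map (shiftSgn hN s₁ p) (algebraMap 𝕜⟦X⟧⟦X⟧ A⟦X⟧⟦X⟧ (C (s₁.num X))) =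
      algebraMap 𝕜⟦X⟧⟦X⟧ A⟦X⟧⟦X⟧ (C (s₁.num (s₁.point h p))) := by
    rw [algebraMap_C, algebraMap_C, map_C, algebraMap_num, algebraMap_num, map_num, algebraMap_X,
      shiftSgn_X]
  have e₂ : PowerSeries.map (shiftSgn hN s₁ p) (algebraMap 𝕜⟦X⟧⟦X⟧ A⟦X⟧⟦X⟧ (C (s₁.den X))) =
      algebraMap 𝕜⟦X⟧⟦X⟧ A⟦X⟧⟦X⟧ (C (s₁.den (s₁.point h p))) := by
    rw [algebraMap_C, algebraMap_C, map_C, algebraMap_den, algebraMap_den, map_den, algebraMap_X,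
      shiftSgn_X]
  have e₃ : PowerSeries.map (shiftSgn hN s₁ p) (algebraMap 𝕜⟦X⟧⟦X⟧ A⟦X⟧⟦X⟧ (s₂.num X)) =
      algebraMap 𝕜⟦X⟧⟦X⟧ A⟦X⟧⟦X⟧ (s₂.num X) := by
    rw [algebraMap_num, map_num, algebraMap_X, map_X]
  have e₄ : PowerSeries.map (shiftSgn hN s₁ p) (algebraMap 𝕜⟦X⟧⟦X⟧ A⟦X⟧⟦X⟧ (s₂.den X)) =
      algebraMap 𝕜⟦X⟧⟦X⟧ A⟦X⟧⟦X⟧ (s₂.den X) := by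
    rw [algebraMap_den, map_den, algebraMap_X, map_X]
  have := X₀.map (PowerSeries.map (shiftSgn hN s₁ p)) (C (s₁.scale h p)) (h' := C (C h))
    (ρ' := specDen s₁ s₂) (w' := specDiff s₁ s₂ - (p : 𝕜⟦X⟧⟦X⟧) * (C (C h) * specDen s₁ s₂)) ?_ ?_ ?_
  · rwa [e, map_map_shift] at this
  · rw [algebraMap_C, algebraMap_C', map_C, shift_C]
  · rw [specDen, map_mul, map_mul, e₂, e₄, ← map_mul, ← map_mul, ← map_mul, ← mul_assoc, ← map_mul,
      scale_mul_den]
  · rw [specDiff, map_sub, map_mul, map_mul, map_sub, map_mul, map_mul, e₁, e₂, e₃, e₄, ← map_mul,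
      ← map_mul, ← map_sub, ← map_mul]
    congr 1
    rw [mul_sub, ← mul_assoc, ← mul_assoc, ← map_mul, ← map_mul, scale_mul_den, scale_mul_num]
    simp only [specDen, map_sub, map_mul, map_intCast]
    ring

/-- The `RTT` relation for the values of `T(u)` at two points. -/
theorem relX_of_shift {s : Sgn} {p q : ℤ} {T G : Matrix (Idx m n) (Idx m n) A⟦X⟧}
    (X₀ : RelX isOdd (C (C h) : 𝕜⟦X⟧⟦X⟧) (specDen s s)
      (specDiff s s - (p : 𝕜⟦X⟧⟦X⟧) * (C (C h) * specDen s s)) (T.map C)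
      (G.map (PowerSeries.map C))) :
    RelX isOdd (1 : 𝕜⟦X⟧⟦X⟧) 1 ((q - p : ℤ) : 𝕜⟦X⟧⟦X⟧) (T.map C)
      (((1 + (C h : 𝕜⟦X⟧) • G).map (shiftSgn hN s q)).map C - 1) := by
  -- Substituting `v = u - qh` turns `ρ (u - ph - v)` into `(q - p) h ρ`.
  have X₁ : RelX isOdd (C h : 𝕜⟦X⟧) (s.den X * s.den X)
      (((q - p : ℤ) : 𝕜⟦X⟧) * (C h * (s.den X * s.den X))) T (G.map (shiftSgn hN s q)) := by
    set ev := evalAt hN (dvd_constantCoeff_point h s q) with hev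
    have c : ∀ x : 𝕜⟦X⟧, ev (algebraMap 𝕜⟦X⟧⟦X⟧ A⟦X⟧⟦X⟧ (C x)) = algebraMap 𝕜⟦X⟧ A⟦X⟧ x := by
      intro x
      rw [algebraMap_C, evalAt_C]
    have cX : ev (algebraMap 𝕜⟦X⟧⟦X⟧ A⟦X⟧⟦X⟧ X) = algebraMap 𝕜⟦X⟧ A⟦X⟧ (s.point h q) := by
      rw [algebraMap_X, evalAt_X]; rfl
    have e₁ : ev (algebraMap 𝕜⟦X⟧⟦X⟧ A⟦X⟧⟦X⟧ (s.num X)) =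
        algebraMap 𝕜⟦X⟧ A⟦X⟧ (s.num (s.point h q)) := by
      rw [algebraMap_num, map_num, cX, algebraMap_num]
    have e₂ : ev (algebraMap 𝕜⟦X⟧⟦X⟧ A⟦X⟧⟦X⟧ (s.den X)) =
        algebraMap 𝕜⟦X⟧ A⟦X⟧ (s.den (s.point h q)) := by
      rw [algebraMap_den, map_den, cX, algebraMap_den]
    have := X₀.map ev (s.scale h q) (h' := C h) (ρ' := s.den X * s.den X)
      (w' := ((q - p : ℤ) : 𝕜⟦X⟧) * (C h * (s.den X * s.den X))) (c _) ?_ ?_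
    · have f₁ : (T.map C).map ev = T := Matrix.ext fun i j =>
        evalAt_C hN (dvd_constantCoeff_point h s q) _
      rwa [f₁] at this
    · rw [specDen, map_mul, map_mul, c, e₂, ← map_mul, ← map_mul, mul_left_comm, scale_mul_den]
    · have W : ev (algebraMap 𝕜⟦X⟧⟦X⟧ A⟦X⟧⟦X⟧
          (specDiff s s - (p : 𝕜⟦X⟧⟦X⟧) * (C (C h) * specDen s s))) = algebraMap 𝕜⟦X⟧ A⟦X⟧
          (s.num X * s.den (s.point h q) - s.den X * s.num (s.point h q) -
            (p : 𝕜⟦X⟧) * (C h * (s.den X * s.den (s.point h q)))) := by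
        simp only [specDiff, specDen, map_sub, map_mul, map_intCast, c, e₁, e₂]
      rw [W, ← map_mul]
      congr 1
      have s₁ := scale_mul_num h s q
      have s₂ := scale_mul_den h s q
      simp only [map_mul, map_intCast] at s₁
      push_cast
      linear_combination (s.num X : 𝕜⟦X⟧) * s₂ - (s.den X : 𝕜⟦X⟧) * s₁ -
        ((p : 𝕜⟦X⟧) * C h * s.den X) * s₂
  have X₂ := X₁.cancel fun x hx =>
    den_regular (𝕜 := 𝕜) s x (den_regular (𝕜 := 𝕜) s _ (by rwa [smul_smul]))
  have := X₂.map (C : A⟦X⟧ →+* A⟦X⟧⟦X⟧) (1 : 𝕜⟦X⟧⟦X⟧) (h' := 1) (ρ' := 1)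
    (w' := ((q - p : ℤ) : 𝕜⟦X⟧⟦X⟧)) (by simp only [map_one]) (by simp only [map_one, mul_one])
    (by simp only [map_one, one_mul, map_intCast])
  convert this using 1
  refine Matrix.ext fun i j => ?_
  simp only [Matrix.sub_apply, Matrix.map_apply, Matrix.add_apply, Matrix.smul_apply, map_add,
    shiftSgn_C_smul]
  rw [Matrix.one_apply, Matrix.one_apply]
  split_ifs <;> simp

/-- For the pair (plus, minus) only the second form is available from the defining relations; the
first follows because `w ± h ρ` are regular. -/
theorem RTTCoeffs.relX (H : RTTCoeffs h t g) (s₁ s₂ : Sgn) (p : ℤ) :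
    RelX isOdd (C (C h) : 𝕜⟦X⟧⟦X⟧) (specDen s₁ s₂)
      (specDiff s₁ s₂ - (p : 𝕜⟦X⟧⟦X⟧) * (C (C h) * specDen s₁ s₂))
      (((seriesMatrix s₁ t).map (shiftSgn hN s₁ p)).map C)
      ((seriesMatrix s₂ g).map (PowerSeries.map C)) := by
  refine RTTCoeffs.relX_shift_of_relX hN ?_ p
  have XY : (s₁ = s₂ ∨ (s₁ = .minus ∧ s₂ = .plus)) ∨ (s₁ = .plus ∧ s₂ = .minus) := by
    cases s₁ <;> cases s₂ <;> simp
  rcases XY with hs | ⟨rfl, rfl⟩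
  · exact H.relX_of_rel hs
  · refine (relX_iff_relY (fun x hx => ?_) (fun x hx => ?_)).2
      (H.relY_of_rel (Or.inr ⟨rfl, rfl⟩))
    · exact specDiff_sub_regular hN .plus .minus 1 x (by rwa [Int.cast_one, one_mul])
    · exact specDiff_sub_regular hN .plus .minus (-1) x (by
        rwa [Int.cast_neg, Int.cast_one, neg_one_mul, sub_neg_eq_add])

/-- The generator series at the points `u - ph` and the generator series at `v` form a system. -/
theorem RTTCoeffs.system (H : RTTCoeffs h t g) (s₁ s₂ : Sgn)
    {T' S' : Matrix (Idx m n) (Idx m n) A⟦X⟧} (hT₁ : seriesMatrix s₁ t * T' = 1)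
    (hT₂ : T' * seriesMatrix s₁ t = 1) (hS₁ : seriesMatrix s₂ t * S' = 1)
    (hS₂ : S' * seriesMatrix s₂ t = 1) :
    RTTSystem m n (C (C h) : 𝕜⟦X⟧⟦X⟧) (specDen s₁ s₂) (specDiff s₁ s₂)
      (fun p => ((seriesMatrix s₁ t).map (shiftSgn hN s₁ p)).map C)
      (fun p => (T'.map (shiftSgn hN s₁ p)).map C)
      ((seriesMatrix s₂ g).map (PowerSeries.map C)) (S'.map (PowerSeries.map C)) := by
  have one_map : ∀ {R R' : Type} [Ring R] [Ring R'] (F : R →+* R'),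
      (1 : Matrix (Idx m n) (Idx m n) R).map F = 1 := fun F =>
    Matrix.map_one F (map_zero F) (map_one F)
  have inv_map : ∀ {R R' : Type} [Ring R] [Ring R'] (F : R →+* R')
      {M M' : Matrix (Idx m n) (Idx m n) R}, M * M' = 1 → M.map F * M'.map F = 1 := by
    intro R R' _ _ F M M' e
    rw [← Matrix.map_mul, e, one_map]
  have hnil : ∀ x : A⟦X⟧⟦X⟧, (C (C h) : 𝕜⟦X⟧⟦X⟧) ^ N • x = 0 :=
    C_pow_smul_eq_zero (C_pow_smul_eq_zero hN)
  have ttX : ∀ p q : ℤ, RelX (K := 𝕜⟦X⟧⟦X⟧) isOdd 1 1 ((q - p : ℤ) : 𝕜⟦X⟧⟦X⟧)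
      (((seriesMatrix s₁ t).map (shiftSgn hN s₁ p)).map C)
      (((seriesMatrix s₁ t).map (shiftSgn hN s₁ q)).map C - 1) := by
    intro p q
    have := relX_of_shift hN (p := p) (q := q) (H.relX hN s₁ s₁ p)
    rwa [← H.seriesMatrix_eq] at this
  refine ⟨ttX, ?_, H.relX hN s₁ s₂, ?_, ?_, ?_, ?_, ?_, specDiff_sub_regular hN s₁ s₂, ?_,
    ⟨N, hnil⟩, ?_, ?_⟩
  · intro p q
    have := (ttX q p).symm
    rwa [← Int.cast_neg, neg_sub] at this
  · intro p
    -- The elements `w - p h ρ ∓ h ρ` needed for the equivalence are the spectral factors at `p ±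
    -- 1`.
    refine (relX_iff_relY (fun x hx => ?_) (fun x hx => ?_)).1 (H.relX hN s₁ s₂ p)
    · refine specDiff_sub_regular hN s₁ s₂ (p + 1) x ?_
      rw [Int.cast_add, Int.cast_one, add_mul, one_mul, ← sub_sub]
      exact hx
    · refine specDiff_sub_regular hN s₁ s₂ (p - 1) x ?_
      rw [Int.cast_sub, Int.cast_one, sub_mul, one_mul, ← sub_add]
      exact hx
  · exact fun p => inv_map _ (inv_map _ hT₁)
  · exact fun p => inv_map _ (inv_map _ hT₂)
  · rw [one_add_map_map_C, ← H.seriesMatrix_eq]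
    exact inv_map _ hS₁
  · rw [one_add_map_map_C, ← H.seriesMatrix_eq]
    exact inv_map _ hS₂
  · intro c x hc hx
    ext b a
    refine H.torsionFree c _ hc ?_
    rw [← map_zsmul, ← map_zsmul, hx, map_zero, map_zero]
  · intro p
    refine ⟨((seriesMatrix s₁ g).map (shiftSgn hN s₁ p)).map C, ?_⟩
    rw [H.seriesMatrix_eq]
    refine Matrix.ext fun i j => ?_
    simp only [Matrix.map_apply, Matrix.add_apply, Matrix.smul_apply, map_add, shiftSgn_C_smul]
    congr 1
    · rw [Matrix.one_apply, Matrix.one_apply]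
      split_ifs <;> simp
    · rw [Algebra.smul_def, Algebra.smul_def, map_mul, algebraMap_C]
  · intro p q i j k l
    -- Commutation is first proved with an independent `v`, where the spectral factor is regular.
    -- Only then is `v = u - qh` substituted, where that factor may become a zero divisor or vanish.
    have c := RelX.commute_inverse (S' := T'.map (PowerSeries.map C)) (H.relX hN s₁ s₁ p)
      (specDiff_sub_regular hN s₁ s₁ p)
      (by rw [one_add_map_map_C, ← H.seriesMatrix_eq]; exact inv_map _ hT₁)
      (by rw [one_add_map_map_C, ← H.seriesMatrix_eq]; exact inv_map _ hT₂) i j k l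
    have := (c.map (evalAt hN (dvd_constantCoeff_point h s₁ q))).map (C : A⟦X⟧ →+* A⟦X⟧⟦X⟧)
    rw [Matrix.map_apply, evalAt_C] at this
    exact this

/-- The coefficients of the quantum Berezinian commute with the coefficients of the generator
series. -/
theorem RTTCoeffs.commute (H : RTTCoeffs h t g) (s₁ s₂ : Sgn)
    {T' S' : Matrix (Idx m n) (Idx m n) A⟦X⟧} (hT₁ : seriesMatrix s₁ t * T' = 1)
    (hT₂ : T' * seriesMatrix s₁ t = 1) (hS₁ : seriesMatrix s₂ t * S' = 1)
    (hS₂ : S' * seriesMatrix s₂ t = 1) (i j : Idx m n) (a b : ℕ) :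
    Commute (coeff a (systemBer (fun p => (seriesMatrix s₁ t).map (shiftSgn hN s₁ p))
      (fun p => T'.map (shiftSgn hN s₁ p)) 0)) (g s₂ (s₂.exponent b) i j) := by
  have c := (H.system hN s₁ s₂ hT₁ hT₂ hS₁ hS₂).commute 0 i j
  have e : systemBer (fun p => ((seriesMatrix s₁ t).map (shiftSgn hN s₁ p)).map C)
      (fun p => (T'.map (shiftSgn hN s₁ p)).map C) 0 = (C : A⟦X⟧ →+* A⟦X⟧⟦X⟧)
      (systemBer (fun p => (seriesMatrix s₁ t).map (shiftSgn hN s₁ p))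
      (fun p => T'.map (shiftSgn hN s₁ p)) 0) := by
    unfold systemBer colDet rowDet altSum
    simp only [map_mul, map_sum, map_zsmul, map_list_prod, List.map_ofFn]
    rfl
  rw [e] at c
  have := congrArg (fun x => coeff a (coeff b x)) c.eq
  simp only [Matrix.map_apply, coeff_C_mul_map_C, coeff_map_C_mul_C] at this
  simp only [seriesMatrix, series, coeff_mk] at this
  exact this

end System

/-! ### The relations of the double Yangian in components -/

section Components

variable {m n : ℕ}

theorem parity_cases (i : Idx m n) :
    (parity i = 0 ∧ isOdd i = false) ∨ (parity i = 1 ∧ isOdd i = true) := by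
  rcases i with i | i
  · exact Or.inl ⟨rfl, rfl⟩
  · exact Or.inr ⟨rfl, rfl⟩

theorem tensorMul_T₁_T₂ (s₁ s₂ : Sgn) (a b : ℤ) (i j k l : Idx m n) :
    tensorMul (T₁ s₁ a) (T₂ s₂ b) i j k l =
      (-1 : ℂ⟦X⟧) ^ ((parity k + parity l) * (parity i + parity j) +
        (parity i * parity j + parity j) + (parity k * parity l + parity l)) •
        (tCoeff i j s₁ a * tCoeff k l s₂ b) := by
  unfold tensorMul
  rw [Finset.sum_eq_single j, Finset.sum_eq_single k]
  · simp only [T₁, T₂, if_true, smul_mul_smul_comm, smul_smul]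
    congr 1
    rw [← pow_add, ← pow_add]
    refine neg_one_pow_congr ?_
    rcases parity_cases i with ⟨hi, -⟩ | ⟨hi, -⟩ <;> rcases parity_cases j with ⟨hj, -⟩ | ⟨hj, -⟩ <;>
      rcases parity_cases k with ⟨hk, -⟩ | ⟨hk, -⟩ <;>
      rcases parity_cases l with ⟨hl, -⟩ | ⟨hl, -⟩ <;> simp only [hi, hj, hk, hl] <;> decide
  · intro c _ hc
    simp [T₁, hc.symm]
  · simp
  · intro c _ hc
    simp [T₂, hc]
  · simp

theorem tensorMul_T₂_T₁ (s₁ s₂ : Sgn) (a b : ℤ) (i j k l : Idx m n) :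
    tensorMul (T₂ s₂ b) (T₁ s₁ a) i j k l =
      (-1 : ℂ⟦X⟧) ^ ((parity i * parity j + parity j) + (parity k * parity l + parity l)) •
        (tCoeff k l s₂ b * tCoeff i j s₁ a) := by
  unfold tensorMul
  rw [Finset.sum_eq_single i, Finset.sum_eq_single l]
  · simp only [T₁, T₂, if_true, smul_mul_smul_comm, smul_smul]
    congr 1
    rw [← pow_add, ← pow_add]
    refine neg_one_pow_congr ?_
    rcases parity_cases i with ⟨hi, -⟩ | ⟨hi, -⟩ <;> rcases parity_cases j with ⟨hj, -⟩ | ⟨hj, -⟩ <;>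
      rcases parity_cases k with ⟨hk, -⟩ | ⟨hk, -⟩ <;>
      rcases parity_cases l with ⟨hl, -⟩ | ⟨hl, -⟩ <;> simp only [hi, hj, hk, hl] <;> decide
  · intro c _ hc
    simp [T₁, hc]
  · simp
  · intro c _ hc
    simp [T₂, hc.symm]
  · simp

theorem permP_tensorMul (M : TensorSq m n) (i j k l : Idx m n) :
    tensorMul (permP m n) M i j k l =
      (-1 : ℂ⟦X⟧) ^ ((parity k + parity j) * (parity k + parity i) + parity k) • M k j i l := by
  unfold tensorMul
  rw [Finset.sum_eq_single k, Finset.sum_eq_single i]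
  · simp only [permP, and_self, if_true, smul_mul_assoc, one_mul, smul_smul]
    congr 1
    rw [← pow_add]
    refine neg_one_pow_congr ?_
    rcases parity_cases i with ⟨hi, -⟩ | ⟨hi, -⟩ <;> rcases parity_cases j with ⟨hj, -⟩ | ⟨hj, -⟩ <;>
      rcases parity_cases k with ⟨hk, -⟩ | ⟨hk, -⟩ <;>
      rcases parity_cases l with ⟨hl, -⟩ | ⟨hl, -⟩ <;> simp only [hi, hj, hk, hl] <;> decide
  · intro c _ hc
    simp [permP, hc]
  · simp
  · intro c _ hc
    simp [permP, hc.symm]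
  · simp

theorem tensorMul_permP (M : TensorSq m n) (i j k l : Idx m n) :
    tensorMul M (permP m n) i j k l =
      (-1 : ℂ⟦X⟧) ^ ((parity l + parity j) * (parity k + parity j) + parity j) • M i l k j := by
  unfold tensorMul
  rw [Finset.sum_eq_single l, Finset.sum_eq_single j]
  · simp only [permP, and_self, if_true, mul_smul_comm, mul_one, smul_smul]
    congr 1
    rw [← pow_add]
    refine neg_one_pow_congr ?_
    rcases parity_cases i with ⟨hi, -⟩ | ⟨hi, -⟩ <;> rcases parity_cases j with ⟨hj, -⟩ | ⟨hj, -⟩ <;>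
      rcases parity_cases k with ⟨hk, -⟩ | ⟨hk, -⟩ <;>
      rcases parity_cases l with ⟨hl, -⟩ | ⟨hl, -⟩ <;> simp only [hi, hj, hk, hl] <;> decide
  · intro c _ hc
    simp [permP, hc]
  · simp
  · intro c _ hc
    simp [permP, hc.symm]
  · simp

theorem rtt_sign_identity {K M : Type} [CommRing K] [AddCommGroup M] [Module K M] (h : K) (i j k l : Idx m n)
    (x₁ x₂ x₁' x₂' y y' : M) :
    ((-1 : K) ^ ((parity k + parity l) * (parity i + parity j) +
        (parity i * parity j + parity j) + (parity k * parity l + parity l)) • x₁ -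
      (-1 : K) ^ ((parity k + parity l) * (parity i + parity j) +
        (parity i * parity j + parity j) + (parity k * parity l + parity l)) • x₂ -
      h • (-1 : K) ^ ((parity k + parity j) * (parity k + parity i) + parity k) •
        (-1 : K) ^ ((parity i + parity l) * (parity k + parity j) +
        (parity k * parity j + parity j) + (parity i * parity l + parity l)) • y) -
    ((-1 : K) ^ ((parity i * parity j + parity j) + (parity k * parity l + parity l)) • x₁' -
      (-1 : K) ^ ((parity i * parity j + parity j) + (parity k * parity l + parity l)) • x₂' -
      h • (-1 : K) ^ ((parity l + parity j) * (parity k + parity j) + parity j) •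
        (-1 : K) ^ ((parity i * parity l + parity l) +
        (parity k * parity j + parity j)) • y') =
    (-1 : K) ^ ((parity k + parity l) * (parity i + parity j) +
        (parity i * parity j + parity j) + (parity k * parity l + parity l)) •
      ((x₁ - (sgn K (isOdd i) (isOdd k) * sgn K (isOdd i) (isOdd l) *
          sgn K (isOdd j) (isOdd k) * sgn K (isOdd j) (isOdd l)) • x₁') -
       (x₂ - (sgn K (isOdd i) (isOdd k) * sgn K (isOdd i) (isOdd l) *
          sgn K (isOdd j) (isOdd k) * sgn K (isOdd j) (isOdd l)) • x₂') -
       h • (sgn K (isOdd i) (isOdd j) * sgn K (isOdd i) (isOdd k) *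
          sgn K (isOdd j) (isOdd k)) • (y - y')) := by
  rcases parity_cases i with ⟨hi, hi'⟩ | ⟨hi, hi'⟩ <;>
    rcases parity_cases j with ⟨hj, hj'⟩ | ⟨hj, hj'⟩ <;>
    rcases parity_cases k with ⟨hk, hk'⟩ | ⟨hk, hk'⟩ <;>
    rcases parity_cases l with ⟨hl, hl'⟩ | ⟨hl, hl'⟩ <;>
    simp only [hi, hj, hk, hl, hi', hj', hk', hl', sgn] <;> norm_num <;> module

theorem smul_smul_sub_sub {K M : Type} [CommRing K] [AddCommGroup M] [Module K M] (c d : K)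
    (x y z : M) : c • (d • x - d • y - d • z) = d • c • (x - y - z) := by
  rw [← smul_sub, ← smul_sub, smul_comm]

/-- The components of the `RTT` relations. -/
theorem rttDefect_eq (s₁ s₂ : Sgn) (a b : ℤ) (i j k l : Idx m n) :
    ∃ τ : ℂ⟦X⟧, τ * τ = 1 ∧ rttDefect s₁ s₂ a b i j k l = τ •
      ((tCoeff i j s₁ (a - 1) * tCoeff k l s₂ b -
        (sgn ℂ⟦X⟧ (isOdd i) (isOdd k) * sgn ℂ⟦X⟧ (isOdd i) (isOdd l) * sgn ℂ⟦X⟧ (isOdd j) (isOdd k) *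
          sgn ℂ⟦X⟧ (isOdd j) (isOdd l)) • (tCoeff k l s₂ b * tCoeff i j s₁ (a - 1))) -
      (tCoeff i j s₁ a * tCoeff k l s₂ (b - 1) -
        (sgn ℂ⟦X⟧ (isOdd i) (isOdd k) * sgn ℂ⟦X⟧ (isOdd i) (isOdd l) * sgn ℂ⟦X⟧ (isOdd j) (isOdd k) *
          sgn ℂ⟦X⟧ (isOdd j) (isOdd l)) • (tCoeff k l s₂ (b - 1) * tCoeff i j s₁ a)) -
      h • (sgn ℂ⟦X⟧ (isOdd i) (isOdd j) * sgn ℂ⟦X⟧ (isOdd i) (isOdd k) * sgn ℂ⟦X⟧ (isOdd j) (isOdd k)) •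
        (tCoeff k j s₁ a * tCoeff i l s₂ b - tCoeff k j s₂ b * tCoeff i l s₁ a)) := by
  refine ⟨(-1) ^ ((parity k + parity l) * (parity i + parity j) +
        (parity i * parity j + parity j) + (parity k * parity l + parity l)), ?_, ?_⟩
  · rw [← pow_add, ← two_mul, pow_mul, neg_one_sq, one_pow]
  · simp only [rttDefect, Pi.sub_apply, Pi.smul_apply, permP_tensorMul, tensorMul_permP,
      tensorMul_T₁_T₂, tensorMul_T₂_T₁]
    exact rtt_sign_identity h i j k l _ _ _ _ _ _

/-- The coefficients `g^s_a` with `t^s_a = δ_{a0} + h g^s_a`. -/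
def gCoeff (i j : Idx m n) : Sgn → ℤ → Free m n
  | .minus, Int.ofNat _ => 0
  | .minus, Int.negSucc r => FreeAlgebra.ι ℂ⟦X⟧ ⟨.minus, r, i, j⟩
  | .plus, Int.ofNat r => -FreeAlgebra.ι ℂ⟦X⟧ ⟨.plus, r, i, j⟩
  | .plus, Int.negSucc _ => 0

theorem tCoeff_eq_add (s : Sgn) (a : ℤ) (i j : Idx m n) :
    tCoeff i j s a = (if a = 0 ∧ i = j then 1 else 0) + h • gCoeff i j s a := by
  cases s <;> cases a <;> simp [tCoeff, gCoeff, sub_eq_add_neg]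

theorem gCoeff_supports (s : Sgn) (i j : Idx m n) : s.Supports fun a => gCoeff i j s a := by
  cases s
  · rintro (a | a) ha
    · simp only [Int.ofNat_eq_natCast] at ha; omega
    · rfl
  · rintro (a | a) ha
    · rfl
    · exact absurd ha (by simp)

/-- The scalar part of the second coefficient occurs only for `k = l`, where the sign is 1, and so
contributes nothing to the supercommutator. -/
theorem bracket_tCoeff (s₁ s₂ : Sgn) (a b : ℤ) (i j k l : Idx m n) {ε : ℂ⟦X⟧}
    (hε : ε = sgn ℂ⟦X⟧ (isOdd i) (isOdd k) * sgn ℂ⟦X⟧ (isOdd i) (isOdd l) *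
      sgn ℂ⟦X⟧ (isOdd j) (isOdd k) * sgn ℂ⟦X⟧ (isOdd j) (isOdd l)) :
    tCoeff i j s₁ a * tCoeff k l s₂ b - ε • (tCoeff k l s₂ b * tCoeff i j s₁ a) =
      h • (tCoeff i j s₁ a * gCoeff k l s₂ b - ε • (gCoeff k l s₂ b * tCoeff i j s₁ a)) := by
  have e : tCoeff i j s₁ a * (if b = 0 ∧ k = l then 1 else 0) -
      ε • ((if b = 0 ∧ k = l then 1 else 0) * tCoeff i j s₁ a) = 0 := by
    split_ifs with hb
    · have : ε = 1 := by
        rw [hε, hb.2]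
        cases isOdd i <;> cases isOdd j <;> cases isOdd l <;> simp [sgn]
      rw [this]; simp
    · simp
  rw [tCoeff_eq_add s₂ b k l, mul_add, add_mul, smul_add, add_sub_add_comm, e, zero_add,
    mul_smul_comm, smul_mul_assoc, smul_sub, smul_comm ε h]

theorem smul_h_injective {x y : Free m n} (hxy : h • x = h • y) : x = y :=
  smul_right_injective (Free m n) (PowerSeries.X_ne_zero : (h : ℂ⟦X⟧) ≠ 0) hxy

/-- The free algebra has no `h`-torsion, so one factor `h` is cancelled there, before passing to the
quotient. -/
theorem smul_h_cancel {τ : ℂ⟦X⟧} (hτ : τ * τ = 1) {x P Q S : Free m n}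
    (hx : h ^ 2 • x = τ • (h • P - h • Q - h • S)) : τ • h • x = P - Q - S := by
  rw [pow_two, mul_smul] at hx
  have e₁ : τ • (h • P - h • Q - h • S) = h • τ • (P - Q - S) := smul_smul_sub_sub τ h P Q S
  have e : h • x = τ • (P - Q - S) := smul_h_injective (hx.trans e₁)
  rw [e, smul_smul, hτ, one_smul]

/-- The `RTT` relations in the presented algebra, divided by `h`. -/
theorem mkAlgHom_rel {s₁ s₂ : Sgn} (hs : s₁ = s₂ ∨ (s₁ = .minus ∧ s₂ = .plus)) (a b : ℤ)
    (i j k l : Idx m n) : RingQuot.mkAlgHom ℂ⟦X⟧ (Relation m n)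
      ((tCoeff i j s₁ (a - 1) * gCoeff k l s₂ b -
        (sgn ℂ⟦X⟧ (isOdd i) (isOdd k) * sgn ℂ⟦X⟧ (isOdd i) (isOdd l) * sgn ℂ⟦X⟧ (isOdd j) (isOdd k) *
          sgn ℂ⟦X⟧ (isOdd j) (isOdd l)) • (gCoeff k l s₂ b * tCoeff i j s₁ (a - 1))) -
      (tCoeff i j s₁ a * gCoeff k l s₂ (b - 1) -
        (sgn ℂ⟦X⟧ (isOdd i) (isOdd k) * sgn ℂ⟦X⟧ (isOdd i) (isOdd l) * sgn ℂ⟦X⟧ (isOdd j) (isOdd k) *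
          sgn ℂ⟦X⟧ (isOdd j) (isOdd l)) • (gCoeff k l s₂ (b - 1) * tCoeff i j s₁ a)) -
      (sgn ℂ⟦X⟧ (isOdd i) (isOdd j) * sgn ℂ⟦X⟧ (isOdd i) (isOdd k) * sgn ℂ⟦X⟧ (isOdd j) (isOdd k)) •
        (tCoeff k j s₁ a * tCoeff i l s₂ b - tCoeff k j s₂ b * tCoeff i l s₁ a)) = 0 := by
  obtain ⟨x, hx⟩ := exists_smul_eq_rttDefect s₁ s₂ a b i j k l
  obtain ⟨τ, hτ, hd⟩ := rttDefect_eq s₁ s₂ a b i j k l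
  have hx₀ : RingQuot.mkAlgHom ℂ⟦X⟧ (Relation m n) x = 0 := by
    rw [← map_zero (RingQuot.mkAlgHom ℂ⟦X⟧ (Relation m n))]
    exact RingQuot.mkAlgHom_rel _ ⟨rfl, s₁, s₂, hs, a, b, i, j, k, l, hx⟩
  rw [bracket_tCoeff s₁ s₂ (a - 1) b i j k l rfl, bracket_tCoeff s₁ s₂ a (b - 1) i j k l rfl,
    ← hx] at hd
  rw [← smul_h_cancel hτ hd, map_smul, map_smul, hx₀, smul_zero, smul_zero]

end Components

/-! ### The truncations of the double Yangian -/

section Truncation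

variable {m n : ℕ}

/-- The quotient of the presented algebra by `h^N`. -/
abbrev Trunc (m n N : ℕ) : Type := Presented m n ⧸ hIdeal (Presented m n) N

/-- The image of an element of the free algebra. -/
def toTrunc (m n N : ℕ) : Free m n →ₐ[ℂ⟦X⟧] Trunc m n N :=
  (Ideal.Quotient.mkₐ ℂ⟦X⟧ (hIdeal (Presented m n) N)).comp
    (RingQuot.mkAlgHom ℂ⟦X⟧ (Relation m n))

theorem toTrunc_surjective (N : ℕ) : Function.Surjective (toTrunc m n N) :=
  (Ideal.Quotient.mkₐ_surjective ℂ⟦X⟧ _).comp (RingQuot.mkAlgHom_surjective _ _)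

theorem pow_smul_eq_zero_of_trunc (N : ℕ) (x : Trunc m n N) : h ^ N • x = 0 := by
  obtain ⟨y, rfl⟩ := Ideal.Quotient.mk_surjective x
  exact Ideal.Quotient.eq_zero_iff_mem.2 ⟨y, rfl⟩

theorem torsionFree_of_algebra {A : Type} [Ring A] [Algebra ℂ⟦X⟧ A] (c : ℤ) (x : A) (hc : c ≠ 0)
    (hx : c • x = 0) : x = 0 := by
  have e : (PowerSeries.C ((c : ℂ)⁻¹) : ℂ⟦X⟧) * (c : ℂ⟦X⟧) = 1 := by
    rw [← map_intCast (PowerSeries.C : ℂ →+* ℂ⟦X⟧), ← map_mul,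
      inv_mul_cancel₀ (Int.cast_ne_zero.2 hc), map_one]
  rw [← one_smul ℂ⟦X⟧ x, ← e, mul_smul, Int.cast_smul_eq_zsmul, hx, smul_zero]

/-- The coefficients of the generator series in the truncation. -/
def tTrunc (m n N : ℕ) (s : Sgn) (a : ℤ) : Matrix (Idx m n) (Idx m n) (Trunc m n N) :=
  Matrix.of fun i j => toTrunc m n N (tCoeff i j s a)

/-- The divided coefficients of the generator series in the truncation. -/
def gTrunc (m n N : ℕ) (s : Sgn) (a : ℤ) : Matrix (Idx m n) (Idx m n) (Trunc m n N) :=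
  Matrix.of fun i j => toTrunc m n N (gCoeff i j s a)

theorem rttCoeffs_trunc (m n N : ℕ) : RTTCoeffs h (tTrunc m n N) (gTrunc m n N) where
  eq_one_add s a := by
    ext i j
    simp only [tTrunc, gTrunc, Matrix.of_apply, tCoeff_eq_add, map_add, map_smul, Matrix.add_apply,
      Matrix.smul_apply]
    congr 1
    by_cases ha : a = 0 <;> by_cases hij : i = j <;> simp [ha, hij, Matrix.one_apply]
  supports s i j := by
    have := gCoeff_supports (m := m) (n := n) s i j
    cases s
    · intro a ha
      have e : gCoeff i j .plus a = 0 := this a ha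
      simp only [gTrunc, Matrix.of_apply, e, map_zero]
    · intro a ha
      have e : gCoeff i j .minus a = 0 := this a ha
      simp only [gTrunc, Matrix.of_apply, e, map_zero]
  rel s₁ s₂ hs a b i j k l := by
    have := congrArg (Ideal.Quotient.mkₐ ℂ⟦X⟧ (hIdeal (Presented m n) N))
      (mkAlgHom_rel hs a b i j k l)
    simp only [sgn_eq_intCast (K := ℂ⟦X⟧), ← Int.cast_mul] at this
    simp only [map_sub, map_mul, map_smul, map_zero, Int.cast_smul_eq_zsmul] at this
    exact sub_eq_zero.1 this
  torsionFree := torsionFree_of_algebra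

/-- The projection of the double Yangian to its truncation. -/
def proj (m n N : ℕ) : DY m n →+* Trunc m n N :=
  (Pi.evalRingHom _ N).comp (completionSubalgebra (Presented m n)).val.toRingHom

theorem proj_injective {x y : DY m n} (hxy : ∀ N, proj m n N x = proj m n N y) : x = y :=
  Subtype.ext (funext hxy)

theorem transition_proj {k N : ℕ} (hk : k ≤ N) (x : DY m n) :
    transition (Presented m n) hk (proj m n N x) = proj m n k x := x.2 k N hk

theorem proj_smul (N : ℕ) (c : ℂ⟦X⟧) (x : DY m n) : proj m n N (c • x) = c • proj m n N x := rfl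

/-- The matrix of generator series over the double Yangian. -/
def genMatrix (m n : ℕ) : Sgn → Matrix (Idx m n) (Idx m n) (DY m n)⟦X⟧
  | .plus => Tplus m n
  | .minus => Tminus m n

theorem map_genMatrix (N : ℕ) (s : Sgn) :
    (genMatrix m n s).map (PowerSeries.map (proj m n N)) = seriesMatrix s (tTrunc m n N) := by
  refine Matrix.ext fun i j => ?_
  ext r
  cases s <;> rfl

theorem matrix_ext_proj {M M' : Matrix (Idx m n) (Idx m n) (DY m n)⟦X⟧}
    (H : ∀ N, M.map (PowerSeries.map (proj m n N)) = M'.map (PowerSeries.map (proj m n N))) :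
    M = M' := by
  refine Matrix.ext fun i j => PowerSeries.ext fun r => ?_
  refine proj_injective fun N => ?_
  have := congrArg (PowerSeries.coeff r) (congrFun (congrFun (H N) i) j)
  simpa only [Matrix.map_apply, PowerSeries.coeff_map] using this

attribute [local instance] powerSeriesAlgebra in
theorem exists_inverse_trunc (N : ℕ) (s : Sgn) :
    ∃ M : Matrix (Idx m n) (Idx m n) (Trunc m n N)⟦X⟧,
      seriesMatrix s (tTrunc m n N) * M = 1 ∧ M * seriesMatrix s (tTrunc m n N) = 1 := by
  rw [(rttCoeffs_trunc m n N).seriesMatrix_eq]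
  exact exists_inverse_one_add_smul (C_pow_smul_eq_zero (pow_smul_eq_zero_of_trunc N)) _

theorem map_mul_eq_one {R R' I : Type} [Ring R] [Ring R'] [Fintype I] [DecidableEq I] (F : R →+* R')
    {M M' : Matrix I I R} (e : M * M' = 1) : M.map F * M'.map F = 1 := by
  rw [← Matrix.map_mul, e, Matrix.map_one F (map_zero F) (map_one F)]

/-- The matrices `T⁺(u)` and `T⁻(u)` are invertible. -/
theorem isUnit_genMatrix (s : Sgn) : IsUnit (genMatrix m n s) := by
  choose V hV₁ hV₂ using fun N => exists_inverse_trunc (m := m) (n := n) N s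
  -- Inverses are unique, so those modulo different powers of `h` are compatible and define a matrix
  -- over the completion.
  have compat : ∀ (k N : ℕ) (hk : k ≤ N),
      (V N).map (PowerSeries.map (transition (Presented m n) hk)) = V k := by
    intro k N hk
    have e : (seriesMatrix s (tTrunc m n N)).map (PowerSeries.map (transition (Presented m n) hk)) =
        seriesMatrix s (tTrunc m n k) := by
      rw [← map_genMatrix, ← map_genMatrix]
      refine Matrix.ext fun i j => ?_
      ext r
      simp only [Matrix.map_apply, PowerSeries.coeff_map, transition_proj]
    have e₂ := map_mul_eq_one (PowerSeries.map (transition (Presented m n) hk)) (hV₁ N)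
    rw [e] at e₂
    exact (left_inv_eq_right_inv (hV₂ k) e₂).symm
  set W : Matrix (Idx m n) (Idx m n) (DY m n)⟦X⟧ := Matrix.of fun i j => PowerSeries.mk fun r =>
    ⟨fun N => PowerSeries.coeff r (V N i j), fun k N hk => by
      change transition _ hk (PowerSeries.coeff r (V N i j)) = PowerSeries.coeff r (V k i j)
      rw [← compat k N hk, Matrix.map_apply, PowerSeries.coeff_map]⟩ with hW
  have hWN : ∀ N, W.map (PowerSeries.map (proj m n N)) = V N := by
    intro N
    refine Matrix.ext fun i j => ?_
    ext r
    rw [Matrix.map_apply, PowerSeries.coeff_map, hW, Matrix.of_apply, PowerSeries.coeff_mk]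
    rfl
  have h₁ : genMatrix m n s * W = 1 := matrix_ext_proj fun N => by
    rw [Matrix.map_mul, map_genMatrix, hWN, hV₁, Matrix.map_one _ (map_zero _) (map_one _)]
  have h₂ : W * genMatrix m n s = 1 := matrix_ext_proj fun N => by
    rw [Matrix.map_mul, map_genMatrix, hWN, hV₂, Matrix.map_one _ (map_zero _) (map_one _)]
  exact ⟨⟨_, W, h₁, h₂⟩, rfl⟩

/-! ### The shifts in the truncations -/

theorem ringHom_sum {R R' I : Type} [Ring R] [Ring R'] (F : R →+* R') (S : Finset I) (f : I → R) :
    F (∑ i ∈ S, f i) = ∑ i ∈ S, F (f i) := map_sum F f S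

theorem ringHom_signed_sum {R R' : Type} [Ring R] [Ring R'] (F : R →+* R') {d : ℕ}
    (E : Fin d → Fin d → R) :
    F (∑ τ : Equiv.Perm (Fin d), (((Equiv.Perm.sign τ : ℤˣ) : ℤ) : R) *
      (List.ofFn fun k => E k (τ k)).prod) =
    ∑ τ : Equiv.Perm (Fin d), ((Equiv.Perm.sign τ : ℤˣ) : ℤ) •
      (List.ofFn fun k => F (E k (τ k))).prod := by
  rw [map_sum]
  simp only [map_mul, map_intCast, map_list_prod, List.map_ofFn, zsmul_eq_mul]
  rfl

/-- The shift of series over the double Yangian. -/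
def shiftDY : Sgn → ℤ → (DY m n)⟦X⟧ → (DY m n)⟦X⟧
  | .plus => shiftPlus
  | .minus => shiftMinus

/-- Modulo `h^N` the convergent sum has `N` terms. They match the substitution formula up to index
`s + N`, in which the terms below `s` vanish. -/
theorem map_shiftPlus (N : ℕ) (c : ℤ) (f : (DY m n)⟦X⟧) :
    PowerSeries.map (proj m n N) (shiftPlus c f) =
      shiftSgn (pow_smul_eq_zero_of_trunc N) .plus (-c) (PowerSeries.map (proj m n N) f) := by
  ext s
  rw [PowerSeries.coeff_map, coeff_shift _ _ le_rfl, Finset.sum_range_add, shiftPlus,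
    PowerSeries.coeff_mk]
  have e₀ : ∑ i ∈ Finset.range s, PowerSeries.coeff s (Sgn.plus.point h (-c) ^ i) •
      PowerSeries.coeff i (PowerSeries.map (proj m n N) f) = 0 :=
    Finset.sum_eq_zero fun i hi => by
      rw [coeff_point_pow_plus, if_neg (not_le.2 (Finset.mem_range.1 hi)), zero_smul]
  rw [e₀, zero_add]
  change ∑ j ∈ Finset.range N, h ^ j • proj m n N (_ * _) = _
  refine Finset.sum_congr rfl fun j _ => ?_
  rw [coeff_point_pow_plus, if_pos (Nat.le_add_right s j), Nat.add_sub_cancel_left, neg_neg,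
    mul_smul, Int.cast_smul_eq_zsmul, RingHom.map_mul, map_intCast (proj m n N), ← zsmul_eq_mul,
    PowerSeries.coeff_map, smul_comm]

theorem map_shiftMinus (N : ℕ) (c : ℤ) (f : (DY m n)⟦X⟧) :
    PowerSeries.map (proj m n N) (shiftMinus c f) =
      shiftSgn (pow_smul_eq_zero_of_trunc N) .minus (-c) (PowerSeries.map (proj m n N) f) := by
  ext s
  rw [PowerSeries.coeff_map, coeff_shift (M := s + 1 + N) _ _ (by omega), Finset.sum_range_add,
    shiftMinus, PowerSeries.coeff_mk]
  have e₀ : ∑ i ∈ Finset.range N, PowerSeries.coeff s (Sgn.minus.point h (-c) ^ (s + 1 + i)) •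
      PowerSeries.coeff (s + 1 + i) (PowerSeries.map (proj m n N) f) = 0 :=
    Finset.sum_eq_zero fun i hi => by
      rw [coeff_point_pow_minus, if_neg (by omega), zero_smul]
  rw [e₀, add_zero, ringHom_sum (proj m n N), Finset.Nat.sum_antidiagonal_eq_sum_range_succ_mk]
  refine Finset.sum_congr rfl fun j hj => ?_
  rw [coeff_point_pow_minus, if_pos (Nat.lt_succ_iff.1 (Finset.mem_range.1 hj)), neg_neg,
    mul_smul, Int.cast_smul_eq_zsmul, RingHom.map_mul, map_intCast (proj m n N),
    ← zsmul_eq_mul, PowerSeries.coeff_map, proj_smul]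

theorem map_shiftDY (N : ℕ) (s : Sgn) (c : ℤ) (f : (DY m n)⟦X⟧) :
    PowerSeries.map (proj m n N) (shiftDY s c f) =
      shiftSgn (pow_smul_eq_zero_of_trunc N) s (-c) (PowerSeries.map (proj m n N) f) := by
  cases s
  · exact map_shiftPlus N c f
  · exact map_shiftMinus N c f

theorem map_berezinian (N : ℕ) (s : Sgn) :
    PowerSeries.map (proj m n N) (berezinian (shiftDY s) (genMatrix m n s)) =
      systemBer (fun p => (seriesMatrix s (tTrunc m n N)).map
          (shiftSgn (pow_smul_eq_zero_of_trunc N) s p))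
        (fun p => ((Ring.inverse (genMatrix m n s)).map (PowerSeries.map (proj m n N))).map
          (shiftSgn (pow_smul_eq_zero_of_trunc N) s p)) 0 := by
  have e₁ := ringHom_signed_sum (PowerSeries.map (proj m n N)) (d := m)
    fun k x => shiftDY s (-(k : ℤ)) (genMatrix m n s (Sum.inl x) (Sum.inl k))
  have e₂ := ringHom_signed_sum (PowerSeries.map (proj m n N)) (d := n)
    fun k x => shiftDY s ((k : ℤ) + 1 - (m : ℤ))
      (Ring.inverse (genMatrix m n s) (Sum.inr k) (Sum.inr x))
  unfold berezinian systemBer colDet rowDet altSum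
  rw [RingHom.map_mul]
  refine congrArg₂ _ (e₁.trans ?_) (e₂.trans ?_)
  · refine Finset.sum_congr rfl fun τ _ => ?_
    simp only [map_shiftDY, ← map_genMatrix N s, neg_neg, zero_add]
    rfl
  -- The odd factors have arguments `u - (m-1-k)h`, that is, a row determinant starting at `m - 1`,
  -- the last argument of the even determinant.
  · have e₃ : ∀ k : ℤ, -(k + 1 - (m : ℤ)) = 0 + m - 1 - k := fun k => by ring
    refine Finset.sum_congr rfl fun τ _ => ?_
    simp only [map_shiftDY, e₃]
    rfl

/-- Centrality is tested in each truncation, which is generated as an algebra by the divided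
coefficients `g`; commutation with the coefficients of `t = δ + h g` alone would not suffice. -/
theorem coeff_berezinian_mem_center (s : Sgn) (r : ℕ) :
    PowerSeries.coeff r (berezinian (shiftDY s) (genMatrix m n s)) ∈
      Subalgebra.center ℂ⟦X⟧ (DY m n) := by
  rw [Subalgebra.mem_center_iff]
  intro y
  refine proj_injective fun N => ?_
  rw [RingHom.map_mul, RingHom.map_mul, ← PowerSeries.coeff_map, map_berezinian]
  set b := PowerSeries.coeff r (systemBer (fun p => (seriesMatrix s (tTrunc m n N)).map
          (shiftSgn (pow_smul_eq_zero_of_trunc N) s p))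
        (fun p => ((Ring.inverse (genMatrix m n s)).map (PowerSeries.map (proj m n N))).map
          (shiftSgn (pow_smul_eq_zero_of_trunc N) s p)) 0) with hb
  have inv₁ : ∀ s, seriesMatrix s (tTrunc m n N) *
      (Ring.inverse (genMatrix m n s)).map (PowerSeries.map (proj m n N)) = 1 := fun s => by
    rw [← map_genMatrix]
    exact map_mul_eq_one _ (Ring.mul_inverse_cancel _ (isUnit_genMatrix s))
  have inv₂ : ∀ s, (Ring.inverse (genMatrix m n s)).map (PowerSeries.map (proj m n N)) *
      seriesMatrix s (tTrunc m n N) = 1 := fun s => by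
    rw [← map_genMatrix]
    exact map_mul_eq_one _ (Ring.inverse_mul_cancel _ (isUnit_genMatrix s))
  have comm : ∀ s' a i j, Commute b (gTrunc m n N s' (s'.exponent a) i j) := fun s' a i j =>
    (rttCoeffs_trunc m n N).commute (pow_smul_eq_zero_of_trunc N) s s' (inv₁ s) (inv₂ s) (inv₁ s')
      (inv₂ s') i j r a
  have all : ∀ x : Free m n, Commute b (toTrunc m n N x) := by
    intro x
    induction x using FreeAlgebra.induction with
    | grade0 c =>
      rw [AlgHom.commutes]
      exact (Algebra.commutes c b).symm
    | grade1 x =>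
      obtain ⟨s', a, i, j⟩ := x
      cases s'
      · have := comm .plus a i j
        change Commute b (toTrunc m n N (-FreeAlgebra.ι ℂ⟦X⟧ ⟨.plus, a, i, j⟩)) at this
        rw [map_neg] at this
        exact (Commute.neg_right_iff).1 this
      -- The generator with label `a` is the coefficient of `u^{-(a+1)}`; in the plus case above,
      -- the label is the exponent but the divided coefficient is minus the generator.
      · exact comm .minus (a + 1) i j
    | mul x y hx hy => rw [map_mul]; exact hx.mul_right hy
    | add x y hx hy => rw [map_add]; exact hx.add_right hy
  obtain ⟨x, hx⟩ := toTrunc_surjective N (proj m n N y)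
  rw [← hx]
  exact (all x).eq.symm

end Truncation

end DoubleYangian

end

theorem proposition3p5 (m n : ℕ) :
    IsUnit (DoubleYangian.Tplus m n) ∧ IsUnit (DoubleYangian.Tminus m n) ∧
    (∀ r : ℕ, PowerSeries.coeff r (DoubleYangian.bPlus m n) ∈
      Subalgebra.center (PowerSeries ℂ) (DoubleYangian.DY m n)) ∧
    (∀ r : ℕ, PowerSeries.coeff r (DoubleYangian.bMinus m n) ∈
      Subalgebra.center (PowerSeries ℂ) (DoubleYangian.DY m n)) :=
  ⟨DoubleYangian.isUnit_genMatrix .plus, DoubleYangian.isUnit_genMatrix .minus,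
    DoubleYangian.coeff_berezinian_mem_center .plus,
    DoubleYangian.coeff_berezinian_mem_center .minus⟩
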